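/- Let $d\ge 1$ and $b\ge 2$ be integers, $X=\mathbb R^d$, $\mathcal L(X)$ the space of linear maps $X\to X$, and $\mathcal O(X)$ its dual space, the space of linear observables $H:\mathcal L(X)\to\mathbb R$. Let $\phi$ be a linear flow on $X$, i.e. a continuous map $\phi:\mathbb R\times X\to X$ with $\phi_0=\mathrm{id}$ and $\phi_{s}\circ\phi_t=\phi_{s+t}$ for all $s,t\in\mathbb R$, such that each $\phi_t=\phi(t,\cdot)$ is linear. Then the following are equivalent: (i) the dominant spectrum $\sigma_{\rm dom}(\phi)$ is exponentially $b$-nonresonant; (ii) for Lebesgue-almost every $H\in\mathcal O(X)\cong\mathbb R^{d^2}$ the function $t\mapsto H(\phi_t)$, $t \ge 0$, is $b$-Benford. Here the following notions are used. Let $A=\frac{d}{dt}\phi_t|_{t=0}$ be the generator of $\phi$, so that $\phi_t=e^{tA}$, and let $\sigma(A)\subset\mathbb C$ be its set of (complex) eigenvalues. For $z\in\sigma(A)$ let $k_z\ge 0$ be the largest integer $k$ with $\mathrm{rank}\,B_z^{k+1}<\mathrm{rank}\,B_z^{k}$, where $B_z=A-zI$ if $z\in\mathbb R$ and $B_z=A^2-2(\mathrm{Re}\,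 z)A+|z|^2I$ otherwise; thus $k_z+1$ is the size of the largest Jordan block of $A$ over $\mathbb C$ for the eigenvalue $z$. Then $\sigma_{\rm dom}(\phi)$ is the set of all $z\in\sigma(A)$ for which $(\mathrm{Re}\, z,k_z)$ is maximal in the lexicographic order among all eigenvalues. With $\arg z \in(-\pi,\pi]$, a set $Z\subset\mathbb C$ is $b$-nonresonant if for every $r>0$ the set $Y=Z\cap\{|z|=r\}$ is either empty, or else the set $\Delta_{Y}=\{1+\frac{\arg z-\arg w}{2\pi}:z,w\in Y\}$ satisfies $\Delta_Y\cap\mathbb Q=\{1\}$ and $\log_b r\notin\mathrm{span}_{\mathbb Q}\Delta_Y$. The set $Z$ is exponentially $b$-nonresonant if $e^{tZ}=\{e^{tz}:z\in Z\}$ is $b$-nonresonant for some $t\ge 0$. For $x\in\mathbb R\setminus\{0\}$, let $S_b(x)\in[1,b)$ be the unique number with $|x|=S_b(x)b^k$ for some integer $k$, and let $S_b(0)=0$. A Borel measurable function $f:[0,\infty)\to\mathbb R$ is $b$-Benford if $\lim_{T\to\infty}\frac1T\lambda(\{0\le t\le T:S_b(f(t))\le s\})=\log_b s$ for every $s\in[1,b)$,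 where $\lambda$ is Lebesgue measure. -/

import Mathlib

open Set Filter Topology MeasureTheory

noncomputable section

/-! ### Linear flows on `ℝ^d` and linear observables -/

/-- The phase space `X = ℝ^d`. -/
abbrev PhaseSpace (d : ℕ) : Type := EuclideanSpace ℝ (Fin d)

/-- The space `𝓛(X)` of all linear maps `X → X`. As `X` is finite-dimensional, every linear map
is continuous; the bundled continuous maps carry the usual topology. -/
abbrev LinMaps (d : ℕ) : Type := PhaseSpace d →L[ℝ] PhaseSpace d

/-- The space `𝓞(X)` of linear observables, i.e. the dual space of `𝓛(X)`, with its usual topology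
and Borel sigma-algebra (again, every linear functional on `𝓛(X)` is continuous). -/
abbrev LinObservable (d : ℕ) : Type := LinMaps d →L[ℝ] ℝ

/-- A linear flow on `X`: a (continuous) flow all of whose time-`t` maps are linear. -/
structure LinearFlow (d : ℕ) extends Flow ℝ (PhaseSpace d) where
  isLinear : ∀ t : ℝ, IsLinearMap ℝ (toFun t)

namespace LinearFlow

variable {d : ℕ}

/-- The time-`t` map `φ_t` as an element of `𝓛(X)`. -/
def timeMap (φ : LinearFlow d) (t : ℝ) : LinMaps d where
  toLinearMap := (φ.isLinear t).mk'
  cont := φ.toFlow.continuous_toFun t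

/-- The generator `A_φ = d/dt φ_t |_{t = 0}` of the linear flow, so that `φ_t = exp (t A_φ)`.
(The derivative exists for every linear flow.) -/
def generator (φ : LinearFlow d) : LinMaps d := deriv φ.timeMap 0

end LinearFlow

/-! ### Spectrum and dominant spectrum -/

/-- The spectrum `σ(A) ⊆ ℂ`: the eigenvalues of the complexification of `A`. -/
def cSpectrum {d : ℕ} (A : LinMaps d) : Set ℂ :=
  {z | Module.End.HasEigenvalue (LinearMap.baseChange ℂ (A : PhaseSpace d →ₗ[ℝ] PhaseSpace d)) z}

/-- `A - z I` if `z` is real, and `A² - 2 (Re z) A + |z|² I` otherwise. -/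
def realFactor {d : ℕ} (A : LinMaps d) (z : ℂ) : LinMaps d :=
  if z.im = 0 then A - z.re • (1 : LinMaps d)
  else A ^ 2 - (2 * z.re) • A + (‖z‖ ^ 2) • (1 : LinMaps d)

/-- `k_z`: the largest `k ≥ 0` at which the rank of the powers of `realFactor A z` drops from `k`
to `k + 1`. The set below is bounded, and it contains `0` when `z ∈ σ(A)`; then `k_z + 1` is the
size of the largest Jordan block of `A` (over `ℂ`) for the eigenvalue `z`. -/
def blockIndex {d : ℕ} (A : LinMaps d) (z : ℂ) : ℕ :=
  sSup {k : ℕ |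
    Module.finrank ℝ ((realFactor A z ^ (k + 1) : LinMaps d) :
        PhaseSpace d →ₗ[ℝ] PhaseSpace d).range <
      Module.finrank ℝ ((realFactor A z ^ k : LinMaps d) :
        PhaseSpace d →ₗ[ℝ] PhaseSpace d).range}

/-- The dominant spectrum `σ_dom(A)`: all `z ∈ σ(A)` for which `(Re z, k_z)` is maximal in the
lexicographic order. -/
def domSpectrum {d : ℕ} (A : LinMaps d) : Set ℂ :=
  {z | z ∈ cSpectrum A ∧
    ∀ w ∈ cSpectrum A, toLex (w.re, blockIndex A w) ≤ toLex (z.re, blockIndex A z)}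

/-- The dominant spectrum `σ_dom(φ) = σ_dom(A_φ)` of a linear flow. -/
def LinearFlow.domSpectrum {d : ℕ} (φ : LinearFlow d) : Set ℂ :=
  _root_.domSpectrum φ.generator

/-! ### Nonresonance -/

/-- The set `Δ_Z = {1 + (arg z - arg w) / (2π) : z, w ∈ Z}`. -/
def argDiffSet (Z : Set ℂ) : Set ℝ :=
  {x | ∃ z ∈ Z, ∃ w ∈ Z, x = 1 + (Complex.arg z - Complex.arg w) / (2 * Real.pi)}

/-- `b`-nonresonance of a set `Z ⊆ ℂ`: for every `r > 0` the set `Y = Z ∩ {|z| = r}` is empty, or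
else `Δ_Y ∩ ℚ = {1}` and `log_b r` is not in the `ℚ`-linear span of `Δ_Y`. -/
def IsNonresonant (b : ℕ) (Z : Set ℂ) : Prop :=
  ∀ r : ℝ, 0 < r → (Z ∩ Metric.sphere (0 : ℂ) r).Nonempty →
    argDiffSet (Z ∩ Metric.sphere (0 : ℂ) r) ∩ Set.range (fun q : ℚ => (q : ℝ)) = {1} ∧
    Real.logb b r ∉ Submodule.span ℚ (argDiffSet (Z ∩ Metric.sphere (0 : ℂ) r))

/-- Exponential `b`-nonresonance: `e^{tZ} = {e^{tz} : z ∈ Z}` is `b`-nonresonant for some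
`t ≥ 0`. -/
def IsExpNonresonant (b : ℕ) (Z : Set ℂ) : Prop :=
  ∃ t : ℝ, 0 ≤ t ∧ IsNonresonant b ((fun z : ℂ => Complex.exp ((t : ℂ) * z)) '' Z)

/-! ### Benford functions -/

/-- The significand base `b`: `S_b(0) = 0`, and for `x ≠ 0` the number `S_b(x) ∈ [1, b)` with
`|x| = S_b(x) b^k` for an integer `k`, namely for the `k` with `b^k ≤ |x| < b^(k+1)`. -/
def significand (b : ℕ) (x : ℝ) : ℝ := |x| / (b : ℝ) ^ Int.log b |x|

theorem significand_zero (b : ℕ) : significand b 0 = 0 := by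
  simp [significand]

theorem significand_spec {b : ℕ} (hb : 2 ≤ b) {x : ℝ} (hx : x ≠ 0) :
    1 ≤ significand b x ∧ significand b x < b ∧ ∃ k : ℤ, |x| = significand b x * (b : ℝ) ^ k := by
  have hx' : 0 < |x| := abs_pos.mpr hx
  have hb0 : (0 : ℝ) < b := by positivity
  have hp : 0 < (b : ℝ) ^ Int.log b |x| := zpow_pos hb0 _
  refine ⟨?_, ?_, Int.log b |x|, ?_⟩
  · rw [significand, le_div_iff₀ hp, one_mul]
    exact Int.zpow_log_le_self (by omega) hx'
  · rw [significand, div_lt_iff₀ hp]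
    have h := Int.lt_zpow_succ_log_self (b := b) (by omega) |x|
    rwa [zpow_add_one₀ hb0.ne', mul_comm] at h
  · rw [significand, div_mul_cancel₀ _ hp.ne']

/-- A function `f`, considered on `[0, ∞)`, is `b`-Benford: it is Borel measurable there and
`λ {t ≤ T : S_b(f(t)) ≤ s} / T → log_b s` as `T → ∞`, for all `s ∈ [1, b)`. -/
def IsBenford (b : ℕ) (f : ℝ → ℝ) : Prop :=
  Measurable ((Set.Ici (0 : ℝ)).domRestrict f) ∧
  ∀ s ∈ Set.Ico (1 : ℝ) b,
    Tendsto (fun T : ℝ =>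
        volume.real {t : ℝ | 0 ≤ t ∧ t ≤ T ∧ significand b (f t) ≤ s} / T)
      atTop (𝓝 (Real.logb b s))

end

open ProbabilityTheory
open scoped TensorProduct

/-! Let `(ρ, k)` be the maximal pair that defines the dominant spectrum and `W` the set of imaginary
parts of that spectrum, which is finite and symmetric. By Jordan theory, `H(φ_t) = e^{ρt} t^k
(P_H(t) + o(1))` with a real trigonometric polynomial `P_H` whose frequencies lie in `W`
(`exists_trigPoly_scaled`). Exponential nonresonance says that `ρ / log b` is not in the rational
span of `W / 2π` (`isExpNonresonant_iff`). By Weyl's criterion (`isBenford_iff`), the Benford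
property says that the time mean of `|H(φ_t)|^{is}` tends to 0 for every `s = 2πn / log b`, `n ≠ 0`.
Away from the times at which `P_H` is small, this function behaves like `t^{isk} e^{isρt}
|P_H(t)|^{is}`. The slowly varying factor `t^{isk}` is absorbed into twisted means, under which
`e^{iwt}` still has limit 1 if `w = 0` and 0 otherwise.

Sufficiency. If `P_H` is small only on sets of times of small density, then `|P_H|^{is}` is a limit
in mean of trigonometric polynomials with frequencies in the group generated by `W`; the mean
vanishes unless `sρ` belongs to that group, which the span condition excludes. That almost every `H`
has this property (`ae_rarelySmall`) is seen by perturbing `H` to `H + p₁ H₁ + p₂ H₂`, where the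
signals of `H₁`, `H₂` are asymptotically `cos θt`, `sin θt`. For Gaussian `p` the perturbation is
standard normal at every time, whatever the phase, so small values are improbable uniformly in `t`;
Fubini transfers this to Lebesgue measure.

Necessity. If there is a resonance, choose `n` such that `sρ = 2v` with `v` in the group generated
by `W`. If almost every signal is Benford, averaging over Gaussian perturbations replaces `|x|^{is}`
by its Gaussian average `G`, which is bounded, even, and the restriction of an entire function. By
density and continuity the twisted mean of `e^{2ivt} G(εP(t))` vanishes for `P = ∑ cos wt` over `w ∈
W` and every real `ε`. Comparing powers of `ε` gives `a_n M_n = 0`, with `a_n` the Taylor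
coefficients of `G` and `M_n` the number of `n`-tuples in `W` with sum `-2v`, which is positive for
all large even `n`. Hence `G` is a bounded polynomial, so constant, whereas `G(x)` is asymptotic to
the oscillating `|x|^{is}`. -/

/-! ### Kernels, base change and rank drops -/

/-- Over a field, the inclusion of kernels means that `g` factors through `f`, and a factorization
survives base change. The converse restricts to the vectors `1 ⊗ x`, on which `V` embeds. -/
theorem LinearMap.ker_le_ker_iff_baseChange {V : Type*} [AddCommGroup V] [Module ℝ V]
    (f g : V →ₗ[ℝ] V) :
    f.ker ≤ g.ker ↔ (f.baseChange ℂ).ker ≤ (g.baseChange ℂ).ker := by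
  constructor
  · intro h
    obtain ⟨p, hp⟩ := LinearMap.exists_extend
      ((f.ker.liftQ g h).comp (f.quotKerEquivRange.symm : f.range →ₗ[ℝ] V ⧸ f.ker))
    have hgf : g = p.comp f := by
      ext x
      have h1 := LinearMap.congr_fun hp ⟨f x, LinearMap.mem_range_self f x⟩
      simp only [LinearMap.comp_apply, Submodule.subtype_apply, LinearEquiv.coe_coe] at h1 ⊢
      rw [h1]
      have h2 : f.quotKerEquivRange.symm ⟨f x, LinearMap.mem_range_self f x⟩
          = f.ker.mkQ x := by
        rw [LinearEquiv.symm_apply_eq]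
        ext
        simp
      rw [h2]
      simp
    intro x hx
    rw [LinearMap.mem_ker] at hx ⊢
    rw [hgf, LinearMap.baseChange_comp, LinearMap.comp_apply, hx, map_zero]
  · intro h x hx
    rw [LinearMap.mem_ker] at hx ⊢
    have h1 : (1 : ℂ) ⊗ₜ[ℝ] x ∈ (f.baseChange ℂ).ker := by
      rw [LinearMap.mem_ker, LinearMap.baseChange_tmul, hx, TensorProduct.tmul_zero]
    have h2 := h h1
    rw [LinearMap.mem_ker, LinearMap.baseChange_tmul] at h2
    have hinj := Module.Flat.rTensor_preserves_injective_linearMap (M := V)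
      (Algebra.linearMap ℝ ℂ) (algebraMap ℝ ℂ).injective
    have h3 : (1 : ℝ) ⊗ₜ[ℝ] g x = 0 := by
      apply hinj
      simpa using h2
    have h4 := congrArg (TensorProduct.lid ℝ V) h3
    simpa using h4

namespace Module.End

variable {K V : Type*} [Field K] [AddCommGroup V] [Module K V]

/-- The set of exponents at which the rank of the powers of an endomorphism drops. -/
def rankDrops (f : Module.End K V) : Set ℕ :=
  {k | finrank K (f ^ (k + 1)).range < finrank K (f ^ k).range}

theorem ker_pow_mono (f : Module.End K V) {m n : ℕ} (h : m ≤ n) : (f ^ m).ker ≤ (f ^ n).ker := by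
  intro x hx
  rw [LinearMap.mem_ker] at hx ⊢
  obtain ⟨j, rfl⟩ := Nat.exists_eq_add_of_le' h
  rw [pow_add, Module.End.mul_apply, hx, map_zero]

variable [FiniteDimensional K V]

theorem mem_rankDrops_iff (f : Module.End K V) (k : ℕ) :
    k ∈ rankDrops f ↔ ¬ (f ^ (k + 1)).ker ≤ (f ^ k).ker := by
  have h1 := LinearMap.finrank_range_add_finrank_ker (f ^ (k + 1))
  have h2 := LinearMap.finrank_range_add_finrank_ker (f ^ k)
  have h3 := ker_pow_mono f (Nat.le_succ k)
  have h4 := Submodule.finrank_mono h3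
  simp only [rankDrops, mem_ofPred_eq]
  constructor
  · intro h hle
    have := Submodule.finrank_mono hle
    simp only [Nat.succ_eq_add_one] at *
    omega
  · intro h
    have h5 : finrank K (f ^ k).ker < finrank K (f ^ (k + 1)).ker :=
      Submodule.finrank_lt_finrank_of_lt (lt_of_le_not_ge h3 h)
    omega

theorem bddAbove_rankDrops (f : Module.End K V) : BddAbove (rankDrops f) := by
  obtain ⟨n, hn⟩ := monotone_stabilizes_iff_noetherian.mpr
    (inferInstance : IsNoetherian K V) ⟨fun k => (f ^ k).ker, fun _ _ h => ker_pow_mono f h⟩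
  refine ⟨n, fun k hk => ?_⟩
  by_contra! hlt
  rw [mem_rankDrops_iff] at hk
  apply hk
  have e1 : (f ^ n).ker = (f ^ k).ker := hn k hlt.le
  have e2 : (f ^ n).ker = (f ^ (k + 1)).ker := hn (k + 1) (by omega)
  rw [← e1, ← e2]

/-- The kernels grow only at a rank drop, so the chain is constant after the last one. -/
theorem ker_pow_le_of_sSup_lt (f : Module.End K V) {m : ℕ} :
    (f ^ m).ker ≤ (f ^ (sSup (rankDrops f) + 1)).ker := by
  induction m with
  | zero => exact ker_pow_mono f (Nat.zero_le _)
  | succ m ih =>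
    by_cases h : m + 1 ≤ sSup (rankDrops f) + 1
    · exact ker_pow_mono f h
    · have : m ∉ rankDrops f := fun hm => by
        have := le_csSup (bddAbove_rankDrops f) hm
        omega
      rw [mem_rankDrops_iff, not_not] at this
      exact this.trans ih

/-- A nontrivial kernel makes `0` a rank drop; without any drop, `sSup ∅ = 0` would be a spurious
value. -/
theorem sSup_rankDrops_mem (f : Module.End K V) (h : f.ker ≠ ⊥) :
    sSup (rankDrops f) ∈ rankDrops f := by
  refine Nat.sSup_mem ⟨0, ?_⟩ (bddAbove_rankDrops f)
  rw [mem_rankDrops_iff]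
  simpa [Module.End.one_eq_id] using h

end Module.End

/-! ### Complexification, conjugation and Jordan chains -/

/-- Complexification of a linear map on `ℝ^d`. -/
noncomputable def complexify {d : ℕ} (A : LinMaps d) : Module.End ℂ (ℂ ⊗[ℝ] PhaseSpace d) :=
  LinearMap.baseChange ℂ (A : PhaseSpace d →ₗ[ℝ] PhaseSpace d)

theorem complexify_eq_hom {d : ℕ} (A : LinMaps d) :
    complexify A = Module.End.baseChangeHom ℝ ℂ (PhaseSpace d)
      (A : Module.End ℝ (PhaseSpace d)) := rfl

theorem coe_pow_linMaps {d : ℕ} (A : LinMaps d) (k : ℕ) :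
    ((A ^ k : LinMaps d) : PhaseSpace d →ₗ[ℝ] PhaseSpace d)
      = (A : Module.End ℝ (PhaseSpace d)) ^ k := by
  exact ContinuousLinearMap.toLinearMap_pow A k

theorem complexify_mul {d : ℕ} (A B : LinMaps d) :
    complexify (A * B) = complexify A * complexify B := by
  rw [complexify_eq_hom, complexify_eq_hom, complexify_eq_hom, ← map_mul]
  rfl

theorem complexify_add {d : ℕ} (A B : LinMaps d) :
    complexify (A + B) = complexify A + complexify B := by
  rw [complexify_eq_hom, complexify_eq_hom, complexify_eq_hom, ← map_add]
  rfl

theorem complexify_sub {d : ℕ} (A B : LinMaps d) :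
    complexify (A - B) = complexify A - complexify B := by
  rw [complexify_eq_hom, complexify_eq_hom, complexify_eq_hom, ← map_sub]
  rfl

theorem complexify_smul {d : ℕ} (r : ℝ) (A : LinMaps d) :
    complexify (r • A) = (r : ℂ) • complexify A := by
  have : complexify (r • A) = r • complexify A := by
    rw [complexify_eq_hom, complexify_eq_hom, ← map_smul]
    rfl
  rw [this]
  rfl

theorem complexify_one {d : ℕ} : complexify (1 : LinMaps d) = 1 := by
  rw [complexify_eq_hom]
  exact map_one _

theorem complexify_pow {d : ℕ} (A : LinMaps d) (k : ℕ) :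
    complexify (A ^ k) = complexify A ^ k := by
  induction k with
  | zero => simp [complexify_one]
  | succ k ih => rw [pow_succ, complexify_mul, ih, pow_succ]

/-- The kernels of the powers of `A` and of its complexification drop simultaneously. -/
theorem rankDrops_complexify {d : ℕ} (A : LinMaps d) :
    Module.End.rankDrops (complexify A)
      = {k : ℕ | Module.finrank ℝ ((A ^ (k + 1) : LinMaps d) :
        PhaseSpace d →ₗ[ℝ] PhaseSpace d).range <
      Module.finrank ℝ ((A ^ k : LinMaps d) :
        PhaseSpace d →ₗ[ℝ] PhaseSpace d).range} := by
  ext k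
  have h := Module.End.mem_rankDrops_iff (A : Module.End ℝ (PhaseSpace d)) k
  rw [Module.End.mem_rankDrops_iff, mem_ofPred_eq, coe_pow_linMaps, coe_pow_linMaps]
  refine Iff.trans ?_ h.symm
  rw [LinearMap.ker_le_ker_iff_baseChange, LinearMap.baseChange_pow, LinearMap.baseChange_pow]
  rfl

theorem blockIndex_eq {d : ℕ} (A : LinMaps d) (z : ℂ) :
    blockIndex A z = sSup (Module.End.rankDrops (complexify (realFactor A z))) := by
  rw [rankDrops_complexify]
  rfl

/-- Complex conjugation on the complexification of `ℝ^d`. -/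
noncomputable def conjTensor (d : ℕ) : (ℂ ⊗[ℝ] PhaseSpace d) →ₗ[ℝ] (ℂ ⊗[ℝ] PhaseSpace d) :=
  LinearMap.rTensor (PhaseSpace d) (Complex.conjAe.toLinearMap)

theorem conjTensor_smul {d : ℕ} (z : ℂ) (v : ℂ ⊗[ℝ] PhaseSpace d) :
    conjTensor d (z • v) = (starRingEnd ℂ z) • conjTensor d v := by
  induction v with
  | zero => simp
  | tmul a x => simp [conjTensor, TensorProduct.smul_tmul']
  | add x y hx hy => simp only [smul_add, map_add, hx, hy]

theorem conjTensor_complexify {d : ℕ} (A : LinMaps d) (v : ℂ ⊗[ℝ] PhaseSpace d) :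
    conjTensor d (complexify A v) = complexify A (conjTensor d v) := by
  induction v with
  | zero => simp
  | tmul a x => simp [conjTensor, complexify]
  | add x y hx hy => simp only [map_add, hx, hy]

theorem conjTensor_conjTensor {d : ℕ} (v : ℂ ⊗[ℝ] PhaseSpace d) :
    conjTensor d (conjTensor d v) = v := by
  induction v with
  | zero => simp
  | tmul a x => simp [conjTensor]
  | add x y hx hy => simp only [map_add, hx, hy]

theorem conjTensor_pow {d : ℕ} (A : LinMaps d) (z : ℂ) (n : ℕ) (v : ℂ ⊗[ℝ] PhaseSpace d) :
    conjTensor d (((complexify A - z • (1 : Module.End ℂ (ℂ ⊗[ℝ] PhaseSpace d))) ^ n) v)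
      = ((complexify A - (starRingEnd ℂ z) • (1 : Module.End ℂ (ℂ ⊗[ℝ] PhaseSpace d))) ^ n)
        (conjTensor d v) := by
  induction n generalizing v with
  | zero => simp
  | succ n ih =>
    rw [pow_succ, pow_succ, Module.End.mul_apply, Module.End.mul_apply, ih]
    congr 1
    simp [conjTensor_smul, conjTensor_complexify]

theorem mem_cSpectrum_conj {d : ℕ} {A : LinMaps d} {z : ℂ} (h : z ∈ cSpectrum A) :
    starRingEnd ℂ z ∈ cSpectrum A := by
  obtain ⟨v, hv⟩ := Module.End.HasEigenvalue.exists_hasEigenvector h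
  have hv1 := hv.apply_eq_smul
  have hv2 := hv.2
  refine Module.End.hasEigenvalue_of_hasEigenvector (x := conjTensor d v) ⟨?_, ?_⟩
  · rw [Module.End.mem_eigenspace_iff]
    have := conjTensor_complexify A v
    rw [show complexify A v = z • v from hv1, conjTensor_smul] at this
    exact this.symm
  · intro h0
    apply hv2
    rw [← conjTensor_conjTensor v, h0, map_zero]

theorem realFactor_conj {d : ℕ} (A : LinMaps d) (z : ℂ) :
    realFactor A (starRingEnd ℂ z) = realFactor A z := by
  simp [realFactor]

theorem domSpectrum_conj {d : ℕ} {A : LinMaps d} {z : ℂ} (h : z ∈ domSpectrum A) :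
    starRingEnd ℂ z ∈ domSpectrum A := by
  refine ⟨mem_cSpectrum_conj h.1, fun w hw => ?_⟩
  have : blockIndex A (starRingEnd ℂ z) = blockIndex A z := by
    rw [blockIndex_eq, blockIndex_eq, realFactor_conj]
  rw [this, Complex.conj_re]
  exact h.2 w hw

theorem complexify_realFactor_of_real {d : ℕ} (A : LinMaps d) {z : ℂ} (hz : z.im = 0) :
    complexify (realFactor A z) = complexify A - z • 1 := by
  rw [realFactor, if_pos hz, complexify_sub, complexify_smul, complexify_one]
  congr 2
  exact Complex.ext (by simp) (by simp [hz])

theorem complexify_realFactor_of_not_real {d : ℕ} (A : LinMaps d) {z : ℂ} (hz : z.im ≠ 0) :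
    complexify (realFactor A z)
      = (complexify A - (starRingEnd ℂ z) • 1) * (complexify A - z • 1) := by
  rw [realFactor, if_neg hz, complexify_add, complexify_sub, complexify_smul, complexify_smul,
    complexify_one, complexify_pow]
  have h1 : (((2 * z.re : ℝ) : ℂ)) = starRingEnd ℂ z + z := by
    rw [add_comm, Complex.add_conj]
  have h2 : (((‖z‖ ^ 2 : ℝ)) : ℂ) = starRingEnd ℂ z * z := by
    rw [mul_comm, Complex.mul_conj, Complex.normSq_eq_norm_sq]
  rw [h1, h2, sub_mul, mul_sub, mul_sub, pow_two]
  simp only [smul_mul_assoc, mul_smul_comm, one_mul, mul_one, add_smul, mul_smul]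
  rw [smul_comm z (starRingEnd ℂ z)]
  abel

theorem complexify_realFactor_ker_ne_bot {d : ℕ} {A : LinMaps d} {z : ℂ} (h : z ∈ cSpectrum A) :
    (complexify (realFactor A z)).ker ≠ ⊥ := by
  obtain ⟨v, hv⟩ := Module.End.HasEigenvalue.exists_hasEigenvector h
  have hv1 : complexify A v = z • v := hv.apply_eq_smul
  intro hbot
  apply hv.2
  rw [← Submodule.mem_bot ℂ, ← hbot, LinearMap.mem_ker]
  by_cases hz : z.im = 0
  · rw [complexify_realFactor_of_real A hz]
    simp [hv1]
  · rw [complexify_realFactor_of_not_real A hz, Module.End.mul_apply]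
    simp [hv1]

theorem commute_sub_smul_one {V : Type*} [AddCommGroup V] [Module ℂ V] (T : Module.End ℂ V)
    (z w : ℂ) : Commute (T - z • 1) (T - w • 1) := by
  refine Commute.sub_left ?_ ?_
  · exact (Commute.refl T).sub_right ((Commute.one_right T).smul_right w)
  · exact ((Commute.one_left _).smul_left z)

theorem eq_zero_of_sub_smul_pow {V : Type*} [AddCommGroup V] [Module ℂ V] (T : Module.End ℂ V)
    {z w : ℂ} (hzw : z ≠ w) {m n : ℕ} {v : V} (hm : ((T - z • 1) ^ m) v = 0)
    (hn : ((T - w • 1) ^ n) v = 0) : v = 0 := by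
  have hd := Module.End.disjoint_genEigenspace T hzw m n
  rw [Submodule.disjoint_def] at hd
  exact hd v ((Module.End.mem_genEigenspace_nat).mpr hm) ((Module.End.mem_genEigenspace_nat).mpr hn)

/-- All generalized eigenvectors for `z` are killed by the power `blockIndex A z + 1`. -/
theorem sub_smul_pow_blockIndex_eq_zero {d : ℕ} (A : LinMaps d) (z : ℂ) {m : ℕ}
    {v : ℂ ⊗[ℝ] PhaseSpace d} (hv : ((complexify A - z • 1) ^ m) v = 0) :
    ((complexify A - z • 1) ^ (blockIndex A z + 1)) v = 0 := by
  have hk := Module.End.ker_pow_le_of_sSup_lt (complexify (realFactor A z)) (m := m)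
  rw [← blockIndex_eq] at hk
  by_cases hz : z.im = 0
  · rw [complexify_realFactor_of_real A hz] at hk
    exact hk hv
  · rw [complexify_realFactor_of_not_real A hz] at hk
    have hc := commute_sub_smul_one (complexify A) (starRingEnd ℂ z) z
    have h1 : v ∈ (((complexify A - starRingEnd ℂ z • 1) * (complexify A - z • 1)) ^ m).ker := by
      rw [LinearMap.mem_ker, hc.mul_pow, Module.End.mul_apply, hv, map_zero]
    have h2 := hk h1
    rw [LinearMap.mem_ker, hc.mul_pow, Module.End.mul_apply] at h2
    -- The vector `(A - z)^(k_z + 1) v` is a generalized eigenvector for both `z` and its conjugate,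
    -- hence zero.
    refine eq_zero_of_sub_smul_pow (complexify A) (z := starRingEnd ℂ z) (w := z) ?_ h2 (n := m) ?_
    · intro h
      exact hz (Complex.conj_eq_iff_im.mp h)
    · rw [← Module.End.mul_apply, ← pow_add, add_comm, pow_add, Module.End.mul_apply, hv, map_zero]

/-- Some Jordan chain for the eigenvalue `z` has length `blockIndex A z + 1`. -/
theorem exists_jordan_chain {d : ℕ} (A : LinMaps d) {z : ℂ} (hz : z ∈ cSpectrum A) :
    ∃ v : ℂ ⊗[ℝ] PhaseSpace d, ((complexify A - z • 1) ^ (blockIndex A z + 1)) v = 0 ∧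
      ((complexify A - z • 1) ^ (blockIndex A z)) v ≠ 0 := by
  have hm := Module.End.sSup_rankDrops_mem _ (complexify_realFactor_ker_ne_bot hz)
  rw [← blockIndex_eq, Module.End.mem_rankDrops_iff, SetLike.not_le_iff_exists] at hm
  obtain ⟨v, hv1, hv2⟩ := hm
  rw [LinearMap.mem_ker] at hv1 hv2
  set K := blockIndex A z
  by_cases him : z.im = 0
  · rw [complexify_realFactor_of_real A him] at hv1 hv2
    exact ⟨v, hv1, hv2⟩
  · rw [complexify_realFactor_of_not_real A him] at hv1 hv2
    have hc := commute_sub_smul_one (complexify A) (starRingEnd ℂ z) z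
    set S := complexify A - starRingEnd ℂ z • 1 with hS
    set R := complexify A - z • 1 with hR
    -- Here `(S R)^(K+1)` kills `v` and `(S R)^K` does not. Either `S^(K+1) v` is the required chain
    -- for `z`, or `S` kills `(S R)^K v`. In the latter case `R` acts on that vector as the nonzero
    -- scalar `z̄ - z`, which makes `R^(K+1) v` a chain of full length for `z̄`; conjugation carries
    -- it to `z`.
    by_cases h0 : (R ^ K) ((S ^ (K + 1)) v) = 0
    · have e : S (((S * R) ^ K) v) = 0 := by
        rw [← h0, ← Module.End.mul_apply, ← Module.End.mul_apply, hc.mul_pow, ← mul_assoc,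
          ← pow_succ', (hc.pow_pow _ _).eq]
      have e2 : (S ^ K) ((R ^ (K + 1)) v) = (starRingEnd ℂ z - z) • ((S * R) ^ K) v := by
        have e3 : R (((S * R) ^ K) v) = (starRingEnd ℂ z - z) • ((S * R) ^ K) v := by
          have : R = S + (starRingEnd ℂ z - z) • 1 := by
            rw [hS, hR]; module
          rw [this] at e ⊢
          rw [LinearMap.add_apply, e]
          simp
        rw [← e3, ← Module.End.mul_apply, ← Module.End.mul_apply, hc.mul_pow, ← mul_assoc,
          ← (hc.pow_left K).eq, mul_assoc, ← pow_succ']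
      refine ⟨conjTensor d ((R ^ (K + 1)) v), ?_, ?_⟩
      · have := conjTensor_pow A (starRingEnd ℂ z) (K + 1) ((R ^ (K + 1)) v)
        rw [Complex.conj_conj] at this
        rw [← this]
        rw [← hS, ← Module.End.mul_apply, ← hc.mul_pow, hv1, map_zero]
      · have := conjTensor_pow A (starRingEnd ℂ z) K ((R ^ (K + 1)) v)
        rw [Complex.conj_conj] at this
        rw [← this, ← hS, e2]
        intro h
        have h' := congrArg (conjTensor d) h
        rw [conjTensor_conjTensor, map_zero, smul_eq_zero] at h'
        rcases h' with h' | h'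
        · exact him (Complex.conj_eq_iff_im.mp (sub_eq_zero.mp h'))
        · exact hv2 h'
    · refine ⟨(S ^ (K + 1)) v, ?_, h0⟩
      rw [← Module.End.mul_apply, ← (hc.pow_pow _ _).eq, ← hc.mul_pow, hv1]

theorem domSpectrum_nonempty {d : ℕ} (hd : 1 ≤ d) (A : LinMaps d) : (domSpectrum A).Nonempty := by
  have : Nonempty (Fin d) := ⟨⟨0, hd⟩⟩
  have : Nontrivial (ℂ ⊗[ℝ] PhaseSpace d) := by
    apply Module.nontrivial_of_finrank_pos (R := ℂ)
    rw [Module.finrank_baseChange]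
    exact Module.finrank_pos
  have hfin : (cSpectrum A).Finite := Module.End.finite_hasEigenvalue _
  have hne : (cSpectrum A).Nonempty := Module.End.exists_eigenvalue (complexify A)
  obtain ⟨z, hz, hmax⟩ := Set.exists_max_image (cSpectrum A)
    (fun w => toLex (w.re, blockIndex A w)) hfin hne
  exact ⟨z, hz, hmax⟩

theorem finite_domSpectrum {d : ℕ} (A : LinMaps d) : (domSpectrum A).Finite :=
  (Module.End.finite_hasEigenvalue _ : (cSpectrum A).Finite).subset fun _ h => h.1

theorem domSpectrum_eq {d : ℕ} {A : LinMaps d} {z w : ℂ} (hz : z ∈ domSpectrum A)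
    (hw : w ∈ domSpectrum A) : w.re = z.re ∧ blockIndex A w = blockIndex A z := by
  have h := le_antisymm (hz.2 w hw.1) (hw.2 z hz.1)
  have := toLex.injective h
  simpa using this

/-! ### Differentiability of the flow -/

/-- A continuous one-parameter semigroup in a Banach algebra is differentiable at `0`. -/
theorem differentiableAt_zero_of_continuous_of_map_add {𝔸 : Type*} [NormedRing 𝔸]
    [NormedAlgebra ℝ 𝔸] [CompleteSpace 𝔸] {E : ℝ → 𝔸} (hc : Continuous E) (h0 : E 0 = 1)
    (hadd : ∀ s t, E (s + t) = E s * E t) : DifferentiableAt ℝ E 0 := by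
  have hF : ∀ x, HasDerivAt (fun h => ∫ s in (0 : ℝ)..h, E s) (E x) x := fun x =>
    intervalIntegral.integral_hasDerivAt_right (hc.intervalIntegrable _ _)
      (hc.stronglyMeasurableAtFilter _ _) hc.continuousAt
  have hslope := (hasDerivAt_iff_tendsto_slope.mp (hF 0))
  rw [h0] at hslope
  -- The average of `E` over `[0, h]` tends to `1`, hence is a unit for some `h ≠ 0`. By the
  -- semigroup law, `E t` times this average is a difference of integrals, differentiable in `t`;
  -- dividing by the unit gives the differentiability of `E`.
  have hunit : ∀ᶠ h in 𝓝[≠] (0 : ℝ), IsUnit (slope (fun h => ∫ s in (0 : ℝ)..h, E s) 0 h) :=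
    hslope.eventually (Units.isOpen.mem_nhds (isUnit_one (M := 𝔸)))
  obtain ⟨h, hu, hne⟩ := (hunit.and self_mem_nhdsWithin).exists
  set V := slope (fun h => ∫ s in (0 : ℝ)..h, E s) 0 h with hV
  have hVeq : V = h⁻¹ • ∫ s in (0 : ℝ)..h, E s := by
    rw [hV, slope_def_module]
    simp
  have key : ∀ t, E t * V
      = h⁻¹ • ((∫ s in (0 : ℝ)..(t + h), E s) - ∫ s in (0 : ℝ)..t, E s) := by
    intro t
    rw [hVeq, mul_smul_comm]
    congr 1
    rw [intervalIntegral.integral_interval_sub_left (hc.intervalIntegrable _ _)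
      (hc.intervalIntegrable _ _)]
    have := intervalIntegral.integral_comp_add_left (a := 0) (b := h) E t
    rw [add_zero] at this
    rw [← this]
    simp_rw [hadd]
    exact ((ContinuousLinearMap.mul ℝ 𝔸 (E t)).intervalIntegral_comp_comm
      (hc.intervalIntegrable 0 h)).symm
  obtain ⟨u, hu⟩ := hu
  have hE : E = fun t => (h⁻¹ • ((∫ s in (0 : ℝ)..(t + h), E s) - ∫ s in (0 : ℝ)..t, E s))
      * ((u⁻¹ : 𝔸ˣ) : 𝔸) := by
    funext t
    rw [← key, ← hu]
    simp [mul_assoc]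
  rw [hE]
  have d1 : DifferentiableAt ℝ (fun t => ∫ s in (0 : ℝ)..(t + h), E s) 0 :=
    ((hF (0 + h)).comp_add_const 0 h).differentiableAt
  exact ((((d1.fun_sub (hF 0).differentiableAt).fun_const_smul _).mul_const _))

namespace LinearFlow

variable {d : ℕ} (φ : LinearFlow d)

theorem timeMap_zero : φ.timeMap 0 = 1 := by
  ext1 x
  exact φ.map_zero' x

theorem timeMap_add (s t : ℝ) : φ.timeMap (s + t) = φ.timeMap s * φ.timeMap t := by
  ext1 x
  exact φ.map_add' s t x

theorem continuous_timeMap : Continuous φ.timeMap := by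
  rw [continuous_clm_apply]
  intro y
  exact φ.cont'.comp (Continuous.prodMk continuous_id continuous_const)

theorem hasDerivAt_timeMap (t : ℝ) :
    HasDerivAt φ.timeMap (φ.timeMap t * φ.generator) t := by
  have h0 : HasDerivAt φ.timeMap φ.generator 0 :=
    (differentiableAt_zero_of_continuous_of_map_add φ.continuous_timeMap φ.timeMap_zero
      φ.timeMap_add).hasDerivAt
  have h1 : HasDerivAt (fun s => φ.timeMap (s - t)) φ.generator t := by
    have := HasDerivAt.comp_sub_const t t (f := φ.timeMap) (f' := φ.generator)
    rw [sub_self] at this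
    exact this h0
  have h2 := h1.const_mul (φ.timeMap t)
  refine h2.congr_of_eventuallyEq (Eventually.of_forall fun s => ?_)
  simp only
  rw [← φ.timeMap_add]
  congr 1
  ring

end LinearFlow

/-! ### Asymptotics of the rescaled flow -/

/-- The real-linear map `B ↦ ℓ (B_ℂ v)` on real operators. -/
noncomputable def complexCoeff {d : ℕ} (l : Module.Dual ℂ (ℂ ⊗[ℝ] PhaseSpace d))
    (v : ℂ ⊗[ℝ] PhaseSpace d) : LinMaps d →L[ℝ] ℂ :=
  LinearMap.toContinuousLinearMap
    { toFun := fun B => l (complexify B v)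
      map_add' := fun B C => by rw [complexify_add, LinearMap.add_apply, map_add]
      map_smul' := fun r B => by
        rw [complexify_smul, LinearMap.smul_apply, map_smul]
        simp }

theorem complexCoeff_apply {d : ℕ} (l : Module.Dual ℂ (ℂ ⊗[ℝ] PhaseSpace d))
    (v : ℂ ⊗[ℝ] PhaseSpace d) (B : LinMaps d) : complexCoeff l v B = l (complexify B v) := rfl

theorem complexCoeff_timeMap_hasDerivAt {d : ℕ} (φ : LinearFlow d)
    (l : Module.Dual ℂ (ℂ ⊗[ℝ] PhaseSpace d)) (v : ℂ ⊗[ℝ] PhaseSpace d) (t : ℝ) :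
    HasDerivAt (fun t => complexCoeff l v (φ.timeMap t))
      (complexCoeff l (complexify φ.generator v) (φ.timeMap t)) t := by
  have h := (complexCoeff l v).hasFDerivAt.comp_hasDerivAt t (φ.hasDerivAt_timeMap t)
  convert! h using 1
  rw [complexCoeff_apply, complexCoeff_apply, complexify_mul, Module.End.mul_apply]

theorem hasDerivAt_sum_pow_div_factorial (a : ℕ → ℂ) (n : ℕ) (t : ℝ) :
    HasDerivAt (fun t : ℝ => ∑ i ∈ Finset.range (n + 1), ((t : ℂ) ^ i / (i.factorial : ℂ)) * a i)
      (∑ i ∈ Finset.range n, ((t : ℂ) ^ i / (i.factorial : ℂ)) * a (i + 1)) t := by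
  have h : ∀ i ∈ Finset.range (n + 1), HasDerivAt
      (fun t : ℝ => ((t : ℂ) ^ i / (i.factorial : ℂ)) * a i)
      ((((i : ℂ) * (t : ℂ) ^ (i - 1)) / (i.factorial : ℂ)) * a i) t := by
    intro i _
    exact (((hasDerivAt_pow i (t : ℂ)).comp_ofReal).div_const _).mul_const _
  have h2 := HasDerivAt.fun_sum h
  convert! h2 using 1
  rw [Finset.sum_range_succ']
  simp only [Nat.cast_zero, zero_mul, zero_div, add_zero]
  refine Finset.sum_congr rfl fun i _ => ?_
  rw [Nat.factorial_succ, Nat.add_sub_cancel]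
  have : ((i : ℂ) + 1) ≠ 0 := by exact_mod_cast Nat.succ_ne_zero i
  have h3 : (i.factorial : ℂ) ≠ 0 := by exact_mod_cast i.factorial_ne_zero
  push_cast
  field_simp

/-- The action of the flow on a generalized eigenvector. -/
theorem complexCoeff_timeMap_eq {d : ℕ} (φ : LinearFlow d)
    (l : Module.Dual ℂ (ℂ ⊗[ℝ] PhaseSpace d)) (z : ℂ) (n : ℕ) (v : ℂ ⊗[ℝ] PhaseSpace d)
    (hv : ((complexify φ.generator - z • 1) ^ n) v = 0) (t : ℝ) :
    complexCoeff l v (φ.timeMap t) = Complex.exp (z * t) *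
      ∑ i ∈ Finset.range n, ((t : ℂ) ^ i / (i.factorial : ℂ)) *
        l (((complexify φ.generator - z • 1) ^ i) v) := by
  set T := complexify φ.generator with hT
  induction n generalizing v t with
  | zero =>
    have : v = 0 := by simpa using hv
    simp [this, complexCoeff_apply]
  | succ n ih =>
    set w := (T - z • 1) v with hw
    have ihw := fun t => ih w t (by rw [hw, ← Module.End.mul_apply, ← pow_succ]; exact hv)
    have e1 : ∀ i : ℕ, ((T - z • 1) ^ i) w = ((T - z • 1) ^ (i + 1)) v := fun i => by
      rw [hw, ← Module.End.mul_apply, ← pow_succ]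
    simp_rw [e1] at ihw
    have hp := hasDerivAt_sum_pow_div_factorial (fun i => l (((T - z • 1) ^ i) v)) n
    have hexp : ∀ t : ℝ, HasDerivAt (fun t : ℝ => Complex.exp (-(z * t)))
        (-z * Complex.exp (-(z * t))) t := fun t => by
      have h1 : HasDerivAt (fun t : ℝ => -(z * (t : ℂ))) (-(z * 1)) t :=
        (((hasDerivAt_id (t : ℂ)).const_mul z).neg).comp_ofReal
      convert! h1.cexp using 1
      ring
    -- With the integrating factor `e^{-zt}`, the derivative of the coefficient of `v` is that of `w
    -- = (T - z) v`, which the induction hypothesis evaluates. The difference is therefore constant,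
    -- and it vanishes at `t = 0`.
    have hh : ∀ t : ℝ, HasDerivAt (fun t : ℝ => Complex.exp (-(z * t)) *
        complexCoeff l v (φ.timeMap t) - ∑ i ∈ Finset.range (n + 1),
          ((t : ℂ) ^ i / (i.factorial : ℂ)) * l (((T - z • 1) ^ i) v)) 0 t := by
      intro t
      have h1 := ((hexp t).mul (complexCoeff_timeMap_hasDerivAt φ l v t)).sub (hp t)
      convert! h1 using 1
      have h2 : complexCoeff l (T v) (φ.timeMap t)
          = complexCoeff l w (φ.timeMap t) + z * complexCoeff l v (φ.timeMap t) := by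
        simp only [complexCoeff_apply, hw]
        simp
      rw [← hT, h2, ihw]
      have h3 : Complex.exp (-(z * t)) * Complex.exp (z * t) = 1 := by
        rw [← Complex.exp_add]; simp
      linear_combination -(∑ i ∈ Finset.range n,
          ((t : ℂ) ^ i / (i.factorial : ℂ)) * l (((T - z • 1) ^ (i + 1)) v)) * h3
    have hconst := is_const_of_deriv_eq_zero (fun t => (hh t).differentiableAt)
      (fun t => (hh t).deriv) t 0
    have h0 : complexCoeff l v (φ.timeMap 0) = l v := by
      rw [complexCoeff_apply, φ.timeMap_zero, complexify_one]; rfl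
    have hR : Complex.exp (-(z * ((0 : ℝ) : ℂ))) * complexCoeff l v (φ.timeMap 0)
        - ∑ i ∈ Finset.range (n + 1),
          ((((0 : ℝ) : ℂ)) ^ i / (i.factorial : ℂ)) * l (((T - z • 1) ^ i) v) = 0 := by
      rw [h0, Finset.sum_range_succ']
      simp
    simp only [hR] at hconst
    rw [← sub_eq_zero.mp hconst, ← mul_assoc, ← Complex.exp_add]
    simp

theorem tendsto_exp_mul_pow_div_pow {a : ℝ} {i k : ℕ} (ha : 0 ≤ a) (h : 0 < a ∨ i < k) :
    Tendsto (fun t : ℝ => Real.exp (-(a * t)) * (t ^ i / t ^ k)) atTop (𝓝 0) := by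
  rcases h with h | h
  · have h1 : Tendsto (fun t : ℝ => t ^ i * Real.exp (-(a * t))) atTop (𝓝 0) := by
      have := (tendsto_rpow_mul_exp_neg_mul_atTop_nhds_zero (i : ℝ) a h)
      simpa using this
    refine squeeze_zero_norm' ?_ h1
    filter_upwards [eventually_ge_atTop 1] with t ht
    have ht0 : 0 ≤ t := by linarith
    rw [Real.norm_of_nonneg (by positivity), mul_comm]
    gcongr
    exact div_le_self (by positivity) (one_le_pow₀ ht)
  · have h1 : Tendsto (fun t : ℝ => t ^ i / t ^ k) atTop (𝓝 0) := by
      have := tendsto_pow_div_pow_atTop_zero (𝕜 := ℝ) h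
      exact this
    refine squeeze_zero_norm' ?_ h1
    filter_upwards [eventually_ge_atTop 1] with t ht
    have ht0 : 0 ≤ t := by linarith
    rw [Real.norm_of_nonneg (by positivity)]
    refine mul_le_of_le_one_left (by positivity) ?_
    rw [Real.exp_le_one_iff]
    have : 0 ≤ a * t := by positivity
    linarith

theorem norm_exp_I_mul_mul (w t : ℝ) : ‖Complex.exp (Complex.I * w * t)‖ = 1 := by
  rw [mul_assoc, mul_comm, ← Complex.ofReal_mul, Complex.norm_exp_ofReal_mul_I]

namespace LinearFlow

variable {d : ℕ} (φ : LinearFlow d)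

/-- The flow, rescaled by `e^{-ρ t} t^{-k}`. -/
noncomputable def scaled (ρ : ℝ) (k : ℕ) (t : ℝ) : LinMaps d :=
  (Real.exp (-(ρ * t)) / t ^ k) • φ.timeMap t

theorem complexCoeff_scaled (l : Module.Dual ℂ (ℂ ⊗[ℝ] PhaseSpace d))
    (v : ℂ ⊗[ℝ] PhaseSpace d) (ρ : ℝ) (k : ℕ) (z : ℂ) (n : ℕ)
    (hv : ((complexify φ.generator - z • 1) ^ n) v = 0) (t : ℝ) :
    complexCoeff l v (φ.scaled ρ k t) = ∑ i ∈ Finset.range n,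
      ((Real.exp (-((ρ - z.re) * t)) * (t ^ i / t ^ k) : ℝ) : ℂ) *
      Complex.exp (Complex.I * z.im * t) *
        (l (((complexify φ.generator - z • 1) ^ i) v) / (i.factorial : ℂ)) := by
  rw [scaled, map_smul, complexCoeff_timeMap_eq φ l z n v hv, Complex.real_smul, ← mul_assoc,
    Finset.mul_sum]
  refine Finset.sum_congr rfl fun i _ => ?_
  have h1 : Complex.exp (z * t) = ((Real.exp (z.re * t) : ℝ) : ℂ) *
      Complex.exp (Complex.I * z.im * t) := by
    rw [Complex.ofReal_exp, ← Complex.exp_add]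
    congr 1
    conv_lhs => rw [← Complex.re_add_im z]
    push_cast
    ring
  have h2 : Real.exp (-((ρ - z.re) * t)) = Real.exp (-(ρ * t)) * Real.exp (z.re * t) := by
    rw [← Real.exp_add]
    congr 1
    ring
  rw [h1, h2]
  push_cast
  ring

/-- There are two ways to be subdominant: a smaller real part, where the exponential wins, or a
Jordan chain too short to produce `t ^ k`. -/
theorem tendsto_complexCoeff_scaled_of_lt (l : Module.Dual ℂ (ℂ ⊗[ℝ] PhaseSpace d))
    (v : ℂ ⊗[ℝ] PhaseSpace d) {ρ : ℝ} {k : ℕ} {z : ℂ} {n : ℕ} (hz : z.re ≤ ρ)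
    (h : z.re < ρ ∨ n ≤ k)
    (hv : ((complexify φ.generator - z • 1) ^ n) v = 0) :
    Tendsto (fun t => complexCoeff l v (φ.scaled ρ k t)) atTop (𝓝 0) := by
  simp_rw [φ.complexCoeff_scaled l v ρ k z n hv]
  rw [← Finset.sum_const_zero (s := Finset.range n)]
  refine tendsto_finsetSum _ fun i hi => ?_
  rw [Finset.mem_range] at hi
  rw [show (0 : ℂ) = 0 * (l (((complexify φ.generator - z • 1) ^ i) v) / (i.factorial : ℂ)) by simp]
  refine Tendsto.mul_const _ ?_
  have h1 := tendsto_exp_mul_pow_div_pow (a := ρ - z.re) (i := i) (k := k) (by linarith)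
    (by rcases h with h | h
        · left; linarith
        · right; omega)
  rw [tendsto_zero_iff_norm_tendsto_zero] at h1 ⊢
  refine h1.congr fun t => ?_
  rw [Complex.norm_mul, Complex.norm_real, norm_exp_I_mul_mul, mul_one]

/-- Of the polynomial factor of degree at most `k`, only the top term `t ^ k / k!` survives the
division by `t ^ k`. -/
theorem tendsto_complexCoeff_scaled_sub (l : Module.Dual ℂ (ℂ ⊗[ℝ] PhaseSpace d))
    (v : ℂ ⊗[ℝ] PhaseSpace d) {k : ℕ} {z : ℂ}
    (hv : ((complexify φ.generator - z • 1) ^ (k + 1)) v = 0) :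
    Tendsto (fun t => complexCoeff l v (φ.scaled z.re k t) -
      l (((complexify φ.generator - z • 1) ^ k) v) / (k.factorial : ℂ) *
        Complex.exp (Complex.I * z.im * t)) atTop (𝓝 0) := by
  have hmain := φ.complexCoeff_scaled l v z.re k z (k + 1) hv
  have hlow : Tendsto (fun t : ℝ => ∑ i ∈ Finset.range k,
      ((Real.exp (-((z.re - z.re) * t)) * (t ^ i / t ^ k) : ℝ) : ℂ) *
      Complex.exp (Complex.I * z.im * t) *
        (l (((complexify φ.generator - z • 1) ^ i) v) / (i.factorial : ℂ))) atTop (𝓝 0) := by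
    rw [← Finset.sum_const_zero (s := Finset.range k)]
    refine tendsto_finsetSum _ fun i hi => ?_
    rw [Finset.mem_range] at hi
    rw [show (0 : ℂ) = 0 * (l (((complexify φ.generator - z • 1) ^ i) v) / (i.factorial : ℂ)) by
      simp]
    refine Tendsto.mul_const _ ?_
    have h1 := tendsto_exp_mul_pow_div_pow (a := z.re - z.re) (i := i) (k := k) (by linarith)
      (Or.inr hi)
    rw [tendsto_zero_iff_norm_tendsto_zero] at h1 ⊢
    refine h1.congr fun t => ?_
    rw [Complex.norm_mul, Complex.norm_real, norm_exp_I_mul_mul, mul_one]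
  refine hlow.congr' ?_
  filter_upwards [eventually_gt_atTop 0] with t ht
  rw [hmain, Finset.sum_range_succ, div_self (pow_ne_zero _ ht.ne')]
  simp
  ring

/-- Every complex coefficient of the rescaled flow is asymptotic to a trigonometric polynomial
whose frequencies are the imaginary parts of the dominant spectrum. -/
theorem exists_trigPoly_complexCoeff_scaled {z₀ : ℂ} (hz₀ : z₀ ∈ φ.domSpectrum) {W : Finset ℝ}
    (hW : ∀ w, w ∈ W ↔ ∃ z ∈ φ.domSpectrum, z.im = w)
    (l : Module.Dual ℂ (ℂ ⊗[ℝ] PhaseSpace d)) (v : ℂ ⊗[ℝ] PhaseSpace d) :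
    ∃ c : ℝ → ℂ, Tendsto (fun t : ℝ =>
      complexCoeff l v (φ.scaled z₀.re (blockIndex φ.generator z₀) t) -
        ∑ w ∈ W, c w * Complex.exp (Complex.I * w * t)) atTop (𝓝 0) := by
  -- The generalized eigenspaces span because `ℂ` is algebraically closed. The claim is additive in
  -- `v`, so one eigenvalue at a time suffices: a dominant one contributes a single frequency, any
  -- other contributes nothing.
  have hv : v ∈ ⨆ z : ℂ, (complexify φ.generator).maxGenEigenspace z := by
    rw [Module.End.iSup_maxGenEigenspace_eq_top]
    trivial
  refine Submodule.iSup_induction _ (motive := fun v => ∃ c : ℝ → ℂ, Tendsto (fun t : ℝ =>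
      complexCoeff l v (φ.scaled z₀.re (blockIndex φ.generator z₀) t) -
        ∑ w ∈ W, c w * Complex.exp (Complex.I * w * t)) atTop (𝓝 0)) hv ?_ ?_ ?_
  · intro z v hv
    by_cases hv0 : v = 0
    · exact ⟨0, by simp [hv0, complexCoeff_apply]⟩
    have hz : z ∈ cSpectrum φ.generator := by
      have h1 : (complexify φ.generator).HasUnifEigenvalue z ⊤ := by
        intro hbot
        apply hv0
        rw [← Submodule.mem_bot ℂ, ← hbot]
        exact hv
      exact h1.lt one_pos
    rw [Module.End.mem_maxGenEigenspace] at hv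
    obtain ⟨m, hm⟩ := hv
    have hk := sub_smul_pow_blockIndex_eq_zero φ.generator z hm
    by_cases hdom : z ∈ φ.domSpectrum
    · obtain ⟨hre, hbi⟩ := domSpectrum_eq hz₀ hdom
      have h1 := φ.tendsto_complexCoeff_scaled_sub l v hk
      rw [hre, hbi] at h1
      refine ⟨Pi.single z.im (l (((complexify φ.generator - z • 1) ^
        (blockIndex φ.generator z₀)) v) / ((blockIndex φ.generator z₀).factorial : ℂ)), ?_⟩
      refine h1.congr fun t => ?_
      congr 1
      rw [Finset.sum_eq_single_of_mem z.im ((hW _).mpr ⟨z, hdom, rfl⟩)]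
      · simp
      · intro w _ hw
        simp [hw]
    · refine ⟨0, ?_⟩
      simp only [Pi.zero_apply, zero_mul, Finset.sum_const_zero, sub_zero]
      have hle := hz₀.2 z hz
      have hlt : toLex (z.re, blockIndex φ.generator z)
          < toLex (z₀.re, blockIndex φ.generator z₀) := by
        refine lt_of_le_of_ne hle fun heq => hdom ⟨hz, fun w hw => ?_⟩
        rw [heq]
        exact hz₀.2 w hw
      rw [Prod.Lex.toLex_lt_toLex] at hlt
      refine φ.tendsto_complexCoeff_scaled_of_lt l v ?_ ?_ hk
      · rcases hlt with h | h
        · exact h.le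
        · exact h.1.le
      · rcases hlt with h | h
        · exact Or.inl h
        · exact Or.inr h.2
  · exact ⟨0, by simp [complexCoeff_apply]⟩
  · rintro x y ⟨c, hc⟩ ⟨c', hc'⟩
    refine ⟨c + c', ?_⟩
    have := hc.add hc'
    rw [add_zero] at this
    refine this.congr fun t => ?_
    simp only [complexCoeff_apply, map_add, Pi.add_apply, add_mul, Finset.sum_add_distrib]
    ring

/-- A real observable is a sum of matrix coefficients: `B` is the sum over `j` of the rank-one maps
`u ↦ u_j B e_j`, so `H B` is a sum of linear functionals of the columns `B e_j`, and each of these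
can be complexified. -/
theorem exists_trigPoly_scaled {z₀ : ℂ} (hz₀ : z₀ ∈ φ.domSpectrum) {W : Finset ℝ}
    (hW : ∀ w, w ∈ W ↔ ∃ z ∈ φ.domSpectrum, z.im = w) (H : LinObservable d) :
    ∃ c : ℝ → ℂ, Tendsto (fun t : ℝ =>
      H (φ.scaled z₀.re (blockIndex φ.generator z₀) t) -
        (∑ w ∈ W, c w * Complex.exp (Complex.I * w * t)).re) atTop (𝓝 0) := by
  let e : Fin d → PhaseSpace d := fun j => EuclideanSpace.single j 1
  let rk : Fin d → (PhaseSpace d →ₗ[ℝ] LinMaps d) := fun j =>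
    { toFun := fun x => (EuclideanSpace.proj j : PhaseSpace d →L[ℝ] ℝ).smulRight x
      map_add' := fun x y => by ext1 u; simp
      map_smul' := fun r x => by ext1 u; exact smul_comm (u j) r x }
  let l : Fin d → Module.Dual ℂ (ℂ ⊗[ℝ] PhaseSpace d) := fun j =>
    (TensorProduct.AlgebraTensorModule.rid ℝ ℂ ℂ).toLinearMap ∘ₗ
      LinearMap.baseChange ℂ ((H : LinMaps d →ₗ[ℝ] ℝ) ∘ₗ rk j)
  have hsum : ∀ B : LinMaps d, ((H B : ℝ) : ℂ)
      = ∑ j, complexCoeff (l j) ((1 : ℂ) ⊗ₜ[ℝ] e j) B := by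
    intro B
    have hB : B = ∑ j, rk j (B (e j)) := by
      ext1 x
      have hx : x = ∑ j, x j • e j := by
        have := (EuclideanSpace.basisFun (Fin d) ℝ).sum_repr x
        simpa [e] using this.symm
      rw [sum_apply]
      conv_lhs => rw [hx]
      simp [rk]
    conv_lhs => rw [hB]
    rw [map_sum, Complex.ofReal_sum]
    refine Finset.sum_congr rfl fun j _ => ?_
    simp [complexCoeff_apply, complexify, l]
  choose c hc using fun j => φ.exists_trigPoly_complexCoeff_scaled hz₀ hW (l j) ((1 : ℂ) ⊗ₜ[ℝ] e j)
  refine ⟨fun w => ∑ j, c j w, ?_⟩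
  have h1 := tendsto_finsetSum Finset.univ fun j _ => hc j
  rw [Finset.sum_const_zero] at h1
  have h2 := (Complex.continuous_re.tendsto 0).comp h1
  rw [Complex.zero_re] at h2
  refine h2.congr fun t => ?_
  simp only [Function.comp_apply]
  rw [Finset.sum_sub_distrib, ← hsum, Complex.sub_re, Complex.ofReal_re]
  congr 2
  rw [Finset.sum_comm]
  exact Finset.sum_congr rfl fun w _ => by rw [Finset.sum_mul]

/-- A Jordan chain of maximal length and a functional that does not vanish at its end give a
coefficient asymptotic to `e^{i (Im z) t}`, whose real and imaginary parts are taken. These two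
observables span the plane of perturbations used in both implications. -/
theorem exists_observable_cos_sin {z : ℂ} (hz : z ∈ φ.domSpectrum) :
    ∃ H₁ H₂ : LinObservable d,
      Tendsto (fun t : ℝ => H₁ (φ.scaled z.re (blockIndex φ.generator z) t) -
        Real.cos (z.im * t)) atTop (𝓝 0) ∧
      Tendsto (fun t : ℝ => H₂ (φ.scaled z.re (blockIndex φ.generator z) t) -
        Real.sin (z.im * t)) atTop (𝓝 0) := by
  set k := blockIndex φ.generator z with hk
  obtain ⟨v, hv1, hv2⟩ := exists_jordan_chain φ.generator hz.1
  rw [← hk] at hv1 hv2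
  obtain ⟨l, hl⟩ := Module.Projective.exists_dual_eq_one ℂ hv2
  -- The factor `k!` cancels the denominator of the leading coefficient.
  have h := φ.tendsto_complexCoeff_scaled_sub ((k.factorial : ℂ) • l) v hv1
  have hf : (k.factorial : ℂ) ≠ 0 := by exact_mod_cast k.factorial_ne_zero
  rw [LinearMap.smul_apply, hl, smul_eq_mul, mul_one, div_self hf] at h
  set L := complexCoeff ((k.factorial : ℂ) • l) v
  have hexp : ∀ t : ℝ, Complex.exp (Complex.I * z.im * t)
      = (Real.cos (z.im * t) : ℝ) + (Real.sin (z.im * t) : ℝ) * Complex.I := fun t => by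
    rw [Complex.ofReal_cos, Complex.ofReal_sin, ← Complex.exp_mul_I]
    congr 1
    push_cast
    ring
  refine ⟨Complex.reCLM.comp L, Complex.imCLM.comp L, ?_, ?_⟩
  · have h2 := (Complex.continuous_re.tendsto 0).comp h
    rw [Complex.zero_re] at h2
    refine h2.congr fun t => ?_
    simp only [Function.comp_apply, hexp]
    simp [-Complex.ofReal_cos, -Complex.ofReal_sin]
  · have h2 := (Complex.continuous_im.tendsto 0).comp h
    rw [Complex.zero_im] at h2
    refine h2.congr fun t => ?_
    simp only [Function.comp_apply, hexp]
    simp [-Complex.ofReal_cos, -Complex.ofReal_sin]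

end LinearFlow

/-! ### Nonresonance as a condition on rational spans -/

theorem Complex.exists_arg_exp_eq (w : ℂ) :
    ∃ m : ℤ, Complex.arg (Complex.exp w) = w.im + 2 * Real.pi * m := by
  refine ⟨-toIocDiv Real.two_pi_pos (-Real.pi) w.im, ?_⟩
  rw [Complex.arg_exp, ← self_sub_toIocDiv_zsmul, zsmul_eq_mul]
  push_cast
  ring

/-- This supplies a time that is generic with respect to countably many rational relations. -/
theorem exists_pos_inv_notMem {U : Submodule ℚ ℝ} (hU : (U : Set ℝ).Countable) :
    ∃ t : ℝ, 0 < t ∧ t⁻¹ ∉ U := by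
  have h : ¬ (Set.Ioi (0 : ℝ)).Countable := fun h => by
    have := h.le_aleph0
    rw [Cardinal.mk_Ioi_real] at this
    exact absurd this (not_le.mpr Cardinal.aleph0_lt_continuum)
  have h2 : ¬ Set.Ioi (0 : ℝ) ⊆ U := fun hs => h (hU.mono hs)
  obtain ⟨x, hx, hxU⟩ := Set.not_subset.mp h2
  exact ⟨x⁻¹, inv_pos.mpr hx, by rwa [inv_inv]⟩

theorem countable_span_of_finite {S : Set ℝ} (hS : S.Finite) :
    (Submodule.span ℚ S : Set ℝ).Countable := by
  have : Module.Finite ℚ (Submodule.span ℚ S) := Module.Finite.span_of_finite ℚ hS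
  have : Countable (Submodule.span ℚ S) :=
    (Module.finBasis ℚ (Submodule.span ℚ S)).equivFun.toEquiv.countable_iff.mpr inferInstance
  exact Set.countable_coe_iff.mp this

/-- For a finite conjugation-invariant set on a vertical line `Re z = ρ`, exponential
`b`-nonresonance means that `ρ / log b` is not a rational combination of the `Im z / 2π`. -/
theorem isExpNonresonant_iff {b : ℕ} {Z : Set ℂ} (hfin : Z.Finite) (hne : Z.Nonempty)
    (hconj : ∀ z ∈ Z, starRingEnd ℂ z ∈ Z) {ρ : ℝ} (hre : ∀ z ∈ Z, z.re = ρ) :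
    IsExpNonresonant b Z ↔
      ρ / Real.log b ∉ Submodule.span ℚ ((fun z : ℂ => z.im / (2 * Real.pi)) '' Z) := by
  set S := (fun z : ℂ => z.im / (2 * Real.pi)) '' Z with hS
  have hpi : (2 * Real.pi) ≠ 0 := by positivity
  have hnorm : ∀ (t : ℝ) (z : ℂ), z ∈ Z → ‖Complex.exp ((t : ℂ) * z)‖ = Real.exp (t * ρ) := by
    intro t z hz
    rw [Complex.norm_exp]
    simp [hre z hz]
  have hsphere : ∀ t : ℝ, ((fun z : ℂ => Complex.exp ((t : ℂ) * z)) '' Z) ∩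
      Metric.sphere (0 : ℂ) (Real.exp (t * ρ)) = (fun z : ℂ => Complex.exp ((t : ℂ) * z)) '' Z := by
    intro t
    refine Set.inter_eq_left.mpr ?_
    rintro _ ⟨z, hz, rfl⟩
    simp [hnorm t z hz]
  have hlogb : ∀ t : ℝ, Real.logb b (Real.exp (t * ρ)) = t * (ρ / Real.log b) := by
    intro t
    rw [Real.logb, Real.log_exp, mul_div_assoc]
  have harg : ∀ (t : ℝ) (z : ℂ), ∃ m : ℤ, Complex.arg (Complex.exp ((t : ℂ) * z))
      = t * z.im + 2 * Real.pi * m := by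
    intro t z
    obtain ⟨m, hm⟩ := Complex.exists_arg_exp_eq ((t : ℂ) * z)
    exact ⟨m, by rw [hm]; simp⟩
  constructor
  · rintro ⟨t, ht, hnr⟩ hmem
    have h := (hnr (Real.exp (t * ρ)) (Real.exp_pos _) (by
      rw [hsphere]; exact hne.image _)).2
    rw [hsphere, hlogb] at h
    apply h
    set Δ := argDiffSet ((fun z : ℂ => Complex.exp ((t : ℂ) * z)) '' Z) with hΔ
    have h1 : (1 : ℝ) ∈ Submodule.span ℚ Δ := by
      obtain ⟨z, hz⟩ := hne
      exact Submodule.subset_span ⟨_, ⟨z, hz, rfl⟩, _, ⟨z, hz, rfl⟩, by simp⟩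
    refine Submodule.span_induction (p := fun x _ => t * x ∈ Submodule.span ℚ Δ)
      ?_ ?_ ?_ ?_ hmem
    · rintro _ ⟨z, hz, rfl⟩
      obtain ⟨m, hm⟩ := harg t z
      obtain ⟨m', hm'⟩ := harg t (starRingEnd ℂ z)
      have h2 := Submodule.subset_span (R := ℚ) (s := Δ)
        ⟨_, ⟨z, hz, rfl⟩, _, ⟨starRingEnd ℂ z, hconj z hz, rfl⟩, rfl⟩
      -- The pair `z`, `z̄` contributes `1 + 2t Im z / 2π` up to an integer. As `1 ∈ Δ`, the
      -- integers can be removed, and halving leaves `t Im z / 2π`.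
      have h3 := Submodule.smul_mem _ (1 / 2 : ℚ)
        (Submodule.sub_mem _ h2 (Submodule.smul_mem _ ((1 + (m - m') : ℚ)) h1))
      convert! h3 using 1
      simp only
      rw [hm, hm', Complex.conj_im]
      simp only [Rat.smul_def]
      push_cast
      field_simp
      ring
    · simp
    · intro x y _ _ hx hy
      rw [mul_add]
      exact Submodule.add_mem _ hx hy
    · intro q x _ hx
      rw [mul_smul_comm]
      exact Submodule.smul_mem _ q hx
  · intro hnot
    set U := Submodule.span ℚ S
    set U' := Submodule.span ℚ (insert (ρ / Real.log b) S) with hU'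
    have hSfin : S.Finite := hfin.image _
    -- With `t⁻¹` outside the countable space `U'`, no nonzero rational multiple of `t⁻¹` lies in
    -- `U'`. Reducing arguments modulo `2π` adds integers to `t u`, and this choice prevents them
    -- from creating new relations.
    obtain ⟨t, ht, htU⟩ := exists_pos_inv_notMem (countable_span_of_finite
      (hSfin.insert (ρ / Real.log b)))
    have hUU' : U ≤ U' := Submodule.span_mono (Set.subset_insert _ _)
    have hq : ∀ q : ℚ, (q : ℝ) * t⁻¹ ∈ U' → q = 0 := by
      intro q hq
      by_contra h0
      apply htU
      have := Submodule.smul_mem U' q⁻¹ hq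
      convert! this using 1
      rw [Rat.smul_def, ← mul_assoc, ← Rat.cast_mul, inv_mul_cancel₀ h0]
      simp
    refine ⟨t, ht.le, fun r hr hne' => ?_⟩
    have hr' : r = Real.exp (t * ρ) := by
      obtain ⟨_, ⟨z, hz, rfl⟩, h2⟩ := hne'
      rw [mem_sphere_zero_iff_norm] at h2
      rw [← h2]
      exact hnorm t z hz
    subst hr'
    rw [hsphere, hlogb]
    set Δ := argDiffSet ((fun z : ℂ => Complex.exp ((t : ℂ) * z)) '' Z) with hΔ
    have hform : ∀ δ ∈ Δ, ∃ u ∈ U, ∃ n : ℤ, δ = t * u + n := by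
      rintro _ ⟨_, ⟨z, hz, rfl⟩, _, ⟨w, hw, rfl⟩, rfl⟩
      obtain ⟨m, hm⟩ := harg t z
      obtain ⟨m', hm'⟩ := harg t w
      refine ⟨z.im / (2 * Real.pi) - w.im / (2 * Real.pi), Submodule.sub_mem _
        (Submodule.subset_span ⟨z, hz, rfl⟩) (Submodule.subset_span ⟨w, hw, rfl⟩),
        1 + (m - m'), ?_⟩
      simp only
      rw [hm, hm']
      push_cast
      field_simp
      ring
    constructor
    · apply Set.Subset.antisymm
      · rintro δ ⟨hδ, q, rfl⟩
        obtain ⟨u, hu, n, hn⟩ := hform _ hδ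
        have h0 : q - n = 0 := by
          apply hq
          have : ((q - n : ℚ) : ℝ) * t⁻¹ = u := by
            push_cast
            simp only at hn
            rw [hn]
            field_simp
            ring
          rw [this]
          exact hUU' hu
        have hqn : (q : ℝ) = n := by
          have := sub_eq_zero.mp h0
          rw [this]; simp
        obtain ⟨x, _, y, _, hxy⟩ := hδ
        simp only at hxy
        -- Arguments lie in `(-π, π]`, so the elements of `Δ` lie strictly between `0` and `2`; the
        -- only integer there is `1`.
        have b1 := Complex.neg_pi_lt_arg x
        have b2 := Complex.arg_le_pi x
        have b3 := Complex.neg_pi_lt_arg y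
        have b4 := Complex.arg_le_pi y
        have hpos : 0 < 2 * Real.pi := by positivity
        have c1 : (Complex.arg x - Complex.arg y) / (2 * Real.pi) < 1 := by
          rw [div_lt_one hpos]; linarith
        have c2 : -1 < (Complex.arg x - Complex.arg y) / (2 * Real.pi) := by
          rw [lt_div_iff₀ hpos]; linarith
        have d1 : (n : ℝ) < 2 := by rw [← hqn, hxy]; linarith
        have d2 : (0 : ℝ) < n := by rw [← hqn, hxy]; linarith
        have d3 : n < 2 := by exact_mod_cast d1
        have d4 : 0 < n := by exact_mod_cast d2
        have : n = 1 := by omega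
        simp [hqn, this]
      · rintro _ rfl
        obtain ⟨z, hz⟩ := hne
        exact ⟨⟨_, ⟨z, hz, rfl⟩, _, ⟨z, hz, rfl⟩, by simp⟩, 1, by simp⟩
    · intro hmem
      have : ∀ x ∈ Submodule.span ℚ Δ, ∃ u ∈ U, ∃ q : ℚ, x = t * u + q := by
        intro x hx
        refine Submodule.span_induction (p := fun x _ => ∃ u ∈ U, ∃ q : ℚ, x = t * u + q)
          ?_ ?_ ?_ ?_ hx
        · intro δ hδ
          obtain ⟨u, hu, n, hn⟩ := hform δ hδ
          exact ⟨u, hu, n, by simpa using hn⟩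
        · exact ⟨0, Submodule.zero_mem _, 0, by simp⟩
        · rintro _ _ _ _ ⟨u, hu, q, rfl⟩ ⟨u', hu', q', rfl⟩
          exact ⟨u + u', Submodule.add_mem _ hu hu', q + q', by push_cast; ring⟩
        · rintro a _ _ ⟨u, hu, q, rfl⟩
          exact ⟨a • u, Submodule.smul_mem _ a hu, a * q, by
            simp only [Rat.smul_def]; push_cast; ring⟩
      obtain ⟨u, hu, q, hx⟩ := this _ hmem
      have e : (q : ℝ) * t⁻¹ = ρ / Real.log b - u := by
        have : (q : ℝ) = t * (ρ / Real.log b - u) := by linarith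
        rw [this]
        field_simp
      have hq0 : q = 0 := by
        apply hq
        rw [e]
        exact Submodule.sub_mem _ (Submodule.subset_span (Set.mem_insert _ _)) (hUU' hu)
      rw [hq0] at e
      apply hnot
      have : ρ / Real.log b = u := by
        simp at e
        linarith
      rw [this]
      exact hu

/-! ### Phases and twisted means -/

/-- The unimodular function `|x|^{is}`. -/
noncomputable def logPhase (s x : ℝ) : ℂ := Complex.exp (Complex.I * s * Real.log x)

/-- This includes `x = 0`, because `Real.log 0 = 0`; zeros of a signal need no separate treatment.
-/
theorem norm_logPhase (s x : ℝ) : ‖logPhase s x‖ = 1 := norm_exp_I_mul_mul _ _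

theorem measurable_logPhase (s : ℝ) : Measurable (logPhase s) := by
  unfold logPhase
  fun_prop

theorem logPhase_zero_left (x : ℝ) : logPhase 0 x = 1 := by simp [logPhase]

theorem logPhase_mul (s : ℝ) {x y : ℝ} (hx : x ≠ 0) (hy : y ≠ 0) :
    logPhase s (x * y) = logPhase s x * logPhase s y := by
  rw [logPhase, logPhase, logPhase, Real.log_mul hx hy, ← Complex.exp_add]
  congr 1
  push_cast
  ring

theorem logPhase_ne_zero (s x : ℝ) : logPhase s x ≠ 0 := Complex.exp_ne_zero _

theorem norm_exp_I_mul_sub_le (x y : ℝ) :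
    ‖Complex.exp (Complex.I * x) - Complex.exp (Complex.I * y)‖ ≤ |x - y| := by
  have h : Complex.exp (Complex.I * x) - Complex.exp (Complex.I * y)
      = Complex.exp (Complex.I * y) * (Complex.exp (Complex.I * ((x - y : ℝ) : ℂ)) - 1) := by
    rw [mul_sub, ← Complex.exp_add, mul_one]
    congr 2
    push_cast
    ring
  rw [h, norm_mul, mul_comm Complex.I, Complex.norm_exp_ofReal_mul_I, one_mul]
  exact Real.norm_exp_I_mul_ofReal_sub_one_le

/-- Bounded measurable functions of time. -/
def BddMeas (g : ℝ → ℂ) : Prop := Measurable g ∧ ∃ C, ∀ t, ‖g t‖ ≤ C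

namespace BddMeas

variable {f g : ℝ → ℂ}

theorem add (hf : BddMeas f) (hg : BddMeas g) : BddMeas (fun t => f t + g t) := by
  obtain ⟨C, hC⟩ := hf.2
  obtain ⟨D, hD⟩ := hg.2
  exact ⟨hf.1.add hg.1, C + D, fun t => (norm_add_le _ _).trans (add_le_add (hC t) (hD t))⟩

theorem sub (hf : BddMeas f) (hg : BddMeas g) : BddMeas (fun t => f t - g t) := by
  obtain ⟨C, hC⟩ := hf.2
  obtain ⟨D, hD⟩ := hg.2
  exact ⟨hf.1.sub hg.1, C + D, fun t => (norm_sub_le _ _).trans (add_le_add (hC t) (hD t))⟩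

theorem mul (hf : BddMeas f) (hg : BddMeas g) : BddMeas (fun t => f t * g t) := by
  obtain ⟨C, hC⟩ := hf.2
  obtain ⟨D, hD⟩ := hg.2
  refine ⟨hf.1.mul hg.1, C * D, fun t => ?_⟩
  rw [norm_mul]
  exact mul_le_mul (hC t) (hD t) (norm_nonneg _) ((norm_nonneg _).trans (hC t))

theorem const (c : ℂ) : BddMeas (fun _ => c) := ⟨measurable_const, ‖c‖, fun _ => le_rfl⟩

theorem const_mul (c : ℂ) (hf : BddMeas f) : BddMeas (fun t => c * f t) := (const c).mul hf

theorem sum {ι : Type*} (s : Finset ι) {F : ι → ℝ → ℂ} (h : ∀ i ∈ s, BddMeas (F i)) :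
    BddMeas (fun t => ∑ i ∈ s, F i t) := by
  classical
  induction s using Finset.induction_on with
  | empty => simpa using const 0
  | insert a s ha ih =>
    simp_rw [Finset.sum_insert ha]
    exact (h a (Finset.mem_insert_self _ _)).add
      (ih fun i hi => h i (Finset.mem_insert_of_mem hi))

theorem intervalIntegrable (hf : BddMeas f) (a b : ℝ) : IntervalIntegrable f volume a b := by
  obtain ⟨C, hC⟩ := hf.2
  rw [intervalIntegrable_iff]
  exact Measure.integrableOn_of_bounded (M := C) (by simp) hf.1.aestronglyMeasurable
    (Eventually.of_forall hC)

theorem logPhase (s : ℝ) {u : ℝ → ℝ} (hu : Measurable u) : BddMeas (fun t => logPhase s (u t)) :=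
  ⟨(measurable_logPhase s).comp hu, 1, fun _ => (norm_logPhase s _).le⟩

theorem expI (w : ℝ) : BddMeas (fun t : ℝ => Complex.exp (Complex.I * w * t)) :=
  ⟨by fun_prop, 1, fun t => (norm_exp_I_mul_mul w t).le⟩

end BddMeas

/-- The mean over `[0, T]` of the norm of a function. -/
noncomputable def normMean (g : ℝ → ℂ) (T : ℝ) : ℝ := T⁻¹ * ∫ t in (0 : ℝ)..T, ‖g t‖

/-- The mean over `[0, T]` of `t^{iκ} g(t)`, normalised such that constants are preserved. -/
noncomputable def twistedMean (κ : ℝ) (g : ℝ → ℂ) (T : ℝ) : ℂ :=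
  (1 + Complex.I * κ) * (logPhase κ T)⁻¹ *
    ((T : ℂ)⁻¹ * ∫ t in (0 : ℝ)..T, logPhase κ t * g t)

theorem twistedMean_zero (g : ℝ → ℂ) (T : ℝ) :
    twistedMean 0 g T = (T : ℂ)⁻¹ * ∫ t in (0 : ℝ)..T, g t := by
  simp [twistedMean, logPhase_zero_left]

theorem norm_twistedMean_eq (κ : ℝ) (g : ℝ → ℂ) {T : ℝ} (hT : 0 < T) :
    ‖twistedMean κ g T‖ = ‖(1 + Complex.I * κ : ℂ)‖ *
      (T⁻¹ * ‖∫ t in (0 : ℝ)..T, logPhase κ t * g t‖) := by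
  rw [twistedMean, norm_mul, norm_mul, norm_mul, norm_inv, norm_logPhase, inv_one, mul_one,
    norm_inv, Complex.norm_real, Real.norm_of_nonneg hT.le]

theorem norm_twistedMean_le (κ : ℝ) (g : ℝ → ℂ) {T : ℝ} (hT : 0 < T) :
    ‖twistedMean κ g T‖ ≤ ‖(1 + Complex.I * κ : ℂ)‖ * normMean g T := by
  rw [norm_twistedMean_eq κ g hT, normMean]
  gcongr
  refine (intervalIntegral.norm_integral_le_integral_norm hT.le).trans (le_of_eq ?_)
  simp [norm_logPhase]

theorem one_add_I_mul_ne_zero (κ : ℝ) : (1 + Complex.I * κ : ℂ) ≠ 0 := by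
  intro h
  have := congrArg Complex.re h
  simp at this

theorem normMean_le {g : ℝ → ℂ} {C T : ℝ} (hT : 0 < T) (h : ∀ t ∈ Ioc 0 T, ‖g t‖ ≤ C) :
    normMean g T ≤ C := by
  have h1 := intervalIntegral.norm_integral_le_of_norm_le_const (a := 0) (b := T) (C := C)
    (f := fun t => ‖g t‖) (fun t ht => by
      rw [uIoc_of_le hT.le] at ht
      simpa using h t ht)
  rw [sub_zero, abs_of_pos hT] at h1
  rw [normMean, inv_mul_le_iff₀ hT, mul_comm]
  exact (le_abs_self _).trans h1

theorem twistedMean_add (κ : ℝ) {f g : ℝ → ℂ} (hf : BddMeas f) (hg : BddMeas g) (T : ℝ) :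
    twistedMean κ (fun t => f t + g t) T = twistedMean κ f T + twistedMean κ g T := by
  have hl : BddMeas (fun t => logPhase κ t) := BddMeas.logPhase κ measurable_id
  simp only [twistedMean, mul_add]
  rw [intervalIntegral.integral_add ((hl.mul hf).intervalIntegrable _ _)
    ((hl.mul hg).intervalIntegrable _ _)]
  ring

theorem twistedMean_const_mul (κ : ℝ) (c : ℂ) (f : ℝ → ℂ) (T : ℝ) :
    twistedMean κ (fun t => c * f t) T = c * twistedMean κ f T := by
  simp only [twistedMean, mul_left_comm _ c]
  rw [intervalIntegral.integral_const_mul]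
  ring

theorem twistedMean_sub (κ : ℝ) {f g : ℝ → ℂ} (hf : BddMeas f) (hg : BddMeas g) (T : ℝ) :
    twistedMean κ (fun t => f t - g t) T = twistedMean κ f T - twistedMean κ g T := by
  have h := twistedMean_add κ hf (hg.const_mul (-1)) T
  rw [twistedMean_const_mul] at h
  simp only [neg_mul, one_mul, ← sub_eq_add_neg] at h
  exact h

theorem twistedMean_sum (κ : ℝ) {ι : Type*} (s : Finset ι) {F : ι → ℝ → ℂ}
    (h : ∀ i ∈ s, BddMeas (F i)) (T : ℝ) :
    twistedMean κ (fun t => ∑ i ∈ s, F i t) T = ∑ i ∈ s, twistedMean κ (F i) T := by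
  classical
  induction s using Finset.induction_on with
  | empty => simp [twistedMean]
  | insert a s ha ih =>
    simp_rw [Finset.sum_insert ha]
    rw [twistedMean_add κ (h a (Finset.mem_insert_self _ _))
      (BddMeas.sum s fun i hi => h i (Finset.mem_insert_of_mem hi)),
      ih fun i hi => h i (Finset.mem_insert_of_mem hi)]

/-- The integral of `t^{iκ}` over `[0, T]` is `T^{1+iκ} / (1+iκ)`, exactly cancelled by the
normalisation for `T > 0`. -/
theorem tendsto_twistedMean_one (κ : ℝ) :
    Tendsto (twistedMean κ (fun _ => 1)) atTop (𝓝 1) := by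
  refine tendsto_const_nhds.congr' ?_
  filter_upwards [eventually_gt_atTop 0] with T hT
  have h1 : ∫ t in (0 : ℝ)..T, logPhase κ t * 1 = ∫ t in (0 : ℝ)..T, (t : ℂ) ^ (Complex.I * κ) := by
    refine intervalIntegral.integral_congr_ae (Eventually.of_forall fun t ht => ?_)
    rw [uIoc_of_le hT.le] at ht
    rw [mul_one, logPhase, Complex.cpow_def_of_ne_zero (by exact_mod_cast ht.1.ne'),
      Complex.ofReal_log ht.1.le, mul_comm]
  have hne := one_add_I_mul_ne_zero κ
  rw [add_comm] at hne
  have hT0 : (T : ℂ) ≠ 0 := by exact_mod_cast hT.ne'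
  rw [twistedMean, h1, integral_cpow (Or.inl (by simp)), Complex.cpow_add _ _ hT0,
    Complex.ofReal_zero, Complex.zero_cpow hne, Complex.cpow_one,
    Complex.cpow_def_of_ne_zero hT0, ← Complex.ofReal_log hT.le, mul_comm (Real.log T : ℂ),
    ← logPhase]
  have := logPhase_ne_zero κ T
  field_simp
  rw [sub_zero, add_comm]
  ring

theorem hasDerivAt_logPhase (κ : ℝ) {t : ℝ} (ht : 0 < t) :
    HasDerivAt (logPhase κ) (logPhase κ t * (Complex.I * κ / t)) t := by
  have h1 : HasDerivAt (fun x : ℝ => Complex.I * κ * (Real.log x : ℂ))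
      (Complex.I * κ * ((t⁻¹ : ℝ) : ℂ)) t :=
    ((Real.hasDerivAt_log ht.ne').ofReal_comp).const_mul _
  convert! h1.cexp using 1
  rw [logPhase]
  push_cast
  rw [div_eq_mul_inv]

theorem hasDerivAt_expI (w t : ℝ) : HasDerivAt (fun t : ℝ => Complex.exp (Complex.I * w * t))
    (Complex.exp (Complex.I * w * t) * (Complex.I * w)) t := by
  have h1 : HasDerivAt (fun t : ℝ => Complex.I * w * (t : ℂ)) (Complex.I * w * 1) t :=
    ((hasDerivAt_id (t : ℂ)).const_mul _).comp_ofReal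
  rw [mul_one] at h1
  exact h1.cexp

/-- Integration by parts on `[1, T]`: the derivative of `t^{iκ}` has size `|κ| / t`, so the
remainder is only logarithmic. The interval `[0, 1]`, where `log` is singular, costs at most 1. -/
theorem norm_integral_logPhase_mul_expI_le (κ : ℝ) {w : ℝ} (hw : w ≠ 0) {T : ℝ} (hT : 1 ≤ T) :
    ‖∫ t in (0 : ℝ)..T, logPhase κ t * Complex.exp (Complex.I * w * t)‖
      ≤ 1 + 2 / |w| + |κ / w| * Real.log T := by
  have hbm : BddMeas (fun t => logPhase κ t * Complex.exp (Complex.I * w * t)) :=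
    (BddMeas.logPhase κ measurable_id).mul (BddMeas.expI w)
  rw [← intervalIntegral.integral_add_adjacent_intervals (b := 1)
    (hbm.intervalIntegrable _ _) (hbm.intervalIntegrable _ _)]
  have h1 : ‖∫ t in (0 : ℝ)..1, logPhase κ t * Complex.exp (Complex.I * w * t)‖ ≤ 1 := by
    have := intervalIntegral.norm_integral_le_of_norm_le_const (a := 0) (b := 1) (C := 1)
      (f := fun t => logPhase κ t * Complex.exp (Complex.I * w * t)) (fun t _ => by
        rw [norm_mul, norm_logPhase, norm_exp_I_mul_mul, mul_one])
    simpa using this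
  have hwI : (Complex.I * w : ℂ) ≠ 0 := mul_ne_zero Complex.I_ne_zero (by exact_mod_cast hw)
  have hder : ∀ t ∈ uIcc 1 T, HasDerivAt (fun t : ℝ => logPhase κ t *
      Complex.exp (Complex.I * w * t) / (Complex.I * w))
      (logPhase κ t * Complex.exp (Complex.I * w * t) +
        ((κ / w : ℝ) : ℂ) * ((t⁻¹ : ℝ) : ℂ) *
          (logPhase κ t * Complex.exp (Complex.I * w * t))) t := by
    intro t ht
    rw [uIcc_of_le hT] at ht
    have ht0 : 0 < t := by linarith [ht.1]
    have := ((hasDerivAt_logPhase κ ht0).mul (hasDerivAt_expI w t)).div_const (Complex.I * w)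
    convert! this using 1
    have hw' : (w : ℂ) ≠ 0 := by exact_mod_cast hw
    have ht' : (t : ℂ) ≠ 0 := by exact_mod_cast ht0.ne'
    push_cast
    field_simp
    ring
  have hcontOn : ContinuousOn (fun t : ℝ => ((κ / w : ℝ) : ℂ) * ((t⁻¹ : ℝ) : ℂ) *
          (logPhase κ t * Complex.exp (Complex.I * w * t))) (uIcc 1 T) := by
    intro t ht
    rw [uIcc_of_le hT] at ht
    have ht0 : 0 < t := by linarith [ht.1]
    refine ContinuousAt.continuousWithinAt ?_
    refine (continuousAt_const.mul ?_).mul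
      ((hasDerivAt_logPhase κ ht0).continuousAt.mul (hasDerivAt_expI w t).continuousAt)
    exact Complex.continuous_ofReal.continuousAt.comp (continuousAt_inv₀ ht0.ne')
  have hint2 := hcontOn.intervalIntegrable (μ := volume)
  have hftc := intervalIntegral.integral_eq_sub_of_hasDerivAt hder
    ((hbm.intervalIntegrable 1 T).add hint2)
  rw [intervalIntegral.integral_add (hbm.intervalIntegrable 1 T) hint2] at hftc
  have h2 : ‖∫ t in (1 : ℝ)..T, ((κ / w : ℝ) : ℂ) * ((t⁻¹ : ℝ) : ℂ) *
          (logPhase κ t * Complex.exp (Complex.I * w * t))‖ ≤ |κ / w| * Real.log T := by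
    have hl : |κ / w| * Real.log T = ∫ t in (1 : ℝ)..T, |κ / w| * t⁻¹ := by
      rw [intervalIntegral.integral_const_mul, integral_inv_of_pos one_pos (by linarith), div_one]
    rw [hl]
    refine intervalIntegral.norm_integral_le_of_norm_le hT (Eventually.of_forall fun t ht => ?_) ?_
    · rw [norm_mul, norm_mul, norm_mul, norm_logPhase, norm_exp_I_mul_mul, Complex.norm_real,
        Complex.norm_real, mul_one, mul_one, Real.norm_eq_abs, Real.norm_eq_abs,
        abs_of_pos (inv_pos.mpr (by linarith [ht.1] : 0 < t))]
    · refine ContinuousOn.intervalIntegrable ?_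
      intro t ht
      rw [uIcc_of_le hT] at ht
      have ht0 : t ≠ 0 := by linarith [ht.1]
      exact (continuousAt_const.mul (continuousAt_inv₀ ht0)).continuousWithinAt
  have h3 : ∀ t : ℝ, ‖logPhase κ t * Complex.exp (Complex.I * w * t) / (Complex.I * w)‖
      = 1 / |w| := by
    intro t
    rw [norm_div, norm_mul, norm_logPhase, norm_exp_I_mul_mul, norm_mul, Complex.norm_I,
      Complex.norm_real, Real.norm_eq_abs, one_mul, one_mul]
  have h4 : ∫ t in (1 : ℝ)..T, logPhase κ t * Complex.exp (Complex.I * w * t)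
      = (logPhase κ T * Complex.exp (Complex.I * w * T) / (Complex.I * w)
        - logPhase κ 1 * Complex.exp (Complex.I * w * (1 : ℝ)) / (Complex.I * w))
        - ∫ t in (1 : ℝ)..T, ((κ / w : ℝ) : ℂ) * ((t⁻¹ : ℝ) : ℂ) *
          (logPhase κ t * Complex.exp (Complex.I * w * t)) := by
    rw [← hftc]; ring
  rw [h4]
  refine (norm_add_le _ _).trans ?_
  have h5 := (norm_sub_le (logPhase κ T * Complex.exp (Complex.I * w * T) / (Complex.I * w)
        - logPhase κ 1 * Complex.exp (Complex.I * w * (1 : ℝ)) / (Complex.I * w))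
    (∫ t in (1 : ℝ)..T, ((κ / w : ℝ) : ℂ) * ((t⁻¹ : ℝ) : ℂ) *
          (logPhase κ t * Complex.exp (Complex.I * w * t))))
  have h6 := norm_sub_le (logPhase κ T * Complex.exp (Complex.I * w * T) / (Complex.I * w))
    (logPhase κ 1 * Complex.exp (Complex.I * w * (1 : ℝ)) / (Complex.I * w))
  rw [h3, h3] at h6
  have h7 : 2 / |w| = 1 / |w| + 1 / |w| := by ring
  linarith

theorem tendsto_twistedMean_expI (κ : ℝ) {w : ℝ} (hw : w ≠ 0) :
    Tendsto (twistedMean κ (fun t => Complex.exp (Complex.I * w * t))) atTop (𝓝 0) := by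
  have h1 : Tendsto (fun T : ℝ => ‖(1 + Complex.I * κ : ℂ)‖ *
      ((1 + 2 / |w|) * T⁻¹ + |κ / w| * (Real.log T / T))) atTop (𝓝 0) := by
    have hlog : Tendsto (fun T : ℝ => Real.log T / T) atTop (𝓝 0) := by
      have := Real.isLittleO_log_id_atTop.tendsto_div_nhds_zero
      exact this
    have h := ((tendsto_inv_atTop_zero (𝕜 := ℝ)).const_mul (1 + 2 / |w|)).add
      (hlog.const_mul |κ / w|)
    have h' := h.const_mul ‖(1 + Complex.I * κ : ℂ)‖
    simpa using h'
  refine squeeze_zero_norm' ?_ h1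
  filter_upwards [eventually_ge_atTop 1] with T hT
  have hT0 : 0 < T := by linarith
  rw [norm_twistedMean_eq κ _ hT0]
  gcongr
  have := norm_integral_logPhase_mul_expI_le κ hw hT
  calc T⁻¹ * _ ≤ T⁻¹ * (1 + 2 / |w| + |κ / w| * Real.log T) := by gcongr
    _ = _ := by ring

theorem tendsto_twistedMean_expI_ite (κ w : ℝ) :
    Tendsto (twistedMean κ (fun t => Complex.exp (Complex.I * w * t))) atTop
      (𝓝 (if w = 0 then 1 else 0)) := by
  split_ifs with h
  · simpa [h] using tendsto_twistedMean_one κ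
  · exact tendsto_twistedMean_expI κ h

/-- Convergence of twisted means passes to limits in the mean-norm. -/
theorem exists_tendsto_twistedMean_of_approx (κ : ℝ) {g : ℝ → ℂ} (hg : BddMeas g)
    (h : ∀ η > 0, ∃ g' : ℝ → ℂ, BddMeas g' ∧ (∃ m, Tendsto (twistedMean κ g') atTop (𝓝 m)) ∧
      ∀ᶠ T in atTop, normMean (fun t => g t - g' t) T ≤ η) :
    ∃ m, Tendsto (twistedMean κ g) atTop (𝓝 m) := by
  have hC : 0 < ‖(1 + Complex.I * κ : ℂ)‖ := norm_pos_iff.mpr (one_add_I_mul_ne_zero κ)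
  refine cauchy_map_iff_exists_tendsto.mp ?_
  rw [Metric.cauchy_iff]
  refine ⟨inferInstance, fun ε hε => ?_⟩
  obtain ⟨g', hg', ⟨m, hm⟩, hclose⟩ := h (ε / 4 / ‖(1 + Complex.I * κ : ℂ)‖) (by positivity)
  have h1 : ∀ᶠ T in atTop, dist (twistedMean κ g T) m < ε / 2 := by
    filter_upwards [hclose, Metric.tendsto_nhds.mp hm (ε / 4) (by positivity),
      eventually_gt_atTop 0] with T hT1 hT2 hT3
    have h2 := norm_twistedMean_le κ (fun t => g t - g' t) hT3
    rw [twistedMean_sub κ hg hg'] at h2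
    have h3 : ‖twistedMean κ g T - twistedMean κ g' T‖ ≤ ε / 4 := by
      refine h2.trans ?_
      calc _ ≤ ‖(1 + Complex.I * κ : ℂ)‖ * (ε / 4 / ‖(1 + Complex.I * κ : ℂ)‖) := by gcongr
        _ = ε / 4 := by field_simp
    rw [← dist_eq_norm] at h3
    have := dist_triangle (twistedMean κ g T) (twistedMean κ g' T) m
    linarith
  refine ⟨Metric.ball m (ε / 2), h1, fun x hx y hy => ?_⟩
  rw [Metric.mem_ball] at hx hy
  have := dist_triangle_right x y m
  linarith

theorem tendsto_twistedMean_zero_of_approx (κ : ℝ) {g : ℝ → ℂ} (hg : BddMeas g)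
    (h : ∀ η > 0, ∃ g' : ℝ → ℂ, BddMeas g' ∧ Tendsto (twistedMean κ g') atTop (𝓝 0) ∧
      ∀ᶠ T in atTop, normMean (fun t => g t - g' t) T ≤ η) :
    Tendsto (twistedMean κ g) atTop (𝓝 0) := by
  have hC : 0 < ‖(1 + Complex.I * κ : ℂ)‖ := norm_pos_iff.mpr (one_add_I_mul_ne_zero κ)
  rw [Metric.tendsto_nhds]
  intro ε hε
  obtain ⟨g', hg', hm, hclose⟩ := h (ε / 4 / ‖(1 + Complex.I * κ : ℂ)‖) (by positivity)
  filter_upwards [hclose, Metric.tendsto_nhds.mp hm (ε / 4) (by positivity),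
    eventually_gt_atTop 0] with T hT1 hT2 hT3
  have h2 := norm_twistedMean_le κ (fun t => g t - g' t) hT3
  rw [twistedMean_sub κ hg hg'] at h2
  have h3 : ‖twistedMean κ g T - twistedMean κ g' T‖ ≤ ε / 4 := by
    refine h2.trans ?_
    calc _ ≤ ‖(1 + Complex.I * κ : ℂ)‖ * (ε / 4 / ‖(1 + Complex.I * κ : ℂ)‖) := by gcongr
      _ = ε / 4 := by field_simp
  rw [← dist_eq_norm] at h3
  have := dist_triangle (twistedMean κ g T) (twistedMean κ g' T) 0
  linarith

/-! ### Weyl's criterion and the Benford property -/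

theorem volume_real_inter_eq_integral {S : Set ℝ} (hS : MeasurableSet S) {T : ℝ} (hT : 0 ≤ T) :
    volume.real {t : ℝ | 0 ≤ t ∧ t ≤ T ∧ t ∈ S}
      = ∫ t in (0 : ℝ)..T, S.indicator (fun _ => (1 : ℝ)) t := by
  have h1 : {t : ℝ | 0 ≤ t ∧ t ≤ T ∧ t ∈ S} = S ∩ Icc 0 T := by
    ext t
    simp only [mem_ofPred_eq, mem_inter_iff, mem_Icc]
    tauto
  rw [h1, intervalIntegral.integral_of_le hT, ← integral_Icc_eq_integral_Ioc,
    integral_indicator hS, setIntegral_const, smul_eq_mul, mul_one, measureReal_restrict_apply hS]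

/-- The exponential `e(n x)`. -/
noncomputable def unitExp (n : ℤ) (x : ℝ) : ℂ := Complex.exp (2 * Real.pi * Complex.I * n * x)

theorem unitExp_eq (n : ℤ) (x : ℝ) :
    unitExp n x = Complex.exp (Complex.I * ((2 * Real.pi * n : ℝ) : ℂ) * x) := by
  rw [unitExp]
  congr 1
  push_cast
  ring

theorem norm_unitExp (n : ℤ) (x : ℝ) : ‖unitExp n x‖ = 1 := by
  rw [unitExp_eq, norm_exp_I_mul_mul]

theorem unitExp_fract (n : ℤ) (x : ℝ) : unitExp n (Int.fract x) = unitExp n x := by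
  rw [unitExp, unitExp, Complex.exp_eq_exp_iff_exists_int]
  refine ⟨-(n * ⌊x⌋), ?_⟩
  rw [Int.fract]
  push_cast
  ring

theorem continuous_unitExp (n : ℤ) : Continuous (unitExp n) := by
  unfold unitExp
  fun_prop

theorem unitExp_one (n : ℤ) : unitExp n 1 = 1 := by
  rw [← unitExp_fract]
  simp [unitExp]

theorem hasDerivAt_unitExp (n : ℤ) (x : ℝ) :
    HasDerivAt (unitExp n) (2 * Real.pi * Complex.I * n * unitExp n x) x := by
  have h := hasDerivAt_expI (2 * Real.pi * n) x
  have e : unitExp n = fun t : ℝ => Complex.exp (Complex.I * ((2 * Real.pi * n : ℝ) : ℂ) * t) :=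
    funext fun t => unitExp_eq n t
  rw [e]
  convert! h using 1
  push_cast
  ring

theorem integral_unitExp {n : ℤ} (hn : n ≠ 0) : ∫ x in (0 : ℝ)..1, unitExp n x = 0 := by
  have hc : (2 * Real.pi * Complex.I * n : ℂ) ≠ 0 := by
    simp [Real.pi_ne_zero, hn]
  have h := intervalIntegral.integral_eq_sub_of_hasDerivAt
    (f := fun x => unitExp n x / (2 * Real.pi * Complex.I * n)) (f' := unitExp n) (a := 0) (b := 1)
    (fun x _ => by
      convert! (hasDerivAt_unitExp n x).div_const (2 * Real.pi * Complex.I * n) using 1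
      field_simp) ((continuous_unitExp n).intervalIntegrable _ _)
  rw [h, unitExp_one]
  simp [unitExp]

/-- Means of continuous periodic functions along a sequence satisfying Weyl's condition. -/
theorem tendsto_mean_of_weyl {u : ℝ → ℝ} (hu : Measurable u)
    (h : ∀ n : ℤ, n ≠ 0 → Tendsto (twistedMean 0 fun t => unitExp n (u t)) atTop (𝓝 0))
    (g : C(AddCircle (1 : ℝ), ℂ)) :
    Tendsto (twistedMean 0 fun t => g (u t : AddCircle (1 : ℝ))) atTop
      (𝓝 (∫ x in (0 : ℝ)..1, g (x : AddCircle (1 : ℝ)))) := by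
  have hbm : ∀ g : C(AddCircle (1 : ℝ), ℂ), BddMeas (fun t => g (u t : AddCircle (1 : ℝ))) :=
    fun g => ⟨(g.continuous.comp (AddCircle.continuous_mk' 1)).measurable.comp hu, ‖g‖,
      fun t => g.norm_coe_le_norm _⟩
  have hint : ∀ g : C(AddCircle (1 : ℝ), ℂ), IntervalIntegrable
      (fun x : ℝ => g (x : AddCircle (1 : ℝ))) volume 0 1 := fun g =>
    (g.continuous.comp (AddCircle.continuous_mk' 1)).intervalIntegrable _ _
  have hspan : ∀ p ∈ Submodule.span ℂ (range (@fourier 1)),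
      Tendsto (twistedMean 0 fun t => p (u t : AddCircle (1 : ℝ))) atTop
      (𝓝 (∫ x in (0 : ℝ)..1, p (x : AddCircle (1 : ℝ)))) := by
    intro p hp
    induction hp using Submodule.span_induction with
    | mem p hp =>
      obtain ⟨n, rfl⟩ := hp
      have e : ∀ x : ℝ, fourier n (x : AddCircle (1 : ℝ)) = unitExp n x := fun x => by
        rw [fourier_coe_apply, unitExp]
        congr 1
        simp
      simp_rw [e]
      by_cases hn : n = 0
      · subst hn
        have : ∀ x, unitExp 0 x = 1 := fun x => by simp [unitExp]
        simp_rw [this]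
        simpa using tendsto_twistedMean_one 0
      · rw [integral_unitExp hn]
        exact h n hn
    | zero =>
      have e0 : twistedMean 0 (fun _ => 0) = fun _ => 0 := funext fun T => by simp [twistedMean]
      simp [e0]
    | add p q _ _ hp hq =>
      have e1 : ∫ x in (0 : ℝ)..1, (p + q) (x : AddCircle (1 : ℝ))
          = (∫ x in (0 : ℝ)..1, p (x : AddCircle (1 : ℝ)))
            + ∫ x in (0 : ℝ)..1, q (x : AddCircle (1 : ℝ)) :=
        intervalIntegral.integral_add (hint p) (hint q)
      rw [e1]
      exact (hp.add hq).congr fun T => (twistedMean_add 0 (hbm p) (hbm q) T).symm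
    | smul c p _ hp =>
      have e1 : ∫ x in (0 : ℝ)..1, (c • p) (x : AddCircle (1 : ℝ))
          = c * ∫ x in (0 : ℝ)..1, p (x : AddCircle (1 : ℝ)) :=
        intervalIntegral.integral_const_mul _ _
      rw [e1]
      exact (hp.const_mul c).congr fun T => (twistedMean_const_mul 0 c _ T).symm
  have hg : g ∈ (Submodule.span ℂ (range (@fourier 1))).topologicalClosure := by
    rw [span_fourier_closure_eq_top]
    trivial
  rw [← SetLike.mem_coe, Submodule.topologicalClosure_coe, Metric.mem_closure_iff] at hg
  rw [Metric.tendsto_nhds]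
  intro ε hε
  obtain ⟨p, hp, hgp⟩ := hg (ε / 3) (by positivity)
  have hle : ∀ y, ‖g y - p y‖ ≤ ε / 3 := fun y => by
    have := (g - p).norm_coe_le_norm y
    rw [dist_eq_norm] at hgp
    exact this.trans hgp.le
  filter_upwards [Metric.tendsto_nhds.mp (hspan p hp) (ε / 3) (by positivity),
    eventually_gt_atTop 0] with T hT1 hT2
  have h1 : ‖twistedMean 0 (fun t => g (u t : AddCircle (1 : ℝ))) T
      - twistedMean 0 (fun t => p (u t : AddCircle (1 : ℝ))) T‖ ≤ ε / 3 := by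
    rw [← twistedMean_sub 0 (hbm g) (hbm p)]
    refine (norm_twistedMean_le 0 _ hT2).trans ?_
    have := normMean_le (g := fun t => g (u t : AddCircle (1 : ℝ)) - p (u t : AddCircle (1 : ℝ)))
      hT2 (fun t _ => hle _)
    simpa using this
  have h2 : ‖(∫ x in (0 : ℝ)..1, g (x : AddCircle (1 : ℝ)))
      - ∫ x in (0 : ℝ)..1, p (x : AddCircle (1 : ℝ))‖ ≤ ε / 3 := by
    rw [← intervalIntegral.integral_sub (hint g) (hint p)]
    have := intervalIntegral.norm_integral_le_of_norm_le_const (a := 0) (b := 1) (C := ε / 3)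
      (f := fun x : ℝ => g (x : AddCircle (1 : ℝ)) - p (x : AddCircle (1 : ℝ)))
      (fun x _ => hle _)
    simpa using this
  rw [dist_eq_norm] at hT1 ⊢
  calc _ = ‖(twistedMean 0 (fun t => g (u t : AddCircle (1 : ℝ))) T
      - twistedMean 0 (fun t => p (u t : AddCircle (1 : ℝ))) T) +
      (twistedMean 0 (fun t => p (u t : AddCircle (1 : ℝ))) T
        - ∫ x in (0 : ℝ)..1, p (x : AddCircle (1 : ℝ))) -
      ((∫ x in (0 : ℝ)..1, g (x : AddCircle (1 : ℝ)))
      - ∫ x in (0 : ℝ)..1, p (x : AddCircle (1 : ℝ)))‖ := by congr 1; ring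
    _ ≤ _ := norm_sub_le _ _
    _ ≤ (_ + _) + _ := by gcongr; exact norm_add_le _ _
    _ < ε / 3 + ε / 3 + ε / 3 := by linarith
    _ = ε := by ring

theorem integral_zero_one_le_of_trapezoid {f : ℝ → ℝ} (hf : Continuous f) {x δ : ℝ} (hx : 0 ≤ x)
    (hδ : 0 < δ) (h1 : ∀ y, f y ≤ 1) (h0 : ∀ y ∈ Ioo (x + δ) (1 - δ), f y ≤ 0) :
    ∫ y in (0 : ℝ)..1, f y ≤ x + 2 * δ := by
  have hle : ∀ y, y ∈ Icc (0 : ℝ) 1 → f y ≤ (Icc 0 (x + δ)).indicator (fun _ => (1 : ℝ)) y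
      + (Icc (1 - δ) 1).indicator (fun _ => (1 : ℝ)) y := by
    intro y hy
    by_cases c1 : y ≤ x + δ
    · rw [indicator_of_mem (show y ∈ Icc 0 (x + δ) from ⟨hy.1, c1⟩)]
      have : 0 ≤ (Icc (1 - δ) 1).indicator (fun _ => (1 : ℝ)) y :=
        indicator_nonneg (fun _ _ => zero_le_one) _
      linarith [h1 y]
    · by_cases c2 : 1 - δ ≤ y
      · rw [indicator_of_mem (show y ∈ Icc (1 - δ) 1 from ⟨c2, hy.2⟩)]
        have : 0 ≤ (Icc 0 (x + δ)).indicator (fun _ => (1 : ℝ)) y :=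
          indicator_nonneg (fun _ _ => zero_le_one) _
        linarith [h1 y]
      · have a1 : 0 ≤ (Icc (1 - δ) 1).indicator (fun _ => (1 : ℝ)) y :=
          indicator_nonneg (fun _ _ => zero_le_one) _
        have a2 : 0 ≤ (Icc 0 (x + δ)).indicator (fun _ => (1 : ℝ)) y :=
          indicator_nonneg (fun _ _ => zero_le_one) _
        linarith [h0 y ⟨not_le.mp c1, not_le.mp c2⟩]
  have i1 : Integrable ((Icc 0 (x + δ)).indicator (fun _ => (1 : ℝ))) volume :=
    (integrable_indicator_iff measurableSet_Icc).mpr (integrableOn_const (by simp))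
  have i2 : Integrable ((Icc (1 - δ) 1).indicator (fun _ => (1 : ℝ))) volume :=
    (integrable_indicator_iff measurableSet_Icc).mpr (integrableOn_const (by simp))
  have hmono := intervalIntegral.integral_mono_on (a := 0) (b := 1) zero_le_one
    (hf.intervalIntegrable (μ := volume) _ _) (i1.add i2).intervalIntegrable hle
  refine hmono.trans ?_
  simp only [Pi.add_apply]
  rw [intervalIntegral.integral_of_le zero_le_one]
  have h2 := setIntegral_le_integral (s := Ioc (0 : ℝ) 1) (i1.add i2)
    (Eventually.of_forall fun y => add_nonneg (indicator_nonneg (fun _ _ => zero_le_one) _)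
      (indicator_nonneg (fun _ _ => zero_le_one) _))
  refine h2.trans ?_
  simp only [Pi.add_apply]
  rw [integral_add i1 i2, integral_indicator measurableSet_Icc, integral_indicator
    measurableSet_Icc, setIntegral_const, setIntegral_const, Real.volume_real_Icc,
    Real.volume_real_Icc, max_eq_left (by linarith), max_eq_left (by linarith)]
  simp
  linarith

/-- The indicator of `[0, x]` is dominated by a continuous function on the circle, whose time means
converge to its integral. -/
theorem eventually_density_le_of_weyl {u : ℝ → ℝ} (hu : Measurable u)
    (h : ∀ n : ℤ, n ≠ 0 → Tendsto (twistedMean 0 fun t => unitExp n (u t)) atTop (𝓝 0))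
    {x : ℝ} (hx : 0 ≤ x) {η : ℝ} (hη : 0 < η) :
    ∀ᶠ T in atTop, volume.real {t : ℝ | 0 ≤ t ∧ t ≤ T ∧ Int.fract (u t) ≤ x} / T ≤ x + η := by
  -- The two ramps cost at most `2δ` in the integral and the convergence of the mean another `δ`.
  set δ := η / 4 with hδ
  have hδ0 : 0 < δ := by positivity
  -- The first ramp descends on `[x, x + δ]`; the second rises to `1` at `y = 1`, in order that `f 0
  -- = f 1` and `f` descends to the circle.
  let f : ℝ → ℝ := fun y => max 0 (max (min 1 (1 - (y - x) / δ)) (min 1 (1 - (1 - y) / δ)))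
  have hf : Continuous f := by fun_prop
  have hf1 : ∀ y, f y ≤ 1 := fun y => by simp [f]
  have hf0 : ∀ y, 0 ≤ f y := fun y => by simp [f]
  have hper : f 0 = f (0 + 1) := by
    have e1 : f 0 = 1 := by
      apply le_antisymm (hf1 0)
      have : 0 ≤ x / δ := by positivity
      simp only [f]
      refine le_max_of_le_right (le_max_of_le_left (le_min le_rfl ?_))
      rw [zero_sub, neg_div]
      linarith
    have e2 : f (0 + 1) = 1 := by
      apply le_antisymm (hf1 _)
      simp only [f]
      refine le_max_of_le_right (le_max_of_le_right (le_min le_rfl ?_))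
      simp
    rw [e1, e2]
  have hfx : ∀ y, y ≤ x → f y = 1 := by
    intro y hy
    apply le_antisymm (hf1 y)
    refine le_max_of_le_right (le_max_of_le_left (le_min le_rfl ?_))
    have : (y - x) / δ ≤ 0 := div_nonpos_of_nonpos_of_nonneg (by linarith) hδ0.le
    linarith
  have hf00 : ∀ y ∈ Ioo (x + δ) (1 - δ), f y ≤ 0 := by
    intro y hy
    have a1 : 1 ≤ (y - x) / δ := by rw [le_div_iff₀ hδ0]; linarith [hy.1]
    have a2 : 1 ≤ (1 - y) / δ := by rw [le_div_iff₀ hδ0]; linarith [hy.2]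
    refine max_le le_rfl (max_le ((min_le_right _ _).trans (by linarith))
      ((min_le_right _ _).trans (by linarith)))
  have hcont : Continuous (AddCircle.liftIco (1 : ℝ) 0 (fun y => (f y : ℂ))) := by
    refine AddCircle.liftIco_continuous ?_ ?_
    · exact congrArg _ hper
    · exact (Complex.continuous_ofReal.comp hf).continuousOn
  have hmean := tendsto_mean_of_weyl hu h ⟨_, hcont⟩
  have e1 : ∀ t : ℝ, AddCircle.liftIco (1 : ℝ) 0 (fun y => (f y : ℂ)) (t : AddCircle (1 : ℝ))
      = (f (Int.fract t) : ℂ) := by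
    intro t
    have : (t : AddCircle (1 : ℝ)) = ((Int.fract t : ℝ) : AddCircle (1 : ℝ)) := by
      rw [Int.fract, AddCircle.coe_sub]
      have : ((⌊t⌋ : ℝ) : AddCircle (1 : ℝ)) = 0 := by
        rw [AddCircle.coe_eq_zero_iff]
        exact ⟨⌊t⌋, by simp⟩
      rw [this, sub_zero]
    rw [this, AddCircle.liftIco_coe_apply]
    exact ⟨Int.fract_nonneg t, by simpa using Int.fract_lt_one t⟩
  simp only [ContinuousMap.coe_mk, e1] at hmean
  have e2 : ∫ y in (0 : ℝ)..1, (f (Int.fract y) : ℂ) = ((∫ y in (0 : ℝ)..1, f y : ℝ) : ℂ) := by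
    rw [← intervalIntegral.integral_ofReal]
    refine intervalIntegral.integral_congr_ae ?_
    have : ∀ᵐ y : ℝ, y ≠ 1 := by simp [ae_iff]
    filter_upwards [this] with y hy1 hy
    rw [uIoc_of_le zero_le_one] at hy
    rw [Int.fract_eq_self.mpr ⟨hy.1.le, lt_of_le_of_ne hy.2 hy1⟩]
  rw [e2] at hmean
  have hI := integral_zero_one_le_of_trapezoid hf hx hδ0 hf1 hf00
  filter_upwards [Metric.tendsto_nhds.mp hmean δ hδ0, eventually_gt_atTop 0] with T hT1 hT
  have hfm : Measurable (fun t => f (Int.fract (u t))) :=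
    hf.measurable.comp (measurable_fract.comp hu)
  have e3 : twistedMean 0 (fun t => (f (Int.fract (u t)) : ℂ)) T
      = ((T⁻¹ * ∫ t in (0 : ℝ)..T, f (Int.fract (u t)) : ℝ) : ℂ) := by
    rw [twistedMean_zero, intervalIntegral.integral_ofReal]
    push_cast
    rfl
  rw [e3, dist_eq_norm, ← Complex.ofReal_sub, Complex.norm_real, Real.norm_eq_abs] at hT1
  have hT2 := (abs_lt.mp hT1).2
  have hS : MeasurableSet {t | Int.fract (u t) ≤ x} :=
    measurableSet_le (measurable_fract.comp hu) measurable_const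
  have e4 := volume_real_inter_eq_integral hS hT.le
  simp only [mem_ofPred_eq] at e4
  rw [e4, div_eq_inv_mul]
  have hfi : IntervalIntegrable (fun t => f (Int.fract (u t))) volume 0 T := by
    rw [intervalIntegrable_iff]
    exact Measure.integrableOn_of_bounded (M := 1) (by simp) hfm.aestronglyMeasurable
      (Eventually.of_forall fun t => by
        rw [Real.norm_of_nonneg (hf0 _)]; exact hf1 _)
  have hmono : ∫ t in (0 : ℝ)..T, {t | Int.fract (u t) ≤ x}.indicator (fun _ => (1 : ℝ)) t
      ≤ ∫ t in (0 : ℝ)..T, f (Int.fract (u t)) := by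
    refine intervalIntegral.integral_mono_on hT.le ?_ hfi ?_
    · rw [intervalIntegrable_iff]
      exact Measure.integrableOn_of_bounded (M := 1) (by simp)
        ((measurable_const.indicator hS).aestronglyMeasurable)
        (Eventually.of_forall fun t => by
          refine (norm_indicator_le_norm_self _ _).trans (by simp))
    · intro t _
      by_cases ht : Int.fract (u t) ≤ x
      · rw [indicator_of_mem (by exact ht), hfx _ ht]
      · rw [indicator_of_notMem (by exact ht)]
        exact hf0 _
  have := mul_le_mul_of_nonneg_left hmono (inv_pos.mpr hT).le
  linarith

theorem volume_inter_ne_top (S : ℝ → Prop) (T : ℝ) :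
    volume {t : ℝ | 0 ≤ t ∧ t ≤ T ∧ S t} ≠ ⊤ := by
  have h : {t : ℝ | 0 ≤ t ∧ t ≤ T ∧ S t} ⊆ Icc 0 T := fun t ht => ⟨ht.1, ht.2.1⟩
  exact ((measure_mono h).trans_lt (by simp)).ne

theorem volume_real_inter_le (S : ℝ → Prop) {T : ℝ} (hT : 0 ≤ T) :
    volume.real {t : ℝ | 0 ≤ t ∧ t ≤ T ∧ S t} ≤ T := by
  have := measureReal_mono (μ := volume) (s₁ := {t : ℝ | 0 ≤ t ∧ t ≤ T ∧ S t}) (s₂ := Icc 0 T)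
    (fun t ht => ⟨ht.1, ht.2.1⟩) (by simp)
  rwa [Real.volume_real_Icc_of_le hT, sub_zero] at this

/-- The upper bound for `-u` at `1 - x` yields the lower bound for `u` at `x`, as the two sets of
times cover `[0, T]`. -/
theorem tendsto_density_of_weyl {u : ℝ → ℝ} (hu : Measurable u)
    (h : ∀ n : ℤ, n ≠ 0 → Tendsto (twistedMean 0 fun t => unitExp n (u t)) atTop (𝓝 0))
    {x : ℝ} (hx : x ∈ Ico (0 : ℝ) 1) :
    Tendsto (fun T => volume.real {t : ℝ | 0 ≤ t ∧ t ≤ T ∧ Int.fract (u t) ≤ x} / T) atTop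
      (𝓝 x) := by
  rw [Metric.tendsto_nhds]
  intro ε hε
  have hneg : ∀ n : ℤ, n ≠ 0 →
      Tendsto (twistedMean 0 fun t => unitExp n (-u t)) atTop (𝓝 0) := by
    intro n hn
    have := h (-n) (neg_ne_zero.mpr hn)
    have e : ∀ t, unitExp n (-u t) = unitExp (-n) (u t) := fun t => by
      rw [unitExp, unitExp]
      push_cast
      ring_nf
    simpa only [e] using this
  filter_upwards [eventually_density_le_of_weyl hu h hx.1 (half_pos hε),
    eventually_density_le_of_weyl hu.neg hneg (by linarith [hx.2] : (0 : ℝ) ≤ 1 - x)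
      (half_pos hε), eventually_gt_atTop 0] with T h1 h2 hT
  have hcover : Icc 0 T ⊆ {t : ℝ | 0 ≤ t ∧ t ≤ T ∧ Int.fract (u t) ≤ x} ∪
      {t : ℝ | 0 ≤ t ∧ t ≤ T ∧ Int.fract (-u t) ≤ 1 - x} := by
    intro t ht
    by_cases hc : Int.fract (u t) ≤ x
    · exact Or.inl ⟨ht.1, ht.2, hc⟩
    · refine Or.inr ⟨ht.1, ht.2, ?_⟩
      have hne : Int.fract (u t) ≠ 0 := by
        have := hx.1
        intro h0
        rw [h0] at hc
        exact hc this
      rw [Int.fract_neg hne]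
      linarith [not_le.mp hc]
  have h3 : T ≤ volume.real {t : ℝ | 0 ≤ t ∧ t ≤ T ∧ Int.fract (u t) ≤ x} +
      volume.real {t : ℝ | 0 ≤ t ∧ t ≤ T ∧ Int.fract (-u t) ≤ 1 - x} := by
    have := (measureReal_mono (μ := volume) hcover
      (measure_union_ne_top (volume_inter_ne_top _ _) (volume_inter_ne_top _ _))).trans (measureReal_union_le _ _)
    rwa [Real.volume_real_Icc_of_le hT.le, sub_zero] at this
  have h4 : 1 ≤ volume.real {t : ℝ | 0 ≤ t ∧ t ≤ T ∧ Int.fract (u t) ≤ x} / T +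
      volume.real {t : ℝ | 0 ≤ t ∧ t ≤ T ∧ Int.fract (-u t) ≤ 1 - x} / T := by
    rw [← add_div, le_div_iff₀ hT, one_mul]
    exact h3
  simp only [Pi.neg_apply] at h2
  rw [Real.dist_eq, abs_lt]
  constructor <;> linarith

/-- The fundamental theorem of calculus on `[x, 1]`. The lower limit is put into an indicator so
that Fubini applies when `x` is a function of time. -/
theorem unitExp_eq_one_sub_integral {n : ℤ} {x : ℝ} (hx : x ∈ Ico (0 : ℝ) 1) :
    unitExp n x = 1 - ∫ y in Ioc (0 : ℝ) 1,
      {y | x ≤ y}.indicator (fun y => 2 * Real.pi * Complex.I * n * unitExp n y) y := by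
  have hm : MeasurableSet {y : ℝ | x ≤ y} := measurableSet_Ici
  rw [setIntegral_indicator hm]
  have hset : (Ioc (0 : ℝ) 1 ∩ {y | x ≤ y} : Set ℝ) =ᵐ[volume] Ioc x 1 := by
    have hne : ∀ᵐ y : ℝ, y ≠ x := by simp [ae_iff]
    filter_upwards [hne] with y hy
    apply propext
    change y ∈ Ioc (0 : ℝ) 1 ∩ {y | x ≤ y} ↔ y ∈ Ioc x 1
    constructor
    · rintro ⟨⟨_, h2⟩, h3⟩
      exact ⟨lt_of_le_of_ne h3 hy.symm, h2⟩
    · rintro ⟨h1, h2⟩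
      exact ⟨⟨hx.1.trans_lt h1, h2⟩, h1.le⟩
  rw [setIntegral_congr_set hset, ← intervalIntegral.integral_of_le hx.2.le,
    intervalIntegral.integral_eq_sub_of_hasDerivAt (fun y _ => hasDerivAt_unitExp n y)
      ((continuous_const.mul (continuous_unitExp n)).intervalIntegrable _ _), unitExp_one]
  ring

/-- By Fubini, the mean of `e(nu)` is `1 - ∫ D_T(y) e(ny)' dy`, with `D_T` the empirical
distribution function. Dominated convergence replaces `D_T(y)` by `y`, and integration by parts
evaluates the limit to 0. -/
theorem weyl_of_tendsto_density {u : ℝ → ℝ} (hu : Measurable u)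
    (h : ∀ x ∈ Ico (0 : ℝ) 1,
      Tendsto (fun T => volume.real {t : ℝ | 0 ≤ t ∧ t ≤ T ∧ Int.fract (u t) ≤ x} / T) atTop
      (𝓝 x)) {n : ℤ} (hn : n ≠ 0) :
    Tendsto (twistedMean 0 fun t => unitExp n (u t)) atTop (𝓝 0) := by
  set c : ℂ := 2 * Real.pi * Complex.I * n with hc
  set D : ℝ → ℝ → ℝ := fun T x =>
    volume.real {t : ℝ | 0 ≤ t ∧ t ≤ T ∧ Int.fract (u t) ≤ x} / T with hD
  have hmeas : MeasurableSet {p : ℝ × ℝ | Int.fract (u p.1) ≤ p.2} :=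
    measurableSet_le (measurable_fract.comp (hu.comp measurable_fst)) measurable_snd
  have hrep : ∀ T : ℝ, 0 < T → twistedMean 0 (fun t => unitExp n (u t)) T
      = 1 - ∫ y in Ioc (0 : ℝ) 1, (D T y : ℂ) * (c * unitExp n y) := by
    intro T hT
    let K : ℝ → ℝ → ℂ := fun t y =>
      {y | Int.fract (u t) ≤ y}.indicator (fun y => c * unitExp n y) y
    have hKm : Measurable (Function.uncurry K) := by
      have : Function.uncurry K = {p : ℝ × ℝ | Int.fract (u p.1) ≤ p.2}.indicator
          (fun p => c * unitExp n p.2) := by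
        ext p
        simp only [Function.uncurry, K, indicator, mem_ofPred_eq]
      rw [this]
      exact (measurable_const.mul ((continuous_unitExp n).measurable.comp
        measurable_snd)).indicator hmeas
    have hKb : ∀ t y, ‖K t y‖ ≤ ‖c‖ := fun t y => by
      refine (norm_indicator_le_norm_self _ _).trans ?_
      rw [norm_mul, norm_unitExp, mul_one]
    have hKi : Integrable (Function.uncurry K)
        ((volume.restrict (Ioc 0 T)).prod (volume.restrict (Ioc (0 : ℝ) 1))) :=
      Integrable.of_bound hKm.aestronglyMeasurable ‖c‖ (Eventually.of_forall fun p => hKb _ _)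
    have hT0 : (T : ℂ) ≠ 0 := by exact_mod_cast hT.ne'
    have e1 : ∀ t, unitExp n (u t) = 1 - ∫ y in Ioc (0 : ℝ) 1, K t y := fun t => by
      rw [← unitExp_fract, unitExp_eq_one_sub_integral
        ⟨Int.fract_nonneg _, Int.fract_lt_one _⟩]
    rw [twistedMean_zero]
    simp_rw [e1]
    have hKi1 : Integrable (fun t => ∫ y in Ioc (0 : ℝ) 1, K t y) (volume.restrict (Ioc 0 T)) :=
      hKi.integral_prod_left
    rw [intervalIntegral.integral_of_le hT.le, integral_sub (integrable_const _) hKi1,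
      integral_integral_swap hKi]
    have e2 : ∀ y, ∫ t in Ioc 0 T, K t y = (T : ℂ) * ((D T y : ℂ) * (c * unitExp n y)) := by
      intro y
      have hS : MeasurableSet {t | Int.fract (u t) ≤ y} :=
        measurableSet_le (measurable_fract.comp hu) measurable_const
      have h1 := volume_real_inter_eq_integral hS hT.le
      simp only [mem_ofPred_eq] at h1
      have h2 : ∀ t, K t y = (({t | Int.fract (u t) ≤ y}.indicator (fun _ => (1 : ℝ)) t : ℝ) : ℂ)
          * (c * unitExp n y) := by
        intro t
        by_cases hty : Int.fract (u t) ≤ y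
        · simp [K, indicator, hty]
        · simp [K, indicator, hty]
      simp_rw [h2]
      rw [integral_mul_const, ← intervalIntegral.integral_of_le hT.le,
        intervalIntegral.integral_ofReal, ← h1, hD]
      push_cast
      field_simp
    simp_rw [e2]
    rw [integral_const_mul, integral_const]
    simp only [measureReal_restrict_apply_univ, Real.volume_real_Ioc, sub_zero, max_eq_left hT.le]
    rw [Complex.real_smul]
    field_simp
    refine congrArg (1 - ·) (integral_congr_ae (Eventually.of_forall fun a => ?_))
    simp only
    ring
  have hval : (1 : ℂ) - ∫ y in Ioc (0 : ℝ) 1, (y : ℂ) * (c * unitExp n y) = 0 := by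
    rw [← intervalIntegral.integral_of_le zero_le_one]
    have hd : ∀ y ∈ uIcc (0 : ℝ) 1, HasDerivAt (fun y : ℝ => (y : ℂ)) 1 y := fun y _ =>
      (hasDerivAt_id (y : ℂ)).comp_ofReal
    rw [intervalIntegral.integral_mul_deriv_eq_deriv_mul hd
      (fun y _ => hasDerivAt_unitExp n y) (by simp)
      ((continuous_const.mul (continuous_unitExp n)).intervalIntegrable _ _)]
    simp only [one_mul]
    rw [integral_unitExp hn, unitExp_one]
    simp
  rw [← hval]
  have hlim : Tendsto (fun T => ∫ y in Ioc (0 : ℝ) 1, (D T y : ℂ) * (c * unitExp n y)) atTop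
      (𝓝 (∫ y in Ioc (0 : ℝ) 1, (y : ℂ) * (c * unitExp n y))) := by
    refine tendsto_integral_filter_of_dominated_convergence (fun _ => ‖c‖) ?_ ?_
      (integrable_const _) ?_
    · filter_upwards [eventually_gt_atTop 0] with T hT
      have hmono : Monotone (D T) := by
        intro x y hxy
        simp only [hD]
        refine div_le_div_of_nonneg_right (measureReal_mono (fun t ht => ?_)
          (volume_inter_ne_top _ _)) hT.le
        exact ⟨ht.1, ht.2.1, ht.2.2.trans hxy⟩
      exact ((Complex.measurable_ofReal.comp hmono.measurable).mul
        (measurable_const.mul (continuous_unitExp n).measurable)).aestronglyMeasurable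
    · filter_upwards [eventually_gt_atTop 0] with T hT
      refine Eventually.of_forall fun y => ?_
      rw [norm_mul, norm_mul, norm_unitExp, mul_one, Complex.norm_real, Real.norm_of_nonneg
        (div_nonneg measureReal_nonneg hT.le)]
      refine mul_le_of_le_one_left (norm_nonneg _) ?_
      rw [div_le_one hT]
      exact volume_real_inter_le _ hT.le
    · rw [ae_restrict_iff' measurableSet_Ioc]
      have : ∀ᵐ y : ℝ, y ≠ 1 := by simp [ae_iff]
      filter_upwards [this] with y hy1 hy
      exact ((Complex.continuous_ofReal.tendsto _).comp
        (h y ⟨hy.1.le, lt_of_le_of_ne hy.2 hy1⟩)).mul_const _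
  refine (hlim.const_sub 1).congr' ?_
  filter_upwards [eventually_gt_atTop 0] with T hT
  exact (hrep T hT).symm

/-- The fractional part of `log_b |x|` is `log_b` of the significand. At `x = 0` both sides are
true, by the conventions `S_b(0) = 0` and `Real.logb b 0 = 0`. -/
theorem significand_le_iff {b : ℕ} (hb : 2 ≤ b) {s : ℝ} (hs : 1 ≤ s) (x : ℝ) :
    significand b x ≤ s ↔ Int.fract (Real.logb b x) ≤ Real.logb b s := by
  have hb1 : (1 : ℝ) < b := by exact_mod_cast hb
  have hb0 : (0 : ℝ) < b := by linarith
  by_cases hx : x = 0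
  · subst hx
    rw [significand_zero, Real.logb_zero, Int.fract_zero]
    exact iff_of_true (by linarith) (Real.logb_nonneg hb1 hs)
  · obtain ⟨h1, h2, k, hk⟩ := significand_spec hb hx
    have hpos : 0 < significand b x := by linarith
    have e1 : Real.logb b x = Real.logb b (significand b x) + k := by
      rw [← Real.logb_abs, hk, Real.logb_mul hpos.ne' (zpow_pos hb0 k).ne', ← Real.rpow_intCast,
        Real.logb_rpow hb0 hb1.ne']
    have e2 : Int.fract (Real.logb b x) = Real.logb b (significand b x) := by
      rw [e1, Int.fract_add_intCast, Int.fract_eq_self]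
      refine ⟨Real.logb_nonneg hb1 h1, ?_⟩
      rw [Real.logb_lt_iff_lt_rpow hb1 hpos, Real.rpow_one]
      exact h2
    rw [e2, Real.logb_le_logb hb1 hpos (by linarith)]

/-- Weyl's criterion for the Benford property. -/
theorem isBenford_iff {b : ℕ} (hb : 2 ≤ b) {f : ℝ → ℝ} (hf : Measurable f) :
    IsBenford b f ↔ ∀ n : ℤ, n ≠ 0 →
      Tendsto (twistedMean 0 fun t => logPhase (2 * Real.pi * n / Real.log b) (f t)) atTop
        (𝓝 0) := by
  have hb1 : (1 : ℝ) < b := by exact_mod_cast hb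
  have hlogm : Measurable (fun t => Real.logb b (f t)) := by
    unfold Real.logb
    fun_prop
  have e : ∀ (n : ℤ) (x : ℝ), logPhase (2 * Real.pi * n / Real.log b) x
      = unitExp n (Real.logb b x) := by
    intro n x
    rw [logPhase, unitExp, Real.logb]
    congr 1
    push_cast
    ring
  simp only [e]
  constructor
  · intro h n hn
    refine weyl_of_tendsto_density hlogm (fun x hx => ?_) hn
    have hs : (b : ℝ) ^ x ∈ Ico (1 : ℝ) b := by
      refine ⟨Real.one_le_rpow hb1.le hx.1, ?_⟩
      calc (b : ℝ) ^ x < (b : ℝ) ^ (1 : ℝ) := Real.rpow_lt_rpow_of_exponent_lt hb1 hx.2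
        _ = b := Real.rpow_one _
    have := h.2 _ hs
    simp only [significand_le_iff hb hs.1] at this
    rwa [Real.logb_rpow (by linarith) hb1.ne'] at this
  · intro h
    refine ⟨hf.comp measurable_subtype_coe, fun s hs => ?_⟩
    simp only [significand_le_iff hb hs.1]
    refine tendsto_density_of_weyl hlogm h ⟨Real.logb_nonneg hb1 hs.1, ?_⟩
    rw [Real.logb_lt_iff_lt_rpow hb1 (by linarith [hs.1]), Real.rpow_one]
    exact hs.2

/-! ### Trigonometric polynomials -/

/-- The character `t ↦ e^{iwt}`. -/
noncomputable def character (w t : ℝ) : ℂ := Complex.exp (Complex.I * w * t)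

theorem character_add (v w : ℝ) : character (v + w) = character v * character w := by
  ext t
  simp only [character, Pi.mul_apply, ← Complex.exp_add]
  congr 1
  push_cast
  ring

theorem character_zero : character 0 = 1 := by
  ext t
  simp [character]

theorem norm_character (w t : ℝ) : ‖character w t‖ = 1 := norm_exp_I_mul_mul w t

theorem bddMeas_character (w : ℝ) : BddMeas (character w) := BddMeas.expI w

theorem conj_character (w t : ℝ) : starRingEnd ℂ (character w t) = character (-w) t := by
  rw [character, character, ← Complex.exp_conj]
  congr 1
  simp

/-- Complex trigonometric polynomials with frequencies in `Λ`. -/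
noncomputable def trigSpan (Λ : AddSubgroup ℝ) : Submodule ℂ (ℝ → ℂ) :=
  Submodule.span ℂ (character '' Λ)

theorem character_mem_trigSpan {Λ : AddSubgroup ℝ} {w : ℝ} (hw : w ∈ Λ) :
    character w ∈ trigSpan Λ := Submodule.subset_span ⟨w, hw, rfl⟩

theorem one_mem_trigSpan (Λ : AddSubgroup ℝ) : (1 : ℝ → ℂ) ∈ trigSpan Λ := by
  rw [← character_zero]
  exact character_mem_trigSpan Λ.zero_mem

theorem mul_mem_trigSpan {Λ : AddSubgroup ℝ} {f g : ℝ → ℂ} (hf : f ∈ trigSpan Λ)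
    (hg : g ∈ trigSpan Λ) : f * g ∈ trigSpan Λ := by
  have h := Submodule.mul_mem_mul hf hg
  rw [trigSpan, Submodule.span_mul_span] at h
  refine Submodule.span_mono ?_ h
  rintro _ ⟨_, ⟨v, hv, rfl⟩, _, ⟨w, hw, rfl⟩, rfl⟩
  exact ⟨v + w, Λ.add_mem hv hw, character_add v w⟩

theorem bddMeas_of_mem_trigSpan {Λ : AddSubgroup ℝ} {f : ℝ → ℂ} (hf : f ∈ trigSpan Λ) :
    BddMeas f := by
  induction hf using Submodule.span_induction with
  | mem f hf =>
    obtain ⟨w, _, rfl⟩ := hf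
    exact bddMeas_character w
  | zero => exact BddMeas.const 0
  | add f g _ _ hf hg => exact hf.add hg
  | smul c f _ hf => exact hf.const_mul c

theorem exists_tendsto_twistedMean_character_mul (κ μ : ℝ) {Λ : AddSubgroup ℝ} {f : ℝ → ℂ}
    (hf : f ∈ trigSpan Λ) :
    ∃ m, Tendsto (twistedMean κ fun t => character μ t * f t) atTop (𝓝 m) ∧
      ((∀ w ∈ Λ, μ + w ≠ 0) → m = 0) := by
  induction hf using Submodule.span_induction with
  | mem f hf =>
    obtain ⟨w, hw, rfl⟩ := hf
    have h := tendsto_twistedMean_expI_ite κ (μ + w)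
    have e : (fun t : ℝ => character μ t * character w t)
        = fun t : ℝ => Complex.exp (Complex.I * ((μ + w : ℝ) : ℂ) * t) :=
      (character_add μ w).symm
    rw [e]
    exact ⟨_, h, fun hne => by rw [if_neg (hne w hw)]⟩
  | zero =>
    have e0 : twistedMean κ (fun t => character μ t * (0 : ℝ → ℂ) t) = fun _ => 0 :=
      funext fun T => by simp [twistedMean]
    exact ⟨0, by rw [e0]; exact tendsto_const_nhds, fun _ => rfl⟩
  | add f g hfm hgm hf hg =>
    obtain ⟨m, hm, hm0⟩ := hf
    obtain ⟨m', hm', hm0'⟩ := hg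
    refine ⟨m + m', (hm.add hm').congr fun T => ?_, fun h => by rw [hm0 h, hm0' h, add_zero]⟩
    rw [← twistedMean_add κ ((bddMeas_character μ).mul (bddMeas_of_mem_trigSpan hfm))
      ((bddMeas_character μ).mul (bddMeas_of_mem_trigSpan hgm))]
    simp only [Pi.add_apply, mul_add]
  | smul c f _ hf =>
    obtain ⟨m, hm, hm0⟩ := hf
    refine ⟨c * m, (hm.const_mul c).congr fun T => ?_, fun h => by rw [hm0 h, mul_zero]⟩
    rw [← twistedMean_const_mul]
    simp only [Pi.smul_apply, smul_eq_mul, mul_left_comm]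

/-- The real trigonometric polynomial `Re ∑ c_w e^{iwt}`. -/
noncomputable def trigPoly (W : Finset ℝ) (c : ℝ → ℂ) (t : ℝ) : ℝ :=
  (∑ w ∈ W, c w * Complex.exp (Complex.I * w * t)).re

theorem continuous_trigPoly (W : Finset ℝ) (c : ℝ → ℂ) : Continuous (trigPoly W c) := by
  unfold trigPoly
  fun_prop

theorem abs_trigPoly_le (W : Finset ℝ) (c : ℝ → ℂ) (t : ℝ) :
    |trigPoly W c t| ≤ ∑ w ∈ W, ‖c w‖ := by
  refine (Complex.abs_re_le_norm _).trans ((norm_sum_le _ _).trans (le_of_eq ?_))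
  exact Finset.sum_congr rfl fun w _ => by rw [norm_mul, norm_exp_I_mul_mul, mul_one]

theorem trigPoly_mem_trigSpan (W : Finset ℝ) (c : ℝ → ℂ) :
    (fun t => (trigPoly W c t : ℂ)) ∈ trigSpan (AddSubgroup.closure (W : Set ℝ)) := by
  have e : (fun t => (trigPoly W c t : ℂ)) = ∑ w ∈ W, ((c w / 2) • character w
      + (starRingEnd ℂ (c w) / 2) • character (-w)) := by
    ext t
    rw [trigPoly, Finset.sum_apply, Complex.re_eq_add_conj, map_sum, ← Finset.sum_add_distrib,
      Finset.sum_div]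
    refine Finset.sum_congr rfl fun w _ => ?_
    rw [map_mul]
    have := conj_character w t
    rw [character] at this
    rw [this]
    simp only [Pi.add_apply, Pi.smul_apply, smul_eq_mul, character]
    ring
  rw [e]
  refine Submodule.sum_mem _ fun w hw => ?_
  have hw' : w ∈ AddSubgroup.closure (W : Set ℝ) := AddSubgroup.subset_closure hw
  exact Submodule.add_mem _ (Submodule.smul_mem _ _ (character_mem_trigSpan hw'))
    (Submodule.smul_mem _ _ (character_mem_trigSpan (AddSubgroup.neg_mem _ hw')))

theorem polynomial_eval_mem_trigSpan {Λ : AddSubgroup ℝ} {P : ℝ → ℝ}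
    (hP : (fun t => (P t : ℂ)) ∈ trigSpan Λ) (p : Polynomial ℝ) :
    (fun t => ((p.eval (P t) : ℝ) : ℂ)) ∈ trigSpan Λ := by
  induction p using Polynomial.induction_on' with
  | add p q hp hq =>
    convert! Submodule.add_mem _ hp hq using 1
    ext t
    simp
  | monomial n a =>
    have hpow : ∀ n : ℕ, (fun t => (P t : ℂ)) ^ n ∈ trigSpan Λ := by
      intro n
      induction n with
      | zero => simpa using one_mem_trigSpan Λ
      | succ n ih =>
        rw [pow_succ]
        exact mul_mem_trigSpan ih hP
    convert! Submodule.smul_mem _ (a : ℂ) (hpow n) using 1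
    ext t
    simp

/-- A continuous function of a real trigonometric polynomial is a uniform limit of
trigonometric polynomials with frequencies in the generated group. -/
theorem exists_trigSpan_near {h : ℝ → ℂ} (hh : Continuous h) (W : Finset ℝ) (c : ℝ → ℂ) {η : ℝ}
    (hη : 0 < η) : ∃ f ∈ trigSpan (AddSubgroup.closure (W : Set ℝ)),
      ∀ t, ‖h (trigPoly W c t) - f t‖ ≤ η := by
  set M := ∑ w ∈ W, ‖c w‖
  obtain ⟨p, hp⟩ := exists_polynomial_near_of_continuousOn (-M) M (fun x => (h x).re)
    (Complex.continuous_re.comp hh).continuousOn (η / 2) (by positivity)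
  obtain ⟨q, hq⟩ := exists_polynomial_near_of_continuousOn (-M) M (fun x => (h x).im)
    (Complex.continuous_im.comp hh).continuousOn (η / 2) (by positivity)
  have hP := trigPoly_mem_trigSpan W c
  refine ⟨_, Submodule.add_mem _ (polynomial_eval_mem_trigSpan hP p)
    (Submodule.smul_mem _ Complex.I (polynomial_eval_mem_trigSpan hP q)), fun t => ?_⟩
  have hx : trigPoly W c t ∈ Icc (-M) M := abs_le.mp (abs_trigPoly_le W c t)
  have h1 := hp _ hx
  have h2 := hq _ hx
  refine (Complex.norm_le_abs_re_add_abs_im _).trans ?_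
  simp only [Pi.add_apply, Pi.smul_apply, smul_eq_mul, Complex.sub_re, Complex.add_re,
    Complex.sub_im, Complex.add_im, Complex.mul_re, Complex.mul_im, Complex.ofReal_re,
    Complex.ofReal_im, Complex.I_re, Complex.I_im]
  rw [abs_sub_comm] at h1 h2
  simp only [mul_zero, zero_mul, sub_zero, add_zero, zero_add, one_mul]
  linarith

/-- Weierstrass approximation on the bounded range of the trigonometric polynomial reduces the claim
to finite sums of characters, for which the limit is read off frequency by frequency. -/
theorem exists_tendsto_twistedMean_continuous_trigPoly (κ μ : ℝ) {h : ℝ → ℂ} (hh : Continuous h)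
    (W : Finset ℝ) (c : ℝ → ℂ) :
    ∃ m, Tendsto (twistedMean κ fun t => character μ t * h (trigPoly W c t)) atTop (𝓝 m) ∧
      ((∀ w ∈ AddSubgroup.closure (W : Set ℝ), μ + w ≠ 0) → m = 0) := by
  have hb : BddMeas (fun t => h (trigPoly W c t)) := by
    obtain ⟨f, hf, hfh⟩ := exists_trigSpan_near hh W c one_pos
    obtain ⟨hfm, C, hC⟩ := bddMeas_of_mem_trigSpan hf
    refine ⟨(hh.comp (continuous_trigPoly W c)).measurable, 1 + C, fun t => ?_⟩
    calc ‖h (trigPoly W c t)‖ = ‖(h (trigPoly W c t) - f t) + f t‖ := by rw [sub_add_cancel]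
      _ ≤ _ := (norm_add_le _ _).trans (add_le_add (hfh t) (hC t))
  have hclose : ∀ η > 0, ∃ f ∈ trigSpan (AddSubgroup.closure (W : Set ℝ)), ∀ᶠ T in atTop,
      normMean (fun t => character μ t * h (trigPoly W c t) - character μ t * f t) T ≤ η := by
    intro η hη
    obtain ⟨f, hf, hfh⟩ := exists_trigSpan_near hh W c hη
    refine ⟨f, hf, ?_⟩
    filter_upwards [eventually_gt_atTop 0] with T hT
    refine normMean_le hT fun t _ => ?_
    rw [← mul_sub, norm_mul, norm_character, one_mul]
    exact hfh t
  have hgb := (bddMeas_character μ).mul hb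
  by_cases hres : ∀ w ∈ AddSubgroup.closure (W : Set ℝ), μ + w ≠ 0
  · refine ⟨0, tendsto_twistedMean_zero_of_approx κ hgb fun η hη => ?_, fun _ => rfl⟩
    obtain ⟨f, hf, hfT⟩ := hclose η hη
    obtain ⟨m, hm, hm0⟩ := exists_tendsto_twistedMean_character_mul κ μ hf
    rw [hm0 hres] at hm
    exact ⟨_, (bddMeas_character μ).mul (bddMeas_of_mem_trigSpan hf), hm, hfT⟩
  · obtain ⟨m, hm⟩ := exists_tendsto_twistedMean_of_approx κ hgb fun η hη => by
      obtain ⟨f, hf, hfT⟩ := hclose η hη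
      obtain ⟨m, hm, _⟩ := exists_tendsto_twistedMean_character_mul κ μ hf
      exact ⟨_, (bddMeas_character μ).mul (bddMeas_of_mem_trigSpan hf), ⟨m, hm⟩, hfT⟩
    exact ⟨m, hm, fun h => absurd h hres⟩

/-! ### Functions that are rarely small -/

theorem normMean_mono_add {f g h : ℝ → ℂ} (hf : BddMeas f) (hg : BddMeas g) (hh : BddMeas h)
    (hle : ∀ t, 0 < t → ‖f t‖ ≤ ‖g t‖ + ‖h t‖) {T : ℝ} (hT : 0 < T) :
    normMean f T ≤ normMean g T + normMean h T := by
  rw [normMean, normMean, normMean, ← mul_add,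
    ← intervalIntegral.integral_add (hg.intervalIntegrable _ _).norm
      (hh.intervalIntegrable _ _).norm]
  refine mul_le_mul_of_nonneg_left ?_ (inv_pos.mpr hT).le
  rw [intervalIntegral.integral_of_le hT.le, intervalIntegral.integral_of_le hT.le]
  refine setIntegral_mono_on ((intervalIntegrable_iff_integrableOn_Ioc_of_le hT.le).mp
    (hf.intervalIntegrable 0 T).norm) ((intervalIntegrable_iff_integrableOn_Ioc_of_le hT.le).mp
    ((hg.intervalIntegrable 0 T).norm.add (hh.intervalIntegrable 0 T).norm)) measurableSet_Ioc
    fun t ht => hle t ht.1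

theorem normMean_const_mul (c : ℂ) (g : ℝ → ℂ) (T : ℝ) :
    normMean (fun t => c * g t) T = ‖c‖ * normMean g T := by
  simp only [normMean, norm_mul]
  rw [intervalIntegral.integral_const_mul]
  ring

/-- Indicator of the times at which `|g| ≤ ε`. -/
noncomputable def smallInd (g : ℝ → ℝ) (ε : ℝ) : ℝ → ℂ :=
  {t | |g t| ≤ ε}.indicator (fun _ => 1)

theorem bddMeas_indicator {S : Set ℝ} (hS : MeasurableSet S) :
    BddMeas (S.indicator (fun _ => 1)) :=
  ⟨measurable_const.indicator hS, 1, fun t => (norm_indicator_le_norm_self _ _).trans (by simp)⟩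

theorem bddMeas_smallInd {g : ℝ → ℝ} (hg : Measurable g) (ε : ℝ) : BddMeas (smallInd g ε) :=
  bddMeas_indicator (measurableSet_le (by fun_prop) measurable_const)

/-- `g` is small only on sets of times of small upper density. -/
def RarelySmall (g : ℝ → ℝ) : Prop :=
  ∀ η > 0, ∃ ε > 0, ∀ᶠ T in atTop, normMean (smallInd g ε) T ≤ η

theorem eventually_normMean_indicator_Iio_le (t₀ : ℝ) {η : ℝ} (hη : 0 < η) :
    ∀ᶠ T in atTop, normMean ((Iio t₀).indicator fun _ => 1) T ≤ η := by
  have h1 : ∀ᶠ T : ℝ in atTop, |t₀| / T < η :=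
    (tendsto_const_nhds.div_atTop tendsto_id).eventually_lt_const hη
  filter_upwards [h1, eventually_gt_atTop 0] with T hT hT0
  refine le_trans ?_ hT.le
  rw [normMean, div_eq_inv_mul]
  refine mul_le_mul_of_nonneg_left ?_ (inv_pos.mpr hT0).le
  have e : ∀ t, ‖(Iio t₀).indicator (fun _ => (1 : ℂ)) t‖ = (Iio t₀).indicator (fun _ => (1 : ℝ)) t
    := fun t => by
      rw [norm_indicator_eq_indicator_norm]
      simp
  simp_rw [e]
  rw [← volume_real_inter_eq_integral measurableSet_Iio hT0.le]
  have hsub : {t : ℝ | 0 ≤ t ∧ t ≤ T ∧ t ∈ Iio t₀} ⊆ Icc 0 |t₀| := fun t ht =>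
    ⟨ht.1, (le_of_lt ht.2.2).trans (le_abs_self _)⟩
  have := measureReal_mono (μ := volume) hsub (by simp)
  rwa [Real.volume_real_Icc_of_le (abs_nonneg _), sub_zero] at this

/-- Times are split into three kinds: those before `t₀`, those with `|g| ≤ ε`, and the rest. The
first two have density at most `η / (3C)` and `‖f‖ ≤ C` there; on the rest `‖f‖ ≤ η / 3`. -/
theorem RarelySmall.eventually_normMean_le {g : ℝ → ℝ} (hgm : Measurable g) (hg : RarelySmall g)
    {f : ℝ → ℂ} (hf : BddMeas f)
    (h : ∀ ε > 0, ∀ η > 0, ∀ᶠ t in atTop, ε < |g t| → ‖f t‖ ≤ η) {η : ℝ} (hη : 0 < η) :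
    ∀ᶠ T in atTop, normMean f T ≤ η := by
  obtain ⟨C', hC'⟩ := hf.2
  set C := max C' 1 with hCdef
  have hC : ∀ t, ‖f t‖ ≤ C := fun t => (hC' t).trans (le_max_left _ _)
  have hC1 : 1 ≤ C := le_max_right _ _
  have hC0 : 0 < C := by linarith
  have hη' : 0 < η / (3 * C) := by positivity
  obtain ⟨ε, hε, hT⟩ := hg (η / (3 * C)) hη'
  obtain ⟨t₀, ht₀⟩ := eventually_atTop.mp (h ε hε (η / 3) (by positivity))
  have hI : BddMeas ((Iio t₀).indicator fun _ => (1 : ℂ)) := bddMeas_indicator measurableSet_Iio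
  have hS := bddMeas_smallInd hgm ε
  filter_upwards [hT, eventually_normMean_indicator_Iio_le t₀ hη', eventually_gt_atTop 0]
    with T h1 h2 hT0
  have hCn : ‖(C : ℂ)‖ = C := by rw [Complex.norm_real, Real.norm_of_nonneg hC0.le]
  have hsum : BddMeas (fun t => (((‖(C : ℂ) * smallInd g ε t‖ +
      ‖(C : ℂ) * (Iio t₀).indicator (fun _ => (1 : ℂ)) t‖ : ℝ)) : ℂ)) := by
    refine ⟨?_, C + C, fun t => ?_⟩
    · exact Complex.measurable_ofReal.comp (((hS.const_mul C).1.norm).add (hI.const_mul C).1.norm)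
    · rw [Complex.norm_real, Real.norm_of_nonneg (by positivity), norm_mul, norm_mul, hCn]
      have a1 : ‖smallInd g ε t‖ ≤ 1 := (norm_indicator_le_norm_self _ _).trans (by simp)
      have a2 : ‖(Iio t₀).indicator (fun _ => (1 : ℂ)) t‖ ≤ 1 :=
        (norm_indicator_le_norm_self _ _).trans (by simp)
      nlinarith
  have hsplit : normMean f T ≤ normMean (fun t => (((‖(C : ℂ) * smallInd g ε t‖ +
      ‖(C : ℂ) * (Iio t₀).indicator (fun _ => (1 : ℂ)) t‖ : ℝ)) : ℂ)) T
      + normMean (fun _ => ((η / 3 : ℝ) : ℂ)) T := by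
    refine normMean_mono_add hf hsum (BddMeas.const _) (fun t _ => ?_) hT0
    have p1 := norm_nonneg ((C : ℂ) * smallInd g ε t)
    have p2 := norm_nonneg ((C : ℂ) * (Iio t₀).indicator (fun _ => (1 : ℂ)) t)
    rw [Complex.norm_real, Complex.norm_real, Real.norm_of_nonneg (by positivity),
      Real.norm_of_nonneg (by positivity)]
    by_cases c1 : t < t₀
    · have : ‖(C : ℂ) * (Iio t₀).indicator (fun _ => (1 : ℂ)) t‖ = C := by
        rw [indicator_of_mem (show t ∈ Iio t₀ from c1), mul_one, hCn]
      linarith [hC t]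
    · by_cases c2 : |g t| ≤ ε
      · have : ‖(C : ℂ) * smallInd g ε t‖ = C := by
          rw [smallInd, indicator_of_mem (show t ∈ {t | |g t| ≤ ε} from c2), mul_one, hCn]
        linarith [hC t]
      · have := ht₀ t (not_lt.mp c1) (not_le.mp c2)
        linarith
  have hsmall : normMean (fun t => (((‖(C : ℂ) * smallInd g ε t‖ +
      ‖(C : ℂ) * (Iio t₀).indicator (fun _ => (1 : ℂ)) t‖ : ℝ)) : ℂ)) T
      ≤ C * normMean (smallInd g ε) T + C * normMean ((Iio t₀).indicator fun _ => 1) T := by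
    have := normMean_mono_add hsum (hS.const_mul C) (hI.const_mul C) (fun t _ => by
      rw [Complex.norm_real, Real.norm_of_nonneg (by positivity)]) hT0
    rwa [normMean_const_mul, normMean_const_mul, hCn] at this
  have hconst : normMean (fun _ => ((η / 3 : ℝ) : ℂ)) T ≤ η / 3 :=
    normMean_le hT0 fun t _ => by
      rw [Complex.norm_real, Real.norm_of_nonneg (by positivity)]
  have e1 : C * (η / (3 * C)) = η / 3 := by field_simp
  have b1 := mul_le_mul_of_nonneg_left h1 hC0.le
  have b2 := mul_le_mul_of_nonneg_left h2 hC0.le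
  linarith

theorem RarelySmall.of_tendsto {g P : ℝ → ℝ} (hgm : Measurable g) (hPm : Measurable P)
    (hg : RarelySmall g) (h : Tendsto (fun t => g t - P t) atTop (𝓝 0)) : RarelySmall P := by
  intro η hη
  obtain ⟨ε, hε, hT⟩ := hg (η / 2) (by positivity)
  refine ⟨ε / 2, by positivity, ?_⟩
  obtain ⟨t₀, ht₀⟩ := eventually_atTop.mp (Metric.tendsto_nhds.mp h (ε / 2) (by positivity))
  filter_upwards [hT, eventually_normMean_indicator_Iio_le t₀ (half_pos hη),
    eventually_gt_atTop 0] with T h1 h2 hT0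
  have := normMean_mono_add (bddMeas_smallInd hPm (ε / 2)) (bddMeas_smallInd hgm ε)
    (bddMeas_indicator (measurableSet_Iio (a := t₀))) (fun t _ => by
      by_cases c1 : t < t₀
      · rw [indicator_of_mem (show t ∈ Iio t₀ from c1)]
        have : ‖smallInd P (ε / 2) t‖ ≤ 1 := (norm_indicator_le_norm_self _ _).trans (by simp)
        have p := norm_nonneg (smallInd g ε t)
        rw [norm_one]
        linarith
      · by_cases c2 : |P t| ≤ ε / 2
        · have c3 := ht₀ t (not_lt.mp c1)
          rw [dist_zero_right, Real.norm_eq_abs] at c3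
          have c4 : |g t| ≤ ε := by
            have := abs_add_le (g t - P t) (P t)
            rw [sub_add_cancel] at this
            linarith
          rw [smallInd, smallInd, indicator_of_mem (show t ∈ {t | |P t| ≤ ε / 2} from c2),
            indicator_of_mem (show t ∈ {t | |g t| ≤ ε} from c4)]
          have p := norm_nonneg ((Iio t₀).indicator (fun _ => (1 : ℂ)) t)
          linarith
        · rw [smallInd, indicator_of_notMem (show t ∉ {t | |P t| ≤ ε / 2} from c2), norm_zero]
          positivity) hT0
  linarith

theorem abs_log_sub_log_le {x y ε : ℝ} (hε : 0 < ε) (hx : ε < |x|) (hxy : |y - x| ≤ ε / 2) :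
    |Real.log y - Real.log x| ≤ 2 * |y - x| / ε := by
  have hx0 : x ≠ 0 := by
    rintro rfl
    rw [abs_zero] at hx
    linarith
  have hax : 0 < |x| := abs_pos.mpr hx0
  set r := y / x with hr
  have hr1 : |r - 1| ≤ |y - x| / ε := by
    rw [hr, div_sub_one hx0, abs_div]
    gcongr
  have hr2 : |r - 1| ≤ 1 / 2 := hr1.trans (by rw [div_le_iff₀ hε]; linarith)
  have hrpos : 1 / 2 ≤ r := by linarith [(abs_le.mp hr2).1]
  have hr0 : 0 < r := by linarith
  have hy0 : y ≠ 0 := by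
    rintro rfl
    rw [hr, zero_div] at hr0
    exact lt_irrefl _ hr0
  rw [← Real.log_div hy0 hx0, ← hr]
  have u1 := Real.log_le_sub_one_of_pos hr0
  have u2 := Real.one_sub_inv_le_log_of_pos hr0
  have u3 : 1 - r⁻¹ = (r - 1) / r := by field_simp
  have u4 : -(2 * |r - 1|) ≤ (r - 1) / r := by
    rw [le_div_iff₀ hr0]
    have := neg_abs_le (r - 1)
    have := abs_nonneg (r - 1)
    nlinarith
  have u5 : |Real.log r| ≤ 2 * |r - 1| := by
    rw [abs_le]
    constructor
    · linarith
    · have := le_abs_self (r - 1)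
      have := abs_nonneg (r - 1)
      linarith
  calc _ ≤ 2 * |r - 1| := u5
    _ ≤ 2 * (|y - x| / ε) := by gcongr
    _ = _ := by ring

theorem norm_logPhase_sub_le (s x y : ℝ) :
    ‖logPhase s x - logPhase s y‖ ≤ |s| * |Real.log x - Real.log y| := by
  have := norm_exp_I_mul_sub_le (s * Real.log x) (s * Real.log y)
  rw [← mul_sub, abs_mul] at this
  rw [logPhase, logPhase]
  push_cast at this
  simpa only [mul_assoc] using this

theorem eventually_norm_logPhase_sub_le (s : ℝ) {g P : ℝ → ℝ}
    (h : Tendsto (fun t => g t - P t) atTop (𝓝 0)) {ε : ℝ} (hε : 0 < ε) {η : ℝ} (hη : 0 < η) :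
    ∀ᶠ t in atTop, ε < |g t| → ‖logPhase s (g t) - logPhase s (P t)‖ ≤ η := by
  have hδ : 0 < min (ε / 2) (η * ε / (2 * (|s| + 1))) := by positivity
  filter_upwards [Metric.tendsto_nhds.mp h _ hδ] with t ht hg
  rw [dist_zero_right, Real.norm_eq_abs, abs_sub_comm] at ht
  have h1 := abs_log_sub_log_le hε hg (ht.le.trans (min_le_left _ _))
  have h2 := ht.le.trans (min_le_right _ _)
  refine (norm_logPhase_sub_le s _ _).trans ?_
  rw [abs_sub_comm] at h1
  calc |s| * |Real.log (g t) - Real.log (P t)| ≤ (|s| + 1) * (2 * |P t - g t| / ε) := by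
        gcongr
        linarith
    _ ≤ (|s| + 1) * (2 * (η * ε / (2 * (|s| + 1))) / ε) := by gcongr
    _ = η := by
        have : |s| + 1 ≠ 0 := by positivity
        field_simp

theorem normMean_sub_comm (f g : ℝ → ℂ) (T : ℝ) :
    normMean (fun t => f t - g t) T = normMean (fun t => g t - f t) T := by
  simp only [normMean, norm_sub_rev]

theorem tendsto_twistedMean_zero_congr (κ : ℝ) {f g : ℝ → ℂ} (hf : BddMeas f) (hg : BddMeas g)
    (h : ∀ η > 0, ∀ᶠ T in atTop, normMean (fun t => f t - g t) T ≤ η) :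
    Tendsto (twistedMean κ f) atTop (𝓝 0) ↔ Tendsto (twistedMean κ g) atTop (𝓝 0) := by
  constructor
  · intro hT
    refine tendsto_twistedMean_zero_of_approx κ hg fun η hη => ⟨f, hf, hT, ?_⟩
    simp_rw [normMean_sub_comm g f]
    exact h η hη
  · exact fun hT => tendsto_twistedMean_zero_of_approx κ hf fun η hη => ⟨g, hg, hT, h η hη⟩

/-- The prefactor of the twisted mean has constant nonzero modulus for `T > 0`, so it is irrelevant
when the limit is 0. -/
theorem tendsto_twistedMean_zero_iff (κ : ℝ) (g : ℝ → ℂ) :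
    Tendsto (twistedMean κ g) atTop (𝓝 0) ↔
      Tendsto (twistedMean 0 fun t => logPhase κ t * g t) atTop (𝓝 0) := by
  rw [tendsto_zero_iff_norm_tendsto_zero, tendsto_zero_iff_norm_tendsto_zero (f := twistedMean 0 _)]
  have hC : ‖(1 + Complex.I * κ : ℂ)‖ ≠ 0 := norm_ne_zero_iff.mpr (one_add_I_mul_ne_zero κ)
  have e : ∀ᶠ T in atTop, ‖twistedMean κ g T‖
      = ‖(1 + Complex.I * κ : ℂ)‖ * ‖twistedMean 0 (fun t => logPhase κ t * g t) T‖ := by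
    filter_upwards [eventually_gt_atTop 0] with T hT
    rw [norm_twistedMean_eq κ g hT, norm_twistedMean_eq 0 _ hT]
    simp [logPhase_zero_left]
  rw [tendsto_congr' e]
  constructor
  · intro h
    have := h.const_mul ‖(1 + Complex.I * κ : ℂ)‖⁻¹
    rw [mul_zero] at this
    refine this.congr fun T => ?_
    rw [← mul_assoc, inv_mul_cancel₀ hC, one_mul]
  · intro h
    simpa using h.const_mul ‖(1 + Complex.I * κ : ℂ)‖

theorem logPhase_exp (s x : ℝ) : logPhase s (Real.exp x) = Complex.exp (Complex.I * s * x) := by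
  rw [logPhase, Real.log_exp]

theorem logPhase_pow (s x : ℝ) (k : ℕ) : logPhase s (x ^ k) = logPhase (s * k) x := by
  rw [logPhase, logPhase, Real.log_pow]
  push_cast
  ring_nf

/-- Exponential and polynomial growth factors turn into a character and a twist. -/
theorem tendsto_mean_logPhase_iff (s ρ : ℝ) (k : ℕ) {f g P : ℝ → ℝ} (hf : Measurable f)
    (hg : Measurable g) (hP : Measurable P)
    (hfg : ∀ t, 0 < t → f t = Real.exp (ρ * t) * t ^ k * g t) (hrs : RarelySmall g)
    (h : Tendsto (fun t => g t - P t) atTop (𝓝 0)) :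
    Tendsto (twistedMean 0 fun t => logPhase s (f t)) atTop (𝓝 0) ↔
      Tendsto (twistedMean (s * k) fun t => character (s * ρ) t * logPhase s (P t)) atTop
        (𝓝 0) := by
  rw [tendsto_twistedMean_zero_iff (s * k)]
  have hb1 := BddMeas.logPhase s hf
  have hb0 : BddMeas (fun t => logPhase (s * k) t) := BddMeas.logPhase (s * k) measurable_id
  have hb2 := hb0.mul ((bddMeas_character (s * ρ)).mul (BddMeas.logPhase s hP))
  refine tendsto_twistedMean_zero_congr 0 hb1 hb2 fun η hη => ?_
  refine hrs.eventually_normMean_le hg (hb1.sub hb2) (fun ε hε η hη => ?_) hη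
  filter_upwards [eventually_norm_logPhase_sub_le s h hε hη, eventually_gt_atTop 0]
    with t ht ht0 hgt
  have hg0 : g t ≠ 0 := by
    intro h0
    rw [h0, abs_zero] at hgt
    linarith
  have e : logPhase s (f t) = logPhase (s * k) t * (character (s * ρ) t * logPhase s (g t)) := by
    rw [hfg t ht0, logPhase_mul s (by positivity) hg0, logPhase_mul s (by positivity)
      (by positivity), logPhase_exp, logPhase_pow, character]
    push_cast
    ring_nf
  rw [e, ← mul_sub, ← mul_sub, norm_mul, norm_mul, norm_logPhase, norm_character, one_mul, one_mul]
  exact ht hgt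

/-- A continuous function that agrees with `logPhase s` off `[-ε, ε]`. -/
noncomputable def cutLogPhase (s ε x : ℝ) : ℂ := logPhase s x * ((min 1 (|x| / ε) : ℝ) : ℂ)

theorem norm_cutLogPhase {ε : ℝ} (hε : 0 < ε) (s x : ℝ) :
    ‖cutLogPhase s ε x‖ = min 1 (|x| / ε) := by
  rw [cutLogPhase, norm_mul, norm_logPhase, one_mul, Complex.norm_real,
    Real.norm_of_nonneg (le_min zero_le_one (by positivity))]

theorem continuous_cutLogPhase {ε : ℝ} (hε : 0 < ε) (s : ℝ) : Continuous (cutLogPhase s ε) := by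
  rw [continuous_iff_continuousAt]
  intro x
  by_cases hx : x = 0
  · subst hx
    rw [ContinuousAt]
    have e0 : cutLogPhase s ε 0 = 0 := by simp [cutLogPhase]
    rw [e0]
    have h1 : Tendsto (fun x : ℝ => |x| / ε) (𝓝 0) (𝓝 0) := by
      have : Continuous (fun x : ℝ => |x| / ε) := by fun_prop
      simpa using this.tendsto 0
    exact squeeze_zero_norm (fun x => by
      rw [norm_cutLogPhase hε]; exact min_le_right _ _) h1
  · refine ContinuousAt.mul ?_ ?_
    · unfold logPhase
      have := (Real.continuousAt_log hx)
      fun_prop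
    · have : Continuous (fun x : ℝ => ((min 1 (|x| / ε) : ℝ) : ℂ)) := by fun_prop
      exact this.continuousAt

theorem norm_logPhase_sub_cutLogPhase_le {ε : ℝ} (hε : 0 < ε) (s : ℝ) (P : ℝ → ℝ) (t : ℝ) :
    ‖logPhase s (P t) - cutLogPhase s ε (P t)‖ ≤ ‖smallInd P ε t‖ := by
  have e : logPhase s (P t) - cutLogPhase s ε (P t)
      = logPhase s (P t) * ((1 - min 1 (|P t| / ε) : ℝ) : ℂ) := by
    rw [cutLogPhase]
    push_cast
    ring
  have h0 : 0 ≤ min 1 (|P t| / ε) := le_min zero_le_one (by positivity)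
  have h1 : min 1 (|P t| / ε) ≤ 1 := min_le_left _ _
  rw [e, norm_mul, norm_logPhase, one_mul, Complex.norm_real, Real.norm_of_nonneg (by linarith)]
  by_cases hc : |P t| ≤ ε
  · rw [smallInd, indicator_of_mem (show t ∈ {t | |P t| ≤ ε} from hc), norm_one]
    linarith
  · have : 1 ≤ |P t| / ε := by rw [le_div_iff₀ hε]; linarith
    rw [min_eq_left this, sub_self]
    positivity

/-- Twisted means of `e^{iμt} |P(t)|^{is}` vanish in the absence of resonances. -/
theorem tendsto_twistedMean_character_mul_logPhase (κ μ s : ℝ) {W : Finset ℝ} {c : ℝ → ℂ}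
    (hrs : RarelySmall (trigPoly W c))
    (hres : ∀ w ∈ AddSubgroup.closure (W : Set ℝ), μ + w ≠ 0) :
    Tendsto (twistedMean κ fun t => character μ t * logPhase s (trigPoly W c t)) atTop (𝓝 0) := by
  have hPm := (continuous_trigPoly W c).measurable
  have hb := (bddMeas_character μ).mul (BddMeas.logPhase s hPm)
  refine tendsto_twistedMean_zero_of_approx κ hb fun η hη => ?_
  obtain ⟨ε, hε, hT⟩ := hrs η hη
  obtain ⟨m, hm, hm0⟩ := exists_tendsto_twistedMean_continuous_trigPoly κ μ
    (continuous_cutLogPhase hε s) W c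
  rw [hm0 hres] at hm
  have hb2 : BddMeas (fun t => cutLogPhase s ε (trigPoly W c t)) :=
    ⟨((continuous_cutLogPhase hε s).comp (continuous_trigPoly W c)).measurable, 1, fun t => by
      rw [norm_cutLogPhase hε]; exact min_le_left _ _⟩
  have hb3 := (bddMeas_character μ).mul hb2
  refine ⟨_, hb3, hm, ?_⟩
  filter_upwards [hT, eventually_gt_atTop 0] with T h1 hT0
  refine le_trans ?_ h1
  have := normMean_mono_add (hb.sub hb3) (bddMeas_smallInd hPm ε) (BddMeas.const 0)
    (fun t _ => by
      rw [← mul_sub, norm_mul, norm_character, one_mul, norm_zero, add_zero]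
      exact norm_logPhase_sub_cutLogPhase_le hε s _ t) hT0
  refine this.trans (le_of_eq ?_)
  simp [normMean]

/-! ### Averaging over Gaussian parameters -/

/-- The variances `cos² θ` and `sin² θ` add up to 1, so the law does not depend on the phase. This
is what makes all later estimates uniform in time. -/
theorem map_gaussian_rotation (θ : ℝ) :
    ((gaussianReal 0 1).prod (gaussianReal 0 1)).map
      (fun p : ℝ × ℝ => p.1 * Real.cos θ + p.2 * Real.sin θ) = gaussianReal 0 1 := by
  have h1 := gaussianReal_map_const_mul (μ := 0) (v := 1) (Real.cos θ)
  have h2 := gaussianReal_map_const_mul (μ := 0) (v := 1) (Real.sin θ)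
  have h3 := gaussianReal_conv_gaussianReal (m₁ := Real.cos θ * 0) (m₂ := Real.sin θ * 0)
    (v₁ := NNReal.mk (Real.cos θ ^ 2) (sq_nonneg _) * 1)
    (v₂ := NNReal.mk (Real.sin θ ^ 2) (sq_nonneg _) * 1)
  rw [← h1, ← h2, Measure.conv, Measure.map_prod_map _ _ (by fun_prop) (by fun_prop),
    Measure.map_map (by fun_prop) (by fun_prop)] at h3
  have e : (fun p : ℝ × ℝ => p.1 * Real.cos θ + p.2 * Real.sin θ)
      = (fun x : ℝ × ℝ => x.1 + x.2) ∘ Prod.map (fun x => Real.cos θ * x)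
        (fun x => Real.sin θ * x) := by
    ext p
    simp [mul_comm]
  rw [e, h3]
  congr 1
  · ring
  · ext
    simp

theorem integral_gaussian_rotation (θ x : ℝ) {f : ℝ → ℂ} (hf : Measurable f) :
    ∫ p : ℝ × ℝ, f (x + (p.1 * Real.cos θ + p.2 * Real.sin θ))
        ∂((gaussianReal 0 1).prod (gaussianReal 0 1))
      = ∫ y, f (x + y) ∂(gaussianReal 0 1) := by
  have h : AEStronglyMeasurable (fun y => f (x + y))
      (((gaussianReal 0 1).prod (gaussianReal 0 1)).map
        (fun p : ℝ × ℝ => p.1 * Real.cos θ + p.2 * Real.sin θ)) :=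
    (hf.comp (measurable_const_add x)).aestronglyMeasurable
  have := integral_map (by fun_prop) h
  rw [map_gaussian_rotation] at this
  exact this.symm

theorem twistedMean_integral_comm (κ : ℝ) {Ω : Type*} [MeasurableSpace Ω] (ν : Measure Ω)
    [IsFiniteMeasure ν] {K : Ω → ℝ → ℂ} (hK : Measurable (Function.uncurry K)) {C : ℝ}
    (hC : ∀ p t, ‖K p t‖ ≤ C) {T : ℝ} (hT : 0 < T) :
    ∫ p, twistedMean κ (K p) T ∂ν = twistedMean κ (fun t => ∫ p, K p t ∂ν) T := by
  simp only [twistedMean]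
  have hi : Integrable (Function.uncurry fun p t => logPhase κ t * K p t)
      (ν.prod (volume.restrict (Ioc 0 T))) := by
    refine Integrable.of_bound (((measurable_logPhase κ).comp
      measurable_snd).mul hK).aestronglyMeasurable C (Eventually.of_forall fun q => ?_)
    rw [Function.uncurry, norm_mul, norm_logPhase, one_mul]
    exact hC _ _
  rw [integral_const_mul, integral_const_mul]
  congr 2
  simp_rw [intervalIntegral.integral_of_le hT.le]
  rw [integral_integral_swap hi]
  simp_rw [integral_const_mul]

theorem tendsto_twistedMean_integral (κ : ℝ) {Ω : Type*} [MeasurableSpace Ω] (ν : Measure Ω)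
    [IsFiniteMeasure ν] {K : Ω → ℝ → ℂ} (hK : Measurable (Function.uncurry K)) {C : ℝ}
    (hC : ∀ p t, ‖K p t‖ ≤ C) {D : Ω → ℂ}
    (hD : ∀ᵐ p ∂ν, Tendsto (twistedMean κ (K p)) atTop (𝓝 (D p))) :
    Tendsto (twistedMean κ (fun t => ∫ p, K p t ∂ν)) atTop (𝓝 (∫ p, D p ∂ν)) := by
  have h : Tendsto (fun T => ∫ p, twistedMean κ (K p) T ∂ν) atTop (𝓝 (∫ p, D p ∂ν)) := by
    refine tendsto_integral_filter_of_dominated_convergence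
      (fun _ => ‖(1 + Complex.I * κ : ℂ)‖ * C) ?_ ?_ (integrable_const _) hD
    · filter_upwards [eventually_gt_atTop 0] with T hT
      simp only [twistedMean]
      have : StronglyMeasurable (fun p => ∫ t in (0 : ℝ)..T, logPhase κ t * K p t) := by
        simp_rw [intervalIntegral.integral_of_le hT.le]
        exact StronglyMeasurable.integral_prod_right (f := fun p t => logPhase κ t * K p t)
          (((measurable_logPhase κ).comp measurable_snd).mul hK).stronglyMeasurable
      exact ((this.const_mul _).const_mul _).aestronglyMeasurable
    · filter_upwards [eventually_gt_atTop 0] with T hT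
      refine Eventually.of_forall fun p => ?_
      refine (norm_twistedMean_le κ _ hT).trans ?_
      gcongr
      exact normMean_le hT fun t _ => hC p t
  refine h.congr' ?_
  filter_upwards [eventually_gt_atTop 0] with T hT
  exact twistedMean_integral_comm κ ν hK hC hT

/-- The bump function `1 / (1 + (a x)^2)`. -/
noncomputable def bump (a x : ℝ) : ℝ := (1 + (a * x) ^ 2)⁻¹

theorem bump_nonneg (a x : ℝ) : 0 ≤ bump a x := by unfold bump; positivity

theorem bump_le_one (a x : ℝ) : bump a x ≤ 1 := by
  unfold bump
  exact inv_le_one_of_one_le₀ (by nlinarith [sq_nonneg (a * x)])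

theorem continuous_bump (a : ℝ) : Continuous (bump a) := by
  unfold bump
  exact Continuous.inv₀ (by fun_prop) fun x => by positivity

theorem abs_bump_sub_le {a : ℝ} (ha : 0 ≤ a) (x y : ℝ) : |bump a x - bump a y| ≤ a * |x - y| := by
  unfold bump
  set X := a * x
  set Y := a * y
  have hX : (0 : ℝ) < 1 + X ^ 2 := by positivity
  have hY : (0 : ℝ) < 1 + Y ^ 2 := by positivity
  have e : (1 + X ^ 2)⁻¹ - (1 + Y ^ 2)⁻¹ = (Y - X) * (Y + X) / ((1 + X ^ 2) * (1 + Y ^ 2)) := by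
    field_simp
    ring
  have e2 : a * |x - y| = |Y - X| := by
    rw [abs_sub_comm, ← mul_sub, abs_mul, abs_of_nonneg ha]
  rw [e, e2, abs_div, abs_mul, abs_of_pos (mul_pos hX hY), div_le_iff₀ (mul_pos hX hY)]
  refine mul_le_mul_of_nonneg_left ?_ (abs_nonneg _)
  rw [abs_le]
  constructor <;> nlinarith [sq_nonneg (X + 1), sq_nonneg (X - 1), sq_nonneg (Y - 1),
    sq_nonneg (Y + 1), mul_nonneg (sq_nonneg X) (sq_nonneg Y)]

theorem integral_bump {a : ℝ} (ha : 0 < a) (x : ℝ) :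
    Integrable (fun y => bump a (x + y)) ∧ ∫ y, bump a (x + y) = Real.pi / a := by
  have h1 : Integrable (bump a) := integrable_inv_one_add_sq.comp_mul_left' ha.ne'
  refine ⟨h1.comp_add_left x, ?_⟩
  rw [integral_add_left_eq_self (bump a) x]
  have := Measure.integral_comp_mul_left (fun y : ℝ => (1 + y ^ 2)⁻¹) a
  rw [integral_univ_inv_one_add_sq] at this
  unfold bump
  rw [this, abs_of_pos (inv_pos.mpr ha), smul_eq_mul]
  ring

/-- The Gaussian density is at most 1 and the bump has integral `π / a`; the bound does not depend
on the centre `x`. -/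
theorem norm_integral_bump_gaussian_le {a : ℝ} (ha : 0 < a) (x : ℝ) :
    ‖∫ y, (bump a (x + y) : ℂ) ∂(gaussianReal 0 1)‖ ≤ 4 / a := by
  rw [integral_gaussianReal_eq_integral_smul (by norm_num)]
  obtain ⟨h1, h2⟩ := integral_bump ha x
  have hpdf : ∀ y, gaussianPDFReal 0 1 y ≤ 1 := by
    intro y
    rw [gaussianPDFReal]
    have h3 : 1 ≤ √(2 * Real.pi * ((1 : NNReal) : ℝ)) := by
      rw [Real.one_le_sqrt, NNReal.coe_one]
      linarith [Real.pi_gt_three]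
    refine mul_le_one₀ (inv_le_one_of_one_le₀ h3) (Real.exp_nonneg _) ?_
    rw [Real.exp_le_one_iff]
    refine div_nonpos_of_nonpos_of_nonneg (by nlinarith [sq_nonneg (y - 0)]) (by simp)
  calc _ ≤ ∫ y, bump a (x + y) := by
        refine norm_integral_le_of_norm_le h1 (Eventually.of_forall fun y => ?_)
        rw [norm_smul, Complex.norm_real, Real.norm_of_nonneg (gaussianPDFReal_nonneg _ _ _),
          Real.norm_of_nonneg (bump_nonneg _ _)]
        exact mul_le_of_le_one_left (bump_nonneg _ _) (hpdf y)
    _ = Real.pi / a := h2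
    _ ≤ 4 / a := by
        gcongr
        exact Real.pi_le_four

theorem eventually_normMean_le_of_tendsto_zero {f : ℝ → ℂ} (hf : BddMeas f)
    (h : Tendsto f atTop (𝓝 0)) {η : ℝ} (hη : 0 < η) : ∀ᶠ T in atTop, normMean f T ≤ η := by
  -- The constant 1 is never small, so only an initial segment of times is exceptional.
  have h1 : RarelySmall (fun _ => 1) := by
    intro η hη
    refine ⟨1 / 2, by norm_num, Eventually.of_forall fun T => ?_⟩
    have : smallInd (fun _ => 1) (1 / 2) = fun _ => 0 := by
      ext t
      rw [smallInd, indicator_of_notMem]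
      simp only [mem_ofPred_eq]
      norm_num
    rw [this]
    simpa [normMean] using hη.le
  refine h1.eventually_normMean_le measurable_const hf (fun ε _ η hη => ?_) hη
  filter_upwards [Metric.tendsto_nhds.mp h η hη] with t ht _
  rw [dist_zero_right] at ht
  exact ht.le

theorem bddMeas_bump (a : ℝ) {g : ℝ → ℝ} (hg : Measurable g) :
    BddMeas (fun t => (bump a (g t) : ℂ)) :=
  ⟨Complex.measurable_ofReal.comp ((continuous_bump a).measurable.comp hg), 1, fun t => by
    rw [Complex.norm_real, Real.norm_of_nonneg (bump_nonneg _ _)]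
    exact bump_le_one _ _⟩

theorem tendsto_twistedMean_congr (κ : ℝ) {f g : ℝ → ℂ} (hf : BddMeas f) (hg : BddMeas g)
    (h : ∀ η > 0, ∀ᶠ T in atTop, normMean (fun t => f t - g t) T ≤ η) {m : ℂ}
    (hm : Tendsto (twistedMean κ g) atTop (𝓝 m)) : Tendsto (twistedMean κ f) atTop (𝓝 m) := by
  have h0 : Tendsto (twistedMean κ fun t => f t - g t) atTop (𝓝 0) := by
    refine tendsto_twistedMean_zero_of_approx κ (hf.sub hg) fun η hη =>
      ⟨fun _ => 0, BddMeas.const 0, ?_, ?_⟩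
    · have : twistedMean κ (fun _ => 0) = fun _ => 0 := funext fun T => by simp [twistedMean]
      rw [this]
      exact tendsto_const_nhds
    · simpa using h η hη
  have := h0.add hm
  rw [zero_add] at this
  refine this.congr fun T => ?_
  rw [twistedMean_sub κ hf hg, sub_add_cancel]

theorem tendsto_mean_bump_congr {a : ℝ} (ha : 0 ≤ a) {g P : ℝ → ℝ} (hg : Measurable g)
    (hP : Measurable P) (h : Tendsto (fun t => g t - P t) atTop (𝓝 0)) {m : ℂ}
    (hm : Tendsto (twistedMean 0 fun t => (bump a (P t) : ℂ)) atTop (𝓝 m)) :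
    Tendsto (twistedMean 0 fun t => (bump a (g t) : ℂ)) atTop (𝓝 m) := by
  refine tendsto_twistedMean_congr 0 (bddMeas_bump a hg) (bddMeas_bump a hP) (fun η hη => ?_) hm
  refine eventually_normMean_le_of_tendsto_zero
    ((bddMeas_bump a hg).sub (bddMeas_bump a hP)) ?_ hη
  have h1 : Tendsto (fun t => a * |g t - P t|) atTop (𝓝 0) := by
    simpa using h.abs.const_mul a
  refine squeeze_zero_norm (fun t => ?_) h1
  rw [← Complex.ofReal_sub, Complex.norm_real]
  exact abs_bump_sub_le ha _ _

theorem twistedMean_zero_ofReal (q : ℝ → ℝ) (T : ℝ) :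
    twistedMean 0 (fun t => (q t : ℂ)) T = ((T⁻¹ * ∫ t in (0 : ℝ)..T, q t : ℝ) : ℂ) := by
  rw [twistedMean_zero, intervalIntegral.integral_ofReal]
  push_cast
  rfl

theorem exists_tendsto_mean_bump {a : ℝ} (ha : 0 ≤ a) {g : ℝ → ℝ} (hg : Measurable g)
    {W : Finset ℝ} {c : ℝ → ℂ}
    (h : Tendsto (fun t => g t - trigPoly W c t) atTop (𝓝 0)) :
    ∃ r : ℝ, 0 ≤ r ∧ Tendsto (twistedMean 0 fun t => (bump a (g t) : ℂ)) atTop (𝓝 (r : ℂ)) := by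
  obtain ⟨m, hm, _⟩ := exists_tendsto_twistedMean_continuous_trigPoly 0 0
    (h := fun x => (bump a x : ℂ)) (Complex.continuous_ofReal.comp (continuous_bump a)) W c
  simp only [character_zero, Pi.one_apply, one_mul] at hm
  have hm2 := tendsto_mean_bump_congr ha hg (continuous_trigPoly W c).measurable h hm
  have e : twistedMean 0 (fun t => (bump a (g t) : ℂ))
      = fun T => ((T⁻¹ * ∫ t in (0 : ℝ)..T, bump a (g t) : ℝ) : ℂ) :=
    funext fun T => twistedMean_zero_ofReal _ T
  have hre := (Complex.continuous_re.tendsto m).comp hm2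
  rw [e] at hre hm2 ⊢
  have hre' : Tendsto (fun T : ℝ => T⁻¹ * ∫ t in (0 : ℝ)..T, bump a (g t)) atTop (𝓝 m.re) :=
    hre.congr fun T => by simp only [Function.comp_apply, Complex.ofReal_re]
  refine ⟨m.re, ge_of_tendsto hre' ?_, (Complex.continuous_ofReal.tendsto _).comp hre'⟩
  filter_upwards [eventually_gt_atTop 0] with T hT
  exact mul_nonneg (inv_pos.mpr hT).le (intervalIntegral.integral_nonneg hT.le fun t _ =>
    bump_nonneg _ _)

/-- The bump is at least `1/2` where `|g| ≤ 1/a`, so the upper density of those times is at most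
twice the limiting mean of the bump. -/
theorem rarelySmall_of_tendsto_mean_bump {g : ℝ → ℝ} (hg : Measurable g)
    (h : ∀ η > 0, ∃ a > 0, ∃ r : ℝ, r < η ∧
      Tendsto (twistedMean 0 fun t => (bump a (g t) : ℂ)) atTop (𝓝 (r : ℂ))) :
    RarelySmall g := by
  intro η hη
  obtain ⟨a, ha, r, hr, hT⟩ := h (η / 2) (by positivity)
  refine ⟨1 / a, by positivity, ?_⟩
  have hre := (Complex.continuous_re.tendsto _).comp hT
  rw [Complex.ofReal_re] at hre
  filter_upwards [hre.eventually_lt_const hr, eventually_gt_atTop 0] with T h1 hT0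
  simp only [Function.comp_apply, twistedMean_zero_ofReal, Complex.ofReal_re] at h1
  have h2 := normMean_mono_add (bddMeas_smallInd hg (1 / a))
    ((bddMeas_bump a hg).const_mul 2) (BddMeas.const 0) (fun t _ => by
      rw [norm_zero, add_zero, norm_mul, Complex.norm_real,
        Real.norm_of_nonneg (bump_nonneg _ _), Complex.norm_ofNat]
      by_cases hc : |g t| ≤ 1 / a
      · rw [smallInd, indicator_of_mem (show t ∈ {t | |g t| ≤ 1 / a} from hc), norm_one]
        have h3 : |a * g t| ≤ 1 := by
          rw [abs_mul, abs_of_pos ha]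
          rwa [le_div_iff₀ ha, mul_comm] at hc
        have h4 : (a * g t) ^ 2 ≤ 1 := by
          rw [← sq_abs]
          exact pow_le_one₀ (abs_nonneg _) h3
        have h5 : (1 / 2 : ℝ) ≤ bump a (g t) := by
          rw [bump, ← one_div]
          exact one_div_le_one_div_of_le (by positivity) (by linarith)
        linarith
      · rw [smallInd, indicator_of_notMem (show t ∉ {t | |g t| ≤ 1 / a} from hc), norm_zero]
        have := bump_nonneg a (g t)
        positivity) hT0
  have h3 : normMean (fun t => 2 * (bump a (g t) : ℂ)) T
      = 2 * (T⁻¹ * ∫ t in (0 : ℝ)..T, bump a (g t)) := by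
    rw [normMean_const_mul, Complex.norm_ofNat, normMean]
    congr 3
    ext t
    rw [Complex.norm_real, Real.norm_of_nonneg (bump_nonneg _ _)]
  have h4 : normMean (fun _ => 0) T = 0 := by simp [normMean]
  rw [h3, h4] at h2
  linarith

theorem ae_add_mem_iff {E : Type*} [AddCommGroup E] [MeasurableSpace E] [MeasurableAdd₂ E]
    {μ : Measure E} [μ.IsAddRightInvariant] (y : E) {S : Set E} :
    (∀ᵐ x ∂μ, x + y ∈ S) ↔ ∀ᵐ x ∂μ, x ∈ S := by
  have := measure_preimage_add_right μ y Sᶜ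
  rw [ae_iff, ae_iff]
  change μ ((fun h => h + y) ⁻¹' Sᶜ) = 0 ↔ μ Sᶜ = 0
  rw [this]

section Fubini

variable {E Ω : Type*} [AddCommGroup E] [MeasurableSpace E] [MeasurableAdd₂ E] [MeasurableSpace Ω]
  {μ : Measure E} [SFinite μ] [μ.IsAddRightInvariant] {ν : Measure Ω} [SFinite ν] {L : Ω → E}

/-- Fubini provides a single `p` for which `x + L p ∈ S` for almost every `x`, and translation
invariance removes the shift. -/
theorem ae_of_forall_ae_add [NeZero ν] (hL : Measurable L) {S : Set E} (hS : MeasurableSet S)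
    (h : ∀ x, ∀ᵐ p ∂ν, x + L p ∈ S) : ∀ᵐ x ∂μ, x ∈ S := by
  have hm : MeasurableSet {q : E × Ω | q.1 + L q.2 ∈ S} :=
    (measurable_fst.add (hL.comp measurable_snd)) hS
  have h1 := (Measure.ae_ae_comm (μ := μ) (ν := ν) hm).mp (Eventually.of_forall h)
  obtain ⟨p, hp⟩ := h1.exists
  exact (ae_add_mem_iff _).mp hp

theorem ae_ae_add_of_ae (hL : Measurable L) {S : Set E} (h : ∀ᵐ x ∂μ, x ∈ S) :
    ∀ᵐ x ∂μ, ∀ᵐ p ∂ν, x + L p ∈ S := by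
  -- No measurability of `S` is assumed, so its complement is enlarged to a measurable null set
  -- before applying Fubini.
  set N := toMeasurable μ Sᶜ with hN
  have hNm : MeasurableSet N := measurableSet_toMeasurable _ _
  have hN0 : ∀ᵐ x ∂μ, x ∈ Nᶜ := by
    rw [ae_iff]
    simp only [mem_compl_iff, not_not]
    change μ N = 0
    rw [hN, measure_toMeasurable]
    exact h
  have hm : MeasurableSet {q : E × Ω | q.1 + L q.2 ∈ Nᶜ} :=
    (measurable_fst.add (hL.comp measurable_snd)) hNm.compl
  have h1 := (Measure.ae_ae_comm (μ := μ) (ν := ν) hm).mpr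
    (Eventually.of_forall fun p => (ae_add_mem_iff _).mpr hN0)
  filter_upwards [h1] with x hx
  filter_upwards [hx] with p hp
  by_contra hc
  exact hp (subset_toMeasurable μ Sᶜ hc)

end Fubini

section RandomSignal

variable {E : Type*} [AddCommGroup E] [MeasurableSpace E] [MeasurableAdd₂ E]
  {μ : Measure E} [SFinite μ] [μ.IsAddRightInvariant] {sig : E → ℝ → ℝ} {L : ℝ × ℝ → E}

/-- If a family of signals is asymptotically trigonometric and can be perturbed along a plane of
pure oscillations of frequency `θ`, then almost all signals are small only on sets of small
density. -/
theorem ae_rarelySmall (hsig : Measurable (Function.uncurry sig)) {W : Finset ℝ}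
    (hW : ∀ H, ∃ c : ℝ → ℂ, Tendsto (fun t => sig H t - trigPoly W c t) atTop (𝓝 0))
    (hLm : Measurable L) {θ : ℝ}
    (hadd : ∀ H p, Tendsto (fun t => sig (H + L p) t - sig H t
      - (p.1 * Real.cos (θ * t) + p.2 * Real.sin (θ * t))) atTop (𝓝 0)) :
    ∀ᵐ H ∂μ, RarelySmall (sig H) := by
  have hgm : ∀ H, Measurable (sig H) := fun H => hsig.comp measurable_prodMk_left
  have hex : ∀ (H : E) (j : ℕ), ∃ r : ℝ, 0 ≤ r ∧
      Tendsto (twistedMean 0 fun t => (bump (j + 1) (sig H t) : ℂ)) atTop (𝓝 (r : ℂ)) := by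
    intro H j
    obtain ⟨c, hc⟩ := hW H
    exact exists_tendsto_mean_bump (by positivity) (hgm H) hc
  choose D hD0 hD using hex
  have hDm : ∀ j, Measurable (fun H => D H j) := by
    intro j
    refine measurable_of_tendsto_metrizable
      (f := fun n : ℕ => fun H : E =>
        (twistedMean 0 (fun t => (bump (j + 1) (sig H t) : ℂ)) (n : ℝ)).re) (fun n => ?_) ?_
    · simp only [twistedMean_zero_ofReal, Complex.ofReal_re]
      refine measurable_const.mul ?_
      simp_rw [intervalIntegral.integral_of_le (Nat.cast_nonneg (α := ℝ) n)]
      have hb : Measurable (Function.uncurry fun (H : E) (t : ℝ) => bump (j + 1) (sig H t)) :=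
        (continuous_bump _).measurable.comp hsig
      exact hb.stronglyMeasurable.integral_prod_right.measurable
    · rw [tendsto_pi_nhds]
      intro H
      have := (Complex.continuous_re.tendsto _).comp
        ((hD H j).comp (tendsto_natCast_atTop_atTop (R := ℝ)))
      rw [Complex.ofReal_re] at this
      exact this
  -- A measurable condition on the limiting means `D`, sufficient for `RarelySmall`, to which Fubini
  -- applies.
  set S : Set (E) := {H | ∀ m : ℕ, ∃ j, D H j < 1 / ((m : ℝ) + 1)} with hS
  have hSm : MeasurableSet S := by
    have : S = ⋂ m : ℕ, ⋃ j, {H | D H j < 1 / ((m : ℝ) + 1)} := by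
      ext H
      simp [hS]
    rw [this]
    exact MeasurableSet.iInter fun m => MeasurableSet.iUnion fun j =>
      measurableSet_lt (hDm j) measurable_const
  let γ : Measure (ℝ × ℝ) := (gaussianReal 0 1).prod (gaussianReal 0 1)
  have key : ∀ H, ∀ᵐ p ∂γ, H + L p ∈ S := by
    intro H
    obtain ⟨c, hc⟩ := hW H
    set P := trigPoly W c with hP
    have hPc : Continuous P := continuous_trigPoly W c
    let Q : ℝ × ℝ → ℝ → ℝ := fun p t =>
      P t + (p.1 * Real.cos (θ * t) + p.2 * Real.sin (θ * t))
    have hQ : ∀ p, Tendsto (fun t => Q p t - sig (H + L p) t) atTop (𝓝 0) := by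
      intro p
      have := (hc.add (hadd H p)).neg
      simp only [add_zero, neg_zero] at this
      refine this.congr fun t => ?_
      simp only [Q, hP]
      ring
    have hQm : ∀ p, Measurable (Q p) := fun p => by
      have : Continuous (Q p) := by fun_prop
      exact this.measurable
    have hQD : ∀ p (j : ℕ), Tendsto (twistedMean 0 fun t => (bump (j + 1) (Q p t) : ℂ)) atTop
        (𝓝 (D (H + L p) j : ℂ)) := fun p j =>
      tendsto_mean_bump_congr (by positivity) (hQm p) (hgm _) (hQ p) (hD _ j)
    have hDL : ∀ j, Measurable (fun p => D (H + L p) j) := fun j =>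
      (hDm j).comp (measurable_const.add hLm)
    -- Averaging over `p` commutes with the time mean and its limit. At each time the perturbed
    -- value `Q p t` is normal with centre `P t` and variance 1, so the averaged bump is at most `4
    -- / (j + 1)`.
    have hbound : ∀ j : ℕ, ∫⁻ p, ENNReal.ofReal (D (H + L p) j) ∂γ
        ≤ ENNReal.ofReal (4 / ((j : ℝ) + 1)) := by
      intro j
      have hj : (0 : ℝ) < (j : ℝ) + 1 := by positivity
      have hKm : Measurable (Function.uncurry fun (p : ℝ × ℝ) (t : ℝ) =>
          (bump (j + 1) (Q p t) : ℂ)) := by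
        refine Complex.measurable_ofReal.comp ((continuous_bump _).measurable.comp ?_)
        have : Continuous (Function.uncurry Q) := by
          simp only [Q, Function.uncurry_def]
          fun_prop
        exact this.measurable
      have hK1 : ∀ p t, ‖(bump (j + 1) (Q p t) : ℂ)‖ ≤ 1 := fun p t => by
        rw [Complex.norm_real, Real.norm_of_nonneg (bump_nonneg _ _)]
        exact bump_le_one _ _
      have hlim := tendsto_twistedMean_integral 0 γ hKm hK1
        (Eventually.of_forall fun p => hQD p j)
      have hle : ‖∫ p, (D (H + L p) j : ℂ) ∂γ‖ ≤ 4 / ((j : ℝ) + 1) := by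
        refine le_of_tendsto hlim.norm ?_
        filter_upwards [eventually_gt_atTop 0] with T hT
        refine (norm_twistedMean_le 0 _ hT).trans ?_
        have : normMean (fun t => ∫ p, (bump (j + 1) (Q p t) : ℂ) ∂γ) T ≤ 4 / ((j : ℝ) + 1) := by
          refine normMean_le hT fun t _ => ?_
          have := integral_gaussian_rotation (θ * t) (P t)
            (f := fun x => (bump (j + 1) x : ℂ))
            (Complex.measurable_ofReal.comp (continuous_bump _).measurable)
          simp only [Q, γ]
          rw [this]
          exact norm_integral_bump_gaussian_le hj _
        simpa using this
      have hDle : ∀ p, D (H + L p) j ≤ 1 := by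
        intro p
        have hn := (hD (H + L p) j).norm
        rw [Complex.norm_real, Real.norm_of_nonneg (hD0 _ _)] at hn
        refine le_of_tendsto hn ?_
        filter_upwards [eventually_gt_atTop 0] with T hT
        refine (norm_twistedMean_le 0 _ hT).trans ?_
        have : normMean (fun t => (bump (j + 1) (sig (H + L p) t) : ℂ)) T ≤ 1 :=
          normMean_le hT fun t _ => by
            rw [Complex.norm_real, Real.norm_of_nonneg (bump_nonneg _ _)]
            exact bump_le_one _ _
        simpa using this
      have hint : Integrable (fun p => D (H + L p) j) γ :=
        Integrable.of_bound (hDL j).aestronglyMeasurable 1 (Eventually.of_forall fun p => by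
          rw [Real.norm_of_nonneg (hD0 _ _)]
          exact hDle p)
      rw [← ofReal_integral_eq_lintegral_ofReal hint (Eventually.of_forall fun p => hD0 _ _)]
      refine ENNReal.ofReal_le_ofReal ?_
      rw [integral_complex_ofReal, Complex.norm_real] at hle
      exact (le_abs_self _).trans hle
    -- The expectation of the infimum lies below every `4 / (j + 1)`; so the infimum over `j`
    -- vanishes almost surely.
    have hinf : ∫⁻ p, ⨅ j, ENNReal.ofReal (D (H + L p) j) ∂γ = 0 := by
      have h1 : ∀ j : ℕ, ∫⁻ p, ⨅ j, ENNReal.ofReal (D (H + L p) j) ∂γ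
          ≤ ENNReal.ofReal (4 / ((j : ℝ) + 1)) := fun j =>
        (lintegral_mono fun p => iInf_le _ j).trans (hbound j)
      have h2 : Tendsto (fun j : ℕ => ENNReal.ofReal (4 / ((j : ℝ) + 1))) atTop (𝓝 0) := by
        have := tendsto_const_div_atTop_nhds_zero_nat (𝕜 := ℝ) 4
        have h3 := (tendsto_add_atTop_iff_nat 1).mpr this
        have h4 := (ENNReal.continuous_ofReal.tendsto 0).comp h3
        rw [ENNReal.ofReal_zero] at h4
        refine h4.congr fun j => ?_
        simp
      exact le_antisymm (ge_of_tendsto' h2 h1) bot_le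
    rw [lintegral_eq_zero_iff (Measurable.iInf fun j => (hDL j).ennreal_ofReal)] at hinf
    filter_upwards [hinf] with p hp m
    have h1 : (⨅ j, ENNReal.ofReal (D (H + L p) j)) < ENNReal.ofReal (1 / ((m : ℝ) + 1)) := by
      rw [hp, Pi.zero_apply, ENNReal.ofReal_pos]
      positivity
    obtain ⟨j, hj⟩ := iInf_lt_iff.mp h1
    exact ⟨j, (ENNReal.ofReal_lt_ofReal_iff (by positivity)).mp hj⟩
  filter_upwards [ae_of_forall_ae_add (μ := μ) (ν := γ) hLm hSm key] with H hH
  refine rarelySmall_of_tendsto_mean_bump (hgm H) fun η hη => ?_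
  obtain ⟨m, hm⟩ := exists_nat_one_div_lt hη
  obtain ⟨j, hj⟩ := hH m
  exact ⟨(j : ℝ) + 1, by positivity, D H j, hj.trans hm, hD H j⟩

end RandomSignal

/-! ### The Gaussian average of `|x|^{is}` -/

/-- The Gaussian average of `logPhase s` around `x`. -/
noncomputable def gaussPhase (s x : ℝ) : ℂ := ∫ y, logPhase s (x + y) ∂(gaussianReal 0 1)

theorem norm_gaussPhase_le (s x : ℝ) : ‖gaussPhase s x‖ ≤ 1 := by
  refine (norm_integral_le_of_norm_le_const (C := 1)
    (Eventually.of_forall fun y => (norm_logPhase s (x + y)).le)).trans ?_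
  simp

/-- The entire function which extends `gaussPhase s`. -/
noncomputable def gaussPhaseExt (s : ℝ) (z : ℂ) : ℂ :=
  Complex.exp (-z ^ 2 / 2) * ∫ y : ℝ, logPhase s y * Complex.exp (z * y) ∂(gaussianReal 0 1)

/-- Translation moves `x` into the Gaussian density, and expanding `(y - x)²` splits off `e^{-x²/2}
e^{xy}`, which makes sense for complex `x`. -/
theorem gaussPhaseExt_ofReal (s x : ℝ) : gaussPhaseExt s x = gaussPhase s x := by
  rw [gaussPhaseExt, gaussPhase, integral_gaussianReal_eq_integral_smul one_ne_zero,
    integral_gaussianReal_eq_integral_smul one_ne_zero,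
    ← integral_sub_right_eq_self (fun y => gaussianPDFReal 0 1 y • logPhase s (x + y)) x,
    ← integral_const_mul]
  refine integral_congr_ae (Eventually.of_forall fun y => ?_)
  simp only [add_sub_cancel, gaussianPDFReal, Complex.real_smul, sub_zero, NNReal.coe_one, mul_one]
  push_cast
  have e : Complex.exp (-(y - x : ℂ) ^ 2 / 2)
      = Complex.exp (-y ^ 2 / 2) * Complex.exp (-x ^ 2 / 2) * Complex.exp (x * y) := by
    rw [← Complex.exp_add, ← Complex.exp_add]
    congr 1
    ring
  rw [e]
  ring

theorem integrable_exp_mul_abs_gaussianReal (R : ℝ) :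
    Integrable (fun y => Real.exp (R * |y|)) (gaussianReal 0 1) := by
  refine ((integrable_exp_mul_gaussianReal R).add (integrable_exp_mul_gaussianReal (-R))).mono'
    (by fun_prop) (Eventually.of_forall fun y => ?_)
  rw [Real.norm_of_nonneg (Real.exp_pos _).le, Pi.add_apply]
  rcases abs_cases y with ⟨h, _⟩ | ⟨h, _⟩ <;> rw [h]
  · linarith [Real.exp_pos (-R * y)]
  · rw [mul_neg, ← neg_mul]
    linarith [Real.exp_pos (R * y)]

theorem norm_exp_mul_ofReal_le (z : ℂ) (y : ℝ) :
    ‖Complex.exp (z * y)‖ ≤ Real.exp (‖z‖ * |y|) := by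
  refine (Complex.norm_exp_le_exp_norm _).trans ?_
  rw [norm_mul, Complex.norm_real, Real.norm_eq_abs]

theorem differentiable_gaussPhaseExt (s : ℝ) : Differentiable ℂ (gaussPhaseExt s) := by
  intro z₀
  refine DifferentiableAt.mul (by fun_prop) ?_
  have hm : ∀ z : ℂ, Measurable fun y : ℝ => logPhase s y * Complex.exp (z * y) := fun z =>
    (measurable_logPhase s).mul (by fun_prop)
  refine (hasDerivAt_integral_of_dominated_loc_of_deriv_le (Metric.ball_mem_nhds z₀ one_pos)
    (Eventually.of_forall fun z => (hm z).aestronglyMeasurable)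
    (F' := fun z y => logPhase s y * (Complex.exp (z * y) * y))
    -- One unit in `‖z₀‖ + 2` is for the ball of radius 1 around `z₀`, the other for the factor `|y|
    -- ≤ e^{|y|}` from the derivative.
    (bound := fun y => Real.exp ((‖z₀‖ + 2) * |y|)) ?_ ?_ (Eventually.of_forall fun y z hz => ?_)
    (integrable_exp_mul_abs_gaussianReal _) (Eventually.of_forall fun y z _ => ?_)).2.differentiableAt
  · refine (integrable_exp_mul_abs_gaussianReal ‖z₀‖).mono' (hm z₀).aestronglyMeasurable
      (Eventually.of_forall fun y => ?_)
    rw [norm_mul, norm_logPhase, one_mul]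
    exact norm_exp_mul_ofReal_le _ _
  · exact ((measurable_logPhase s).mul (by fun_prop)).aestronglyMeasurable
  · rw [norm_mul, norm_logPhase, one_mul, norm_mul, Complex.norm_real, Real.norm_eq_abs]
    have hz' : ‖z‖ ≤ ‖z₀‖ + 1 := by
      rw [Metric.mem_ball, dist_eq_norm] at hz
      have := norm_add_le (z - z₀) z₀
      rw [sub_add_cancel] at this
      linarith
    have h1 : |y| ≤ Real.exp |y| := by linarith [Real.add_one_le_exp |y|]
    calc ‖Complex.exp (z * y)‖ * |y| ≤ Real.exp ((‖z₀‖ + 1) * |y|) * Real.exp |y| := by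
          gcongr
          exact (norm_exp_mul_ofReal_le z y).trans (by gcongr)
      _ = Real.exp ((‖z₀‖ + 2) * |y|) := by
          rw [← Real.exp_add]
          ring_nf
  · have := ((hasDerivAt_id z).mul_const (y : ℂ)).cexp
    simpa using this.const_mul (logPhase s y)

/-- Both the Gaussian measure and `log |y|` are even. -/
theorem gaussPhaseExt_neg (s : ℝ) (z : ℂ) : gaussPhaseExt s (-z) = gaussPhaseExt s z := by
  rw [gaussPhaseExt, gaussPhaseExt, neg_sq]
  congr 1
  have h : gaussianReal 0 1 = (gaussianReal 0 1).map (fun x : ℝ => -x) := by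
    rw [gaussianReal_map_neg, neg_zero]
  have hm : Measurable fun y : ℝ => logPhase s y * Complex.exp (-z * y) :=
    (measurable_logPhase s).mul (by fun_prop)
  conv_lhs => rw [h]
  rw [integral_map (by fun_prop) hm.aestronglyMeasurable]
  refine integral_congr_ae (Eventually.of_forall fun y => ?_)
  simp [logPhase]

/-- Taylor coefficients of `gaussPhase s`. -/
noncomputable def gaussPhaseCoeff (s : ℝ) (n : ℕ) : ℂ :=
  (n.factorial : ℂ)⁻¹ * iteratedDeriv n (gaussPhaseExt s) 0

theorem hasSum_gaussPhase (s x : ℝ) :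
    HasSum (fun n => gaussPhaseCoeff s n * (x : ℂ) ^ n) (gaussPhase s x) := by
  have := Complex.hasSum_taylorSeries_of_entire (differentiable_gaussPhaseExt s) 0 x
  rw [gaussPhaseExt_ofReal] at this
  refine this.congr_fun fun n => ?_
  simp only [gaussPhaseCoeff, smul_eq_mul, sub_zero]
  ring

theorem continuous_gaussPhase (s : ℝ) : Continuous (gaussPhase s) := by
  have := (differentiable_gaussPhaseExt s).continuous.comp Complex.continuous_ofReal
  exact this.congr fun x => gaussPhaseExt_ofReal s x

theorem gaussPhaseCoeff_odd (s : ℝ) {n : ℕ} (hn : Odd n) : gaussPhaseCoeff s n = 0 := by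
  have h := iteratedDeriv_comp_neg n (gaussPhaseExt s) 0
  simp_rw [gaussPhaseExt_neg] at h
  rw [hn.neg_one_pow, neg_zero, neg_smul, one_smul, self_eq_neg] at h
  rw [gaussPhaseCoeff, h, mul_zero]

/-- For fixed `y`, the quotient `|x + y|^{is} / |x|^{is} = |1 + y/x|^{is}` tends to 1; dominated
convergence does the rest. -/
theorem tendsto_gaussPhase_div (s : ℝ) :
    Tendsto (fun x => gaussPhase s x / logPhase s x) atTop (𝓝 1) := by
  have h1 : Tendsto (fun x : ℝ => ∫ y, logPhase s (x + y) / logPhase s x ∂(gaussianReal 0 1)) atTop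
      (𝓝 (∫ _, (1 : ℂ) ∂(gaussianReal 0 1))) := by
    refine tendsto_integral_filter_of_dominated_convergence (fun _ => 1)
      (Eventually.of_forall fun x => (((measurable_logPhase s).comp
        (measurable_const_add x)).div_const _).aestronglyMeasurable)
      (Eventually.of_forall fun x => Eventually.of_forall fun y => ?_) (integrable_const _)
      (Eventually.of_forall fun y => ?_)
    · rw [norm_div, norm_logPhase, norm_logPhase, div_one]
    · have h2 : Tendsto (fun x : ℝ => 1 + y / x) atTop (𝓝 1) := by
        simpa using (tendsto_const_nhds (x := (1 : ℝ))).add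
          ((tendsto_const_nhds (x := y)).div_atTop tendsto_id)
      have h3 : ContinuousAt (logPhase s) 1 := by
        unfold logPhase
        have := Real.continuousAt_log one_ne_zero
        fun_prop
      have h4 := h3.tendsto.comp h2
      have h5 : logPhase s 1 = 1 := by simp [logPhase]
      rw [h5] at h4
      refine h4.congr' ?_
      filter_upwards [eventually_gt_atTop 0, eventually_gt_atTop (-y)] with x hx hxy
      have h6 : 1 + y / x ≠ 0 := by
        have : 0 < 1 + y / x := by
          rw [one_add_div hx.ne']
          exact div_pos (by linarith) hx
        exact this.ne'
      rw [Function.comp_apply, eq_div_iff (logPhase_ne_zero s x), mul_comm,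
        ← logPhase_mul s hx.ne' h6]
      congr 1
      field_simp
  simp only [integral_div, integral_const, probReal_univ, one_smul] at h1
  exact h1

/-- Infinitely many Taylor coefficients of `gaussPhase s` do not vanish: otherwise it would be a
bounded polynomial, hence constant. -/
theorem exists_gaussPhaseCoeff_ne_zero {s : ℝ} (hs : 0 < s) (n₀ : ℕ) :
    ∃ n ≥ n₀, Even n ∧ gaussPhaseCoeff s n ≠ 0 := by
  by_contra! hcon
  have h0 : ∀ n ≥ n₀, gaussPhaseCoeff s n = 0 := fun n hn => by
    rcases Nat.even_or_odd n with h | h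
    · exact hcon n hn h
    · exact gaussPhaseCoeff_odd s h
  let p : Polynomial ℂ := ∑ n ∈ Finset.range n₀, Polynomial.monomial n (gaussPhaseCoeff s n)
  have hp : ∀ x : ℝ, p.eval (x : ℂ) = gaussPhase s x := by
    intro x
    have h1 : HasSum (fun n => gaussPhaseCoeff s n * (x : ℂ) ^ n)
        (∑ n ∈ Finset.range n₀, gaussPhaseCoeff s n * (x : ℂ) ^ n) :=
      hasSum_sum_of_ne_finset_zero fun n hn => by
        rw [h0 n (by simpa using hn), zero_mul]
    rw [(hasSum_gaussPhase s x).unique h1]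
    simp [p, Polynomial.eval_finsetSum]
  have hdeg : p.degree ≤ 0 := by
    by_contra! hd
    have h1 := Polynomial.tendsto_norm_atTop p hd (z := fun x : ℝ => (x : ℂ)) (l := atTop) (by
      simpa using tendsto_abs_atTop_atTop)
    obtain ⟨x, hx⟩ := (h1.eventually_gt_atTop 1).exists
    rw [hp] at hx
    exact absurd (norm_gaussPhase_le s x) (not_le.mpr hx)
  obtain ⟨c, hc⟩ : ∃ c, ∀ x : ℝ, gaussPhase s x = c := by
    refine ⟨p.coeff 0, fun x => ?_⟩
    rw [← hp, Polynomial.eq_C_of_degree_le_zero hdeg]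
    simp
  have h2 := (tendsto_gaussPhase_div s).comp Real.tendsto_exp_atTop
  -- At `x = e^t`, shifting `t` by `π / s` changes the sign of `|x|^{is}`. With a constant
  -- numerator, the quotient would tend to both `1` and `-1`.
  have h3 := h2.comp (tendsto_atTop_add_const_right atTop (Real.pi / s) tendsto_id)
  have h4 : ∀ t : ℝ, ((fun x => gaussPhase s x / logPhase s x) ∘ Real.exp) (id t + Real.pi / s)
      = -(((fun x => gaussPhase s x / logPhase s x) ∘ Real.exp) t) := by
    intro t
    simp only [Function.comp_apply, hc, logPhase_exp, id]
    have e : Complex.I * s * ((t + Real.pi / s : ℝ) : ℂ)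
        = Complex.I * s * t + Real.pi * Complex.I := by
      have : (s : ℂ) ≠ 0 := by exact_mod_cast hs.ne'
      push_cast
      field_simp
    rw [e, Complex.exp_add, Complex.exp_pi_mul_I, mul_neg_one, div_neg]
  have h5 := h3.congr h4
  have h6 := tendsto_nhds_unique h5 h2.neg
  norm_num at h6

/-! ### Means of Gaussian averages of signals -/

theorem bddMeas_character_mul_gaussPhase (Ω s : ℝ) {g : ℝ → ℝ} (hg : Measurable g) :
    BddMeas fun t => character Ω t * gaussPhase s (g t) :=
  (bddMeas_character Ω).mul
    ⟨(continuous_gaussPhase s).measurable.comp hg, 1, fun _ => norm_gaussPhase_le _ _⟩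

/-- The hypothesis is integrated over `p`: at each time the perturbation is standard normal, so the
expectation of the phase is `gaussPhase s (g t)`. -/
theorem tendsto_twistedMean_gaussPhase (κ Ω s θ : ℝ) {g : ℝ → ℝ} (hg : Measurable g)
    (h : ∀ᵐ p : ℝ × ℝ ∂((gaussianReal 0 1).prod (gaussianReal 0 1)),
      Tendsto (twistedMean κ fun t => character Ω t *
        logPhase s (g t + (p.1 * Real.cos (θ * t) + p.2 * Real.sin (θ * t)))) atTop (𝓝 0)) :
    Tendsto (twistedMean κ fun t => character Ω t * gaussPhase s (g t)) atTop (𝓝 0) := by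
  have hK : Measurable (Function.uncurry fun (p : ℝ × ℝ) (t : ℝ) => character Ω t *
      logPhase s (g t + (p.1 * Real.cos (θ * t) + p.2 * Real.sin (θ * t)))) := by
    refine ((bddMeas_character Ω).1.comp measurable_snd).mul ((measurable_logPhase s).comp ?_)
    exact (hg.comp measurable_snd).add (by fun_prop)
  have := tendsto_twistedMean_integral κ ((gaussianReal 0 1).prod (gaussianReal 0 1)) hK (C := 1)
    (fun p t => by rw [norm_mul, norm_character, norm_logPhase, one_mul]) (D := fun _ => 0) h
  rw [integral_zero] at this
  refine this.congr' (Eventually.of_forall fun T => ?_)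
  congr 1
  ext t
  rw [integral_const_mul, integral_gaussian_rotation (θ * t) (g t) (measurable_logPhase s),
    gaussPhase]

theorem eventually_normMean_le_of_eventually_le {f : ℝ → ℂ} (hf : BddMeas f) {η : ℝ} (hη : 0 < η)
    (h : ∀ᶠ t in atTop, ‖f t‖ ≤ η / 2) : ∀ᶠ T in atTop, normMean f T ≤ η := by
  obtain ⟨t₀, ht₀⟩ := eventually_atTop.mp h
  set f₀ : ℝ → ℂ := (Iio t₀).indicator f with hf₀
  have hb : BddMeas f₀ := ⟨hf.1.indicator measurableSet_Iio, by
    obtain ⟨C, hC⟩ := hf.2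
    exact ⟨C, fun t => (norm_indicator_le_norm_self _ _).trans (hC t)⟩⟩
  have h0 : Tendsto f₀ atTop (𝓝 0) := by
    refine tendsto_const_nhds.congr' ?_
    filter_upwards [eventually_ge_atTop t₀] with t ht
    rw [hf₀, indicator_of_notMem (by simpa using ht)]
  filter_upwards [eventually_normMean_le_of_tendsto_zero hb h0 (half_pos hη),
    eventually_gt_atTop 0] with T hT hT0
  have h1 := normMean_mono_add hf hb (BddMeas.const ((η / 2 : ℝ) : ℂ)) (fun t _ => ?_) hT0
  · have h2 : normMean (fun _ => ((η / 2 : ℝ) : ℂ)) T ≤ η / 2 := normMean_le hT0 fun t _ => by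
      rw [Complex.norm_real, Real.norm_of_nonneg (half_pos hη).le]
    linarith
  · rw [Complex.norm_real, Real.norm_of_nonneg (half_pos hη).le]
    by_cases ht : t < t₀
    · rw [hf₀, indicator_of_mem (show t ∈ Iio t₀ from ht)]
      linarith
    · exact (ht₀ t (not_lt.mp ht)).trans (by linarith [norm_nonneg (f₀ t)])

theorem tendsto_twistedMean_gaussPhase_of_approx (κ Ω s : ℝ) {P : ℝ → ℝ} (hP : Measurable P) {B : ℝ}
    (hB : ∀ t, |P t| ≤ B)
    (h : ∀ δ > 0, ∃ g : ℝ → ℝ, Measurable g ∧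
      Tendsto (twistedMean κ fun t => character Ω t * gaussPhase s (g t)) atTop (𝓝 0) ∧
      ∀ᶠ t in atTop, |g t - P t| ≤ δ) :
    Tendsto (twistedMean κ fun t => character Ω t * gaussPhase s (P t)) atTop (𝓝 0) := by
  refine tendsto_twistedMean_zero_of_approx κ (bddMeas_character_mul_gaussPhase Ω s hP)
    fun η hη => ?_
  -- The interval is enlarged by 1 to contain also the values of `g` at late times; the bound `1` in
  -- the choice of `g` below ensures this.
  have hu := (isCompact_Icc (a := -(B + 1)) (b := B + 1)).uniformContinuousOn_of_continuous
    (continuous_gaussPhase s).continuousOn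
  obtain ⟨δ, hδ, hδ'⟩ := Metric.uniformContinuousOn_iff.mp hu (η / 2) (half_pos hη)
  obtain ⟨g, hg, hg0, hgP⟩ := h (min (δ / 2) 1) (by positivity)
  refine ⟨_, bddMeas_character_mul_gaussPhase Ω s hg, hg0, ?_⟩
  refine eventually_normMean_le_of_eventually_le ((bddMeas_character_mul_gaussPhase Ω s hP).sub
    (bddMeas_character_mul_gaussPhase Ω s hg)) hη ?_
  filter_upwards [hgP] with t ht
  rw [← mul_sub, norm_mul, norm_character, one_mul, ← dist_eq_norm]
  have h1 := abs_le.mp (hB t)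
  have h2 := abs_le.mp (ht.trans (min_le_right _ _))
  refine (hδ' _ ⟨by linarith, by linarith⟩ _ ⟨by linarith, by linarith⟩ ?_).le
  rw [dist_comm, Real.dist_eq]
  have := ht.trans (min_le_left _ _)
  linarith

theorem eq_zero_of_hasSum_pow {c : ℕ → ℂ} (h : ∀ ε : ℝ, HasSum (fun n => (ε : ℂ) ^ n * c n) 0)
    (n : ℕ) : c n = 0 := by
  let p : FormalMultilinearSeries ℝ ℝ ℂ := fun n =>
    ContinuousMultilinearMap.mkPiRing ℝ (Fin n) (c n)
  have hp : ∀ n, p.coeff n = c n := fun n => by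
    simp [p, FormalMultilinearSeries.coeff]
  have hs : HasFPowerSeriesAt (0 : ℝ → ℂ) p 0 := by
    rw [hasFPowerSeriesAt_iff]
    refine Eventually.of_forall fun z => ?_
    simp only [hp, Complex.real_smul, Complex.ofReal_pow, Pi.zero_apply]
    exact h z
  rw [← hp, hs.eq_zero]
  simp [FormalMultilinearSeries.coeff]

/-- If the means of `F(ε P)` vanish for an entire function `F` and all `ε`, then so do the products
of the Taylor coefficients of `F` and the means of the powers of `P`. -/
theorem coeff_mul_mean_eq_zero (κ : ℝ) {a : ℕ → ℂ} {F : ℝ → ℂ}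
    (hF : ∀ x : ℝ, HasSum (fun n => a n * (x : ℂ) ^ n) (F x)) {q : ℝ → ℂ} (hq : Measurable q)
    (hq1 : ∀ t, ‖q t‖ = 1) {P : ℝ → ℝ} (hP : Measurable P) {B : ℝ} (hB : ∀ t, |P t| ≤ B)
    {M : ℕ → ℂ}
    (hM : ∀ n, Tendsto (twistedMean κ fun t => q t * (P t : ℂ) ^ n) atTop (𝓝 (M n)))
    (h : ∀ ε : ℝ, Tendsto (twistedMean κ fun t => q t * F (ε * P t)) atTop (𝓝 0)) (n : ℕ) :
    a n * M n = 0 := by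
  refine eq_zero_of_hasSum_pow (c := fun n => a n * M n) (fun ε => ?_) n
  have hB0 : 0 ≤ B := (abs_nonneg _).trans (hB 0)
  set f : ℕ → ℝ → ℂ := fun n t => a n * ε ^ n * (q t * (P t : ℂ) ^ n) with hf
  have hfm : ∀ n, Measurable (f n) := fun n => by
    simp only [hf]
    fun_prop
  have hfb : ∀ n t, ‖f n t‖ ≤ ‖a n‖ * (|ε| * B) ^ n := by
    intro n t
    simp only [hf, norm_mul, norm_pow, hq1, one_mul, Complex.norm_real, Real.norm_eq_abs, mul_pow]
    rw [mul_assoc]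
    gcongr
    exact hB t
  have hsum : Summable fun n => ‖a n‖ * (|ε| * B) ^ n := by
    have := (hF (|ε| * B)).summable.norm
    refine this.congr fun n => ?_
    rw [norm_mul, norm_pow, Complex.norm_real, Real.norm_of_nonneg (by positivity)]
  set K := ‖(1 + Complex.I * κ : ℂ)‖ with hK
  have hb : ∀ n, ∀ T, 0 < T → ‖twistedMean κ (f n) T‖ ≤ K * (‖a n‖ * (|ε| * B) ^ n) :=
    fun n T hT => (norm_twistedMean_le κ _ hT).trans (by
      gcongr
      exact normMean_le hT fun t _ => hfb n t)
  have hlim : ∀ n, Tendsto (twistedMean κ (f n)) atTop (𝓝 (a n * ε ^ n * M n)) := fun n =>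
    ((hM n).const_mul (a n * ε ^ n)).congr fun T => (twistedMean_const_mul κ _ _ T).symm
  have hcs : Summable fun n => a n * ε ^ n * M n := by
    refine (hsum.mul_left K).of_norm_bounded fun n => ?_
    refine le_of_tendsto (hlim n).norm ?_
    filter_upwards [eventually_gt_atTop 0] with T hT using hb n T hT
  -- The summable majorant `‖a n‖ (|ε| B)^n` permits exchanging the series first with the limit in
  -- `T`, then with the time integral. The limit is a power series in `ε` that vanishes identically.
  have hT := tendsto_tsum_of_dominated_convergence (f := fun T n => twistedMean κ (f n) T)
    (hsum.mul_left K) hlim (by filter_upwards [eventually_gt_atTop 0] with T hT n using hb n T hT)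
  have hex : ∀ T, ∑' n, twistedMean κ (f n) T = twistedMean κ (fun t => q t * F (ε * P t)) T := by
    intro T
    refine HasSum.tsum_eq ?_
    simp only [twistedMean]
    refine HasSum.mul_left _ (HasSum.mul_left _ ?_)
    refine intervalIntegral.hasSum_integral_of_dominated_convergence
      (fun n _ => ‖a n‖ * (|ε| * B) ^ n)
      (fun n => ((measurable_logPhase κ).mul (hfm n)).aestronglyMeasurable)
      (fun n => Eventually.of_forall fun t _ => ?_) (Eventually.of_forall fun t _ => hsum)
      intervalIntegrable_const (Eventually.of_forall fun t _ => HasSum.mul_left _ ?_)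
    · rw [norm_mul, norm_logPhase, one_mul]
      exact hfb n t
    · have := (hF (ε * P t)).mul_left (q t)
      refine this.congr_fun fun n => ?_
      simp only [hf]
      push_cast
      ring
  simp_rw [hex] at hT
  have h0 := tendsto_nhds_unique (h ε) hT
  have := hcs.hasSum
  rw [← h0] at this
  refine this.congr_fun fun n => ?_
  ring

/-! ### Means of powers of a sum of characters -/

/-- A list in `W` with sum `v`, taken twice, has even length and sum `2v`; inserting pairs `w, -w`
reaches every larger even length. Doubling `v` settles the parity. -/
theorem exists_tuple_sum {W : Finset ℝ} (hsymm : ∀ w ∈ W, -w ∈ W) (hne : W.Nonempty) {v : ℝ}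
    (hv : v ∈ AddSubgroup.closure (W : Set ℝ)) :
    ∃ n₀, ∀ n ≥ n₀, Even n → ∃ p : Fin n → W, ∑ i, (p i : ℝ) = 2 * v := by
  have h1 : ∃ l : List ℝ, (∀ x ∈ l, x ∈ W) ∧ l.sum = v := by
    induction hv using AddSubgroup.closure_induction with
    | mem x hx => exact ⟨[x], by simpa using hx, by simp⟩
    | zero => exact ⟨[], by simp, rfl⟩
    | add x y _ _ hx hy =>
      obtain ⟨l, hl, rfl⟩ := hx
      obtain ⟨m, hm, rfl⟩ := hy
      refine ⟨l ++ m, fun x hx => ?_, List.sum_append⟩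
      exact (List.mem_append.mp hx).elim (hl x) (hm x)
    | neg x _ hx =>
      obtain ⟨l, hl, rfl⟩ := hx
      refine ⟨l.map fun w => -w, fun x hx => ?_, by rw [List.sum_neg]⟩
      obtain ⟨w, hw, rfl⟩ := List.mem_map.mp hx
      exact hsymm w (hl w hw)
  obtain ⟨l, hlW, hl⟩ := h1
  obtain ⟨w, hw⟩ := hne
  have h2 : ∀ j : ℕ, ∃ m : List ℝ, (∀ x ∈ m, x ∈ W) ∧ m.length = 2 * (l.length + j) ∧
      m.sum = 2 * v := by
    intro j
    induction j with
    | zero =>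
      refine ⟨l ++ l, fun x hx => ?_, by rw [List.length_append]; ring, ?_⟩
      · exact (List.mem_append.mp hx).elim (hlW x) (hlW x)
      · rw [List.sum_append, hl, two_mul]
    | succ j ih =>
      obtain ⟨m, hmW, hm1, hm2⟩ := ih
      refine ⟨w :: -w :: m, fun x hx => ?_, ?_, ?_⟩
      · rcases List.mem_cons.mp hx with rfl | hx
        · exact hw
        · rcases List.mem_cons.mp hx with rfl | hx
          · exact hsymm w hw
          · exact hmW x hx
      · simp only [List.length_cons, hm1]
        ring
      · rw [List.sum_cons, List.sum_cons, hm2, add_neg_cancel_left]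
  refine ⟨2 * l.length, fun n hn he => ?_⟩
  obtain ⟨k, rfl⟩ := he
  obtain ⟨m, hmW, hm1, hm2⟩ := h2 (k - l.length)
  have hlen : k + k = m.length := by omega
  rw [hlen]
  refine ⟨fun i => ⟨m.get i, hmW _ (List.get_mem m i)⟩, ?_⟩
  rw [← hm2, ← List.sum_ofFn, List.ofFn_get]

theorem prod_character {ι : Type*} (s : Finset ι) (v : ι → ℝ) (t : ℝ) :
    ∏ i ∈ s, character (v i) t = character (∑ i ∈ s, v i) t := by
  simp only [character, ← Complex.exp_sum]
  congr 1
  push_cast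
  rw [Finset.mul_sum, Finset.sum_mul]

/-- Expanding the power into characters, `M n` counts the `n`-tuples in `W` with sum `-2v`, so
nothing can cancel. -/
theorem exists_mean_pow_ne_zero (κ : ℝ) {W : Finset ℝ} (hsymm : ∀ w ∈ W, -w ∈ W)
    (hne : W.Nonempty) {v : ℝ} (hv : v ∈ AddSubgroup.closure (W : Set ℝ)) :
    ∃ M : ℕ → ℂ, (∀ n, Tendsto (twistedMean κ fun t =>
        character (2 * v) t * (∑ w ∈ W, character w t) ^ n) atTop (𝓝 (M n))) ∧
      ∃ n₀, ∀ n ≥ n₀, Even n → M n ≠ 0 := by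
  classical
  refine ⟨fun n => ∑ p : Fin n → W, if 2 * v + ∑ i, (p i : ℝ) = 0 then 1 else 0, fun n => ?_, ?_⟩
  · have e : ∀ t, character (2 * v) t * (∑ w ∈ W, character w t) ^ n
        = ∑ p : Fin n → W, character (2 * v + ∑ i, (p i : ℝ)) t := by
      intro t
      rw [← Finset.sum_coe_sort, Fintype.sum_pow, Finset.mul_sum]
      refine Finset.sum_congr rfl fun p _ => ?_
      rw [prod_character, character_add, Pi.mul_apply]
    simp_rw [e]
    have := tendsto_finsetSum (Finset.univ : Finset (Fin n → W)) fun p _ =>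
      tendsto_twistedMean_expI_ite κ (2 * v + ∑ i, (p i : ℝ))
    refine this.congr fun T => ?_
    exact (twistedMean_sum κ _ (fun p _ => bddMeas_character _) T).symm
  · obtain ⟨n₀, h⟩ := exists_tuple_sum hsymm hne (neg_mem hv)
    refine ⟨n₀, fun n hn he => ?_⟩
    obtain ⟨p, hp⟩ := h n hn he
    beta_reduce
    rw [Finset.sum_boole]
    have : 0 < (Finset.univ.filter fun p : Fin n → W => 2 * v + ∑ i, (p i : ℝ) = 0).card := by
      refine Finset.card_pos.mpr ⟨p, ?_⟩
      simp only [Finset.mem_filter, Finset.mem_univ, true_and]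
      linarith
    exact_mod_cast this.ne'

/-! ### Integer relations and rational spans -/

theorem div_mem_span_of_mem_closure {W : Set ℝ} {w : ℝ} (hw : w ∈ AddSubgroup.closure W) :
    w / (2 * Real.pi) ∈ Submodule.span ℚ ((fun w : ℝ => w / (2 * Real.pi)) '' W) := by
  induction hw using AddSubgroup.closure_induction with
  | mem x hx => exact Submodule.subset_span ⟨x, hx, rfl⟩
  | zero => simp
  | add x y _ _ hx hy => rw [add_div]; exact add_mem hx hy
  | neg x _ hx => rw [neg_div]; exact neg_mem hx

/-- `N` is a common denominator of the rational coefficients. -/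
theorem exists_mul_mem_closure_of_mem_span {W : Set ℝ} {x : ℝ}
    (hx : x ∈ Submodule.span ℚ ((fun w : ℝ => w / (2 * Real.pi)) '' W)) :
    ∃ N : ℕ, 0 < N ∧ N * (2 * Real.pi * x) ∈ AddSubgroup.closure W := by
  induction hx using Submodule.span_induction with
  | mem x hx =>
    obtain ⟨w, hw, rfl⟩ := hx
    refine ⟨1, one_pos, ?_⟩
    have : ((1 : ℕ) : ℝ) * (2 * Real.pi * (w / (2 * Real.pi))) = w := by
      field_simp
      simp
    simp only [this]
    exact AddSubgroup.subset_closure hw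
  | zero => exact ⟨1, one_pos, by simp⟩
  | add x y _ _ hx hy =>
    obtain ⟨m, hm, hxm⟩ := hx
    obtain ⟨n, hn, hyn⟩ := hy
    refine ⟨m * n, Nat.mul_pos hm hn, ?_⟩
    have e : ((m * n : ℕ) : ℝ) * (2 * Real.pi * (x + y))
        = n • (m * (2 * Real.pi * x)) + m • (n * (2 * Real.pi * y)) := by
      push_cast [nsmul_eq_mul]
      ring
    rw [e]
    exact add_mem (nsmul_mem hxm n) (nsmul_mem hyn m)
  | smul q x _ hx =>
    obtain ⟨m, hm, hxm⟩ := hx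
    refine ⟨m * q.den, Nat.mul_pos hm q.den_pos, ?_⟩
    have e : ((m * q.den : ℕ) : ℝ) * (2 * Real.pi * (q • x))
        = q.num • (m * (2 * Real.pi * x)) := by
      have hq : (q.den : ℝ) * (q : ℝ) = q.num := by
        rw [mul_comm]
        exact_mod_cast Rat.mul_den_eq_num q
      rw [Rat.smul_def, zsmul_eq_mul, ← hq]
      push_cast
      ring
    rw [e]
    exact zsmul_mem hxm _

/-! ### Signals of a linear flow -/

/-- In finite dimension it suffices to bound a basis; the time from which the bound holds is then
the same for all `x`. -/
theorem exists_eventually_abs_le_mul_norm {E : Type*} [NormedAddCommGroup E] [NormedSpace ℝ E]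
    [FiniteDimensional ℝ E] {e : ℝ → E →ₗ[ℝ] ℝ} (h : ∀ x, ∃ C, ∀ᶠ t in atTop, |e t x| ≤ C) :
    ∃ C > 0, ∀ᶠ t in atTop, ∀ x, |e t x| ≤ C * ‖x‖ := by
  let v := Module.finBasis ℝ E
  choose C hC using fun i => h (v i)
  let l : Fin (Module.finrank ℝ E) → E →L[ℝ] ℝ := fun i => (v.coord i).toContinuousLinearMap
  refine ⟨∑ i, ‖l i‖ * |C i| + 1, by positivity, ?_⟩
  filter_upwards [eventually_all.mpr hC] with t ht x
  have e1 : e t x = ∑ i, l i x * e t (v i) := by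
    conv_lhs => rw [← v.sum_repr x, map_sum]
    simp [l]
  rw [e1, add_mul, Finset.sum_mul]
  refine (Finset.abs_sum_le_sum_abs _ _).trans ?_
  have : ∀ i, |l i x * e t (v i)| ≤ ‖l i‖ * |C i| * ‖x‖ := fun i => by
    rw [abs_mul]
    calc |l i x| * |e t (v i)| ≤ (‖l i‖ * ‖x‖) * |C i| :=
          mul_le_mul ((l i).le_opNorm x) ((ht i).trans (le_abs_self _)) (abs_nonneg _)
            (by positivity)
      _ = ‖l i‖ * |C i| * ‖x‖ := by ring
  have h2 := Finset.sum_le_sum fun i (_ : i ∈ Finset.univ) => this i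
  linarith [norm_nonneg x]

theorem character_sum_eq_trigPoly {W : Finset ℝ} (hsymm : ∀ w ∈ W, -w ∈ W) (t : ℝ) :
    ((trigPoly W (fun _ => 1) t : ℝ) : ℂ) = ∑ w ∈ W, character w t := by
  have e : trigPoly W (fun _ => 1) t = (∑ w ∈ W, character w t).re := by
    simp [trigPoly, character]
  rw [e, ← Complex.conj_eq_iff_re, map_sum]
  simp_rw [conj_character]
  exact Finset.sum_nbij' (fun w => -w) (fun w => -w) hsymm hsymm (fun _ _ => neg_neg _)
    (fun _ _ => neg_neg _) fun _ _ => rfl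

theorem trigPoly_one_eq_sum_cos (W : Finset ℝ) (t : ℝ) :
    trigPoly W (fun _ => 1) t = ∑ w ∈ W, Real.cos (w * t) := by
  rw [trigPoly, Complex.re_sum]
  refine Finset.sum_congr rfl fun w _ => ?_
  rw [one_mul, Complex.exp_re]
  simp

namespace LinearFlow

variable {d : ℕ} (φ : LinearFlow d)

theorem measurable_apply_timeMap (H : LinObservable d) : Measurable fun t => H (φ.timeMap t) :=
  (H.continuous.comp φ.continuous_timeMap).measurable

theorem apply_scaled (ρ : ℝ) (k : ℕ) (H : LinObservable d) (t : ℝ) :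
    H (φ.scaled ρ k t) = Real.exp (-(ρ * t)) / t ^ k * H (φ.timeMap t) := by
  rw [scaled, map_smul, smul_eq_mul]

theorem measurable_apply_scaled (ρ : ℝ) (k : ℕ) :
    Measurable (Function.uncurry fun (H : LinObservable d) (t : ℝ) => H (φ.scaled ρ k t)) := by
  simp only [apply_scaled, Function.uncurry_def]
  have h : Continuous fun q : LinObservable d × ℝ => q.1 (φ.timeMap q.2) :=
    continuous_fst.clm_apply (φ.continuous_timeMap.comp continuous_snd)
  refine Measurable.mul (by fun_prop) h.measurable

theorem apply_timeMap_eq (ρ : ℝ) (k : ℕ) (H : LinObservable d) {t : ℝ} (ht : 0 < t) :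
    H (φ.timeMap t) = Real.exp (ρ * t) * t ^ k * H (φ.scaled ρ k t) := by
  rw [apply_scaled, Real.exp_neg]
  have := Real.exp_pos (ρ * t)
  field_simp

end LinearFlow

theorem sFinite_of_isAddHaarMeasure {E : Type*} [NormedAddCommGroup E] [NormedSpace ℝ E]
    [FiniteDimensional ℝ E] [MeasurableSpace E] (μ : Measure E) [μ.IsAddHaarMeasure] :
    SFinite μ := by
  have : ProperSpace E := FiniteDimensional.proper ℝ E
  infer_instance

theorem isAddRightInvariant_of_isAddHaarMeasure {E : Type*} [NormedAddCommGroup E]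
    [MeasurableSpace E] [BorelSpace E] (μ : Measure E) [μ.IsAddHaarMeasure] :
    μ.IsAddRightInvariant := by
  infer_instance

theorem measurable_smul_add_smul {E : Type*} [NormedAddCommGroup E] [NormedSpace ℝ E]
    [MeasurableSpace E] [BorelSpace E] (x y : E) :
    Measurable fun p : ℝ × ℝ => p.1 • x + p.2 • y := by
  have : Continuous fun p : ℝ × ℝ => p.1 • x + p.2 • y := by fun_prop
  exact this.measurable

namespace LinearFlow

variable {d : ℕ} (φ : LinearFlow d)

theorem tendsto_apply_scaled_add {ρ θ : ℝ} {k : ℕ} {H₁ H₂ : LinObservable d}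
    (h₁ : Tendsto (fun t => H₁ (φ.scaled ρ k t) - Real.cos (θ * t)) atTop (𝓝 0))
    (h₂ : Tendsto (fun t => H₂ (φ.scaled ρ k t) - Real.sin (θ * t)) atTop (𝓝 0))
    (H : LinObservable d) (p : ℝ × ℝ) :
    Tendsto (fun t => (H + (p.1 • H₁ + p.2 • H₂)) (φ.scaled ρ k t) - H (φ.scaled ρ k t)
      - (p.1 * Real.cos (θ * t) + p.2 * Real.sin (θ * t))) atTop (𝓝 0) := by
  have := (h₁.const_mul p.1).add (h₂.const_mul p.2)
  rw [mul_zero, mul_zero, add_zero] at this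
  refine this.congr fun t => ?_
  simp only [add_apply, smul_apply, smul_eq_mul]
  ring

theorem ae_rarelySmall_scaled {z₀ : ℂ} (hz₀ : z₀ ∈ φ.domSpectrum) {W : Finset ℝ}
    (hW : ∀ w, w ∈ W ↔ ∃ z ∈ φ.domSpectrum, z.im = w)
    (μ : Measure (LinObservable d)) [μ.IsAddHaarMeasure] :
    ∀ᵐ H ∂μ, RarelySmall fun t => H (φ.scaled z₀.re (blockIndex φ.generator z₀) t) := by
  have : SFinite μ := sFinite_of_isAddHaarMeasure (E := LinObservable d) μ
  have : μ.IsAddRightInvariant :=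
    isAddRightInvariant_of_isAddHaarMeasure (E := LinObservable d) μ
  obtain ⟨H₁, H₂, h₁, h₂⟩ := φ.exists_observable_cos_sin hz₀
  exact ae_rarelySmall (sig := fun (H : LinObservable d) t =>
      H (φ.scaled z₀.re (blockIndex φ.generator z₀) t))
    (φ.measurable_apply_scaled _ _) (W := W) (fun H => φ.exists_trigPoly_scaled hz₀ hW H)
    (measurable_smul_add_smul (E := LinObservable d) H₁ H₂) (φ.tendsto_apply_scaled_add h₁ h₂)

/-- A resonance `sρ + w = 0` with `s = 2πn / log b` can be solved for `ρ / log b = -(1/n) (w / 2π)`,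
which the hypothesis forbids; so all Weyl means vanish once the limiting polynomial is rarely small.
-/
theorem ae_isBenford_of_notMem_span {b : ℕ} (hb : 2 ≤ b) {z₀ : ℂ} (hz₀ : z₀ ∈ φ.domSpectrum)
    {W : Finset ℝ} (hW : ∀ w, w ∈ W ↔ ∃ z ∈ φ.domSpectrum, z.im = w)
    (μ : Measure (LinObservable d)) [μ.IsAddHaarMeasure]
    (hres : z₀.re / Real.log b ∉
      Submodule.span ℚ ((fun w : ℝ => w / (2 * Real.pi)) '' (W : Set ℝ))) :
    ∀ᵐ H ∂μ, IsBenford b fun t => H (φ.timeMap t) := by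
  have hlog : Real.log b ≠ 0 := (Real.log_pos (by exact_mod_cast hb)).ne'
  filter_upwards [φ.ae_rarelySmall_scaled hz₀ hW μ] with H hH
  set k := blockIndex φ.generator z₀ with hk
  have hgm : Measurable fun t => H (φ.scaled z₀.re k t) :=
    (φ.measurable_apply_scaled z₀.re k).comp measurable_prodMk_left
  obtain ⟨c, hc⟩ := φ.exists_trigPoly_scaled hz₀ hW H
  have hPm := (continuous_trigPoly W c).measurable
  rw [isBenford_iff hb (φ.measurable_apply_timeMap H)]
  intro n hn
  refine (tendsto_mean_logPhase_iff _ z₀.re k (φ.measurable_apply_timeMap H) hgm hPm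
    (fun t ht => φ.apply_timeMap_eq z₀.re k H ht) hH hc).mpr ?_
  refine tendsto_twistedMean_character_mul_logPhase _ _ _ (hH.of_tendsto hgm hPm hc)
    fun w hw h0 => hres ?_
  have hn' : (n : ℝ) ≠ 0 := by exact_mod_cast hn
  have e : z₀.re / Real.log b = (-(n : ℚ)⁻¹) • (w / (2 * Real.pi)) := by
    rw [Rat.smul_def, eq_neg_of_add_eq_zero_right h0]
    push_cast
    field_simp
  rw [e]
  exact Submodule.smul_mem _ _ (div_mem_span_of_mem_closure hw)

/-- The sum of one cosine observable per frequency. With all coefficients equal to 1, means of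
powers of the limit become counts of tuples. -/
theorem exists_observable_trigPoly {z₀ : ℂ} (hz₀ : z₀ ∈ φ.domSpectrum) {W : Finset ℝ}
    (hW : ∀ w, w ∈ W ↔ ∃ z ∈ φ.domSpectrum, z.im = w) :
    ∃ H : LinObservable d, Tendsto (fun t => H (φ.scaled z₀.re (blockIndex φ.generator z₀) t)
      - trigPoly W (fun _ => 1) t) atTop (𝓝 0) := by
  have h : ∀ w : W, ∃ H : LinObservable d,
      Tendsto (fun t => H (φ.scaled z₀.re (blockIndex φ.generator z₀) t) - Real.cos (w * t))
        atTop (𝓝 0) := by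
    rintro ⟨w, hw⟩
    obtain ⟨z, hz, rfl⟩ := (hW w).mp hw
    obtain ⟨H, _, h, _⟩ := φ.exists_observable_cos_sin hz
    obtain ⟨h1, h2⟩ := domSpectrum_eq hz₀ hz
    rw [h1, h2] at h
    exact ⟨H, h⟩
  choose F hF using h
  refine ⟨∑ w, F w, ?_⟩
  have := tendsto_finsetSum (Finset.univ : Finset W) fun w _ => hF w
  rw [Finset.sum_const_zero] at this
  refine this.congr fun t => ?_
  rw [trigPoly_one_eq_sum_cos, Finset.sum_sub_distrib, sum_apply,
    Finset.sum_coe_sort W fun w => Real.cos (w * t)]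

/-- The bound is uniform in `H`, so nearby observables have uniformly close rescaled signals at late
times. This turns a dense set of observables into all of them. -/
theorem exists_eventually_abs_apply_scaled_le {z₀ : ℂ} (hz₀ : z₀ ∈ φ.domSpectrum) {W : Finset ℝ}
    (hW : ∀ w, w ∈ W ↔ ∃ z ∈ φ.domSpectrum, z.im = w) :
    ∃ C > 0, ∀ᶠ t in atTop, ∀ H : LinObservable d,
      |H (φ.scaled z₀.re (blockIndex φ.generator z₀) t)| ≤ C * ‖H‖ := by
  set k := blockIndex φ.generator z₀ with hk
  let e : ℝ → LinObservable d →ₗ[ℝ] ℝ := fun t =>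
    { toFun := fun H => H (φ.scaled z₀.re k t)
      map_add' := fun _ _ => rfl
      map_smul' := fun _ _ => rfl }
  refine exists_eventually_abs_le_mul_norm (E := LinObservable d) (e := e) fun H => ?_
  obtain ⟨c, hc⟩ := φ.exists_trigPoly_scaled hz₀ hW H
  refine ⟨∑ w ∈ W, ‖c w‖ + 1, ?_⟩
  filter_upwards [Metric.tendsto_nhds.mp hc 1 one_pos] with t ht
  rw [dist_zero_right, Real.norm_eq_abs] at ht
  have h1 := abs_trigPoly_le W c t
  have h2 := abs_add_le (H (φ.scaled z₀.re k t) - trigPoly W c t) (trigPoly W c t)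
  rw [sub_add_cancel] at h2
  change |H (φ.scaled z₀.re k t)| ≤ _
  exact h2.trans (by rw [add_comm]; exact add_le_add h1 ht.le)

/-- For almost every observable with Benford signal, the Gaussian average around the rescaled signal
has vanishing mean. -/
theorem ae_tendsto_twistedMean_gaussPhase {b : ℕ} (hb : 2 ≤ b) {z₀ : ℂ}
    (hz₀ : z₀ ∈ φ.domSpectrum) {W : Finset ℝ}
    (hW : ∀ w, w ∈ W ↔ ∃ z ∈ φ.domSpectrum, z.im = w)
    (μ : Measure (LinObservable d)) [μ.IsAddHaarMeasure]
    (h : ∀ᵐ H ∂μ, IsBenford b fun t => H (φ.timeMap t)) {n : ℤ} (hn : n ≠ 0) {s : ℝ}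
    (hs : s = 2 * Real.pi * n / Real.log b) :
    ∀ᵐ H ∂μ, Tendsto (twistedMean (s * (blockIndex φ.generator z₀ : ℝ)) fun t =>
      character (s * z₀.re) t * gaussPhase s (H (φ.scaled z₀.re (blockIndex φ.generator z₀) t)))
        atTop (𝓝 0) := by
  have : SFinite μ := sFinite_of_isAddHaarMeasure (E := LinObservable d) μ
  have : μ.IsAddRightInvariant :=
    isAddRightInvariant_of_isAddHaarMeasure (E := LinObservable d) μ
  obtain ⟨H₁, H₂, h₁, h₂⟩ := φ.exists_observable_cos_sin hz₀
  have hrs := φ.ae_rarelySmall_scaled hz₀ hW μ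
  set k := blockIndex φ.generator z₀ with hk
  have hgm : ∀ H : LinObservable d, Measurable fun t => H (φ.scaled z₀.re k t) := fun H =>
    (φ.measurable_apply_scaled z₀.re k).comp measurable_prodMk_left
  -- Almost every `H` is such that almost all its Gaussian perturbations are both Benford and rarely
  -- small.
  have hae := ae_ae_add_of_ae (μ := μ) (ν := (gaussianReal 0 1).prod (gaussianReal 0 1))
    (measurable_smul_add_smul (E := LinObservable d) H₁ H₂) (h.and hrs)
  filter_upwards [hae] with H hH
  refine tendsto_twistedMean_gaussPhase _ _ s z₀.im (hgm H) ?_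
  filter_upwards [hH] with p hp
  obtain ⟨hp1, hp2⟩ := hp
  have hm := (isBenford_iff hb (φ.measurable_apply_timeMap _)).mp hp1 n hn
  rw [← hs] at hm
  refine (tendsto_mean_logPhase_iff s z₀.re k (φ.measurable_apply_timeMap _) (hgm _)
    ((hgm H).add (by fun_prop)) (fun t ht => φ.apply_timeMap_eq z₀.re k _ ht) hp2 ?_).mp hm
  refine (φ.tendsto_apply_scaled_add h₁ h₂ H p).congr fun t => ?_
  exact sub_sub _ _ _

/-- A resonance makes all high even moments `M n` nonzero, while the Benford property makes the
products of moments and Taylor coefficients of the Gaussian phase vanish; but infinitely many even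
coefficients are nonzero. -/
theorem notMem_span_of_ae_isBenford {b : ℕ} (hb : 2 ≤ b) {z₀ : ℂ} (hz₀ : z₀ ∈ φ.domSpectrum)
    {W : Finset ℝ} (hW : ∀ w, w ∈ W ↔ ∃ z ∈ φ.domSpectrum, z.im = w)
    (μ : Measure (LinObservable d)) [μ.IsAddHaarMeasure]
    (h : ∀ᵐ H ∂μ, IsBenford b fun t => H (φ.timeMap t)) :
    z₀.re / Real.log b ∉ Submodule.span ℚ ((fun w : ℝ => w / (2 * Real.pi)) '' (W : Set ℝ)) := by
  intro hspan
  have hlog : 0 < Real.log b := Real.log_pos (by exact_mod_cast hb)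
  obtain ⟨N, hN, hv⟩ := exists_mul_mem_closure_of_mem_span hspan
  have hsymm : ∀ w ∈ W, -w ∈ W := by
    intro w hw
    obtain ⟨z, hz, rfl⟩ := (hW w).mp hw
    exact (hW _).mpr ⟨_, domSpectrum_conj hz, Complex.conj_im z⟩
  have hne : W.Nonempty := ⟨z₀.im, (hW _).mpr ⟨z₀, hz₀, rfl⟩⟩
  set v : ℝ := N * (2 * Real.pi * (z₀.re / Real.log b)) with hvdef
  -- The Weyl index is `2N` rather than `N`, in order that the resonant frequency `sρ = 2v` is even
  -- in the group generated by `W`.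
  set s : ℝ := 2 * Real.pi * ((2 * N : ℕ) : ℤ) / Real.log b with hs
  have hs0 : 0 < s := by
    have : (0 : ℝ) < N := by exact_mod_cast hN
    rw [hs]
    push_cast
    positivity
  have hsv : s * z₀.re = 2 * v := by
    rw [hs, hvdef]
    push_cast
    ring
  have hgood := φ.ae_tendsto_twistedMean_gaussPhase hb hz₀ hW μ h
    (n := ((2 * N : ℕ) : ℤ)) (by omega) hs
  obtain ⟨Hs, hHs⟩ := φ.exists_observable_trigPoly hz₀ hW
  obtain ⟨C, hC, hCt⟩ := φ.exists_eventually_abs_apply_scaled_le hz₀ hW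
  set k := blockIndex φ.generator z₀ with hk
  rw [hsv] at hgood
  -- A set of full measure is dense, so the particular observables `ε • Hs` can be approximated by
  -- good ones.
  have hdense := Measure.dense_of_ae hgood
  set P := trigPoly W fun _ => 1 with hP
  have hPm : Measurable P := (continuous_trigPoly W _).measurable
  have hPb : ∀ t, |P t| ≤ ∑ w ∈ W, ‖(1 : ℂ)‖ := abs_trigPoly_le W _
  have hmean : ∀ ε : ℝ, Tendsto (twistedMean (s * k) fun t =>
      character (2 * v) t * gaussPhase s (ε * P t)) atTop (𝓝 0) := by
    intro ε
    refine tendsto_twistedMean_gaussPhase_of_approx _ _ s (hPm.const_mul ε)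
      (B := |ε| * ∑ w ∈ W, ‖(1 : ℂ)‖) (fun t => ?_) fun δ hδ => ?_
    · rw [abs_mul]
      exact mul_le_mul_of_nonneg_left (hPb t) (abs_nonneg ε)
    · obtain ⟨H, hH, hHd⟩ := hdense.exists_dist_lt (ε • Hs) (show 0 < δ / 2 / C by positivity)
      refine ⟨fun t => H (φ.scaled z₀.re k t),
        (φ.measurable_apply_scaled z₀.re k).comp measurable_prodMk_left, hH, ?_⟩
      have h0 := hHs.const_mul ε
      rw [mul_zero] at h0
      filter_upwards [hCt, Metric.tendsto_nhds.mp h0 (δ / 2) (half_pos hδ)] with t h1 h2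
      rw [dist_zero_right, Real.norm_eq_abs] at h2
      have h3 := h1 (H - ε • Hs)
      have h4 : C * ‖H - ε • Hs‖ < δ / 2 := by
        rw [← lt_div_iff₀' hC]
        refine (dist_eq_norm H (ε • Hs)).symm.trans_lt ?_
        rwa [dist_comm]
      have e : H (φ.scaled z₀.re k t) - ε * P t = (H - ε • Hs) (φ.scaled z₀.re k t)
          + ε * (Hs (φ.scaled z₀.re k t) - P t) := by
        simp only [sub_apply, smul_apply, smul_eq_mul]
        ring
      rw [e]
      refine (abs_add_le _ _).trans ?_
      linarith
  obtain ⟨M, hM, n₀, hM0⟩ := exists_mean_pow_ne_zero (s * k) hsymm hne hv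
  obtain ⟨n, hn, hne, hcoeff⟩ := exists_gaussPhaseCoeff_ne_zero hs0 n₀
  have := coeff_mul_mean_eq_zero (s * k) (hasSum_gaussPhase s) (bddMeas_character (2 * v)).1
    (norm_character (2 * v)) hPm hPb (M := M) (fun n => by
      refine (hM n).congr fun T => ?_
      congr 1
      ext t
      rw [character_sum_eq_trigPoly hsymm]) hmean n
  exact (mul_ne_zero hcoeff (hM0 n hn hne)) this

end LinearFlow

/-- `μ` is Lebesgue measure on `𝓞(X) ≅ ℝ^(d²)` with respect to an arbitrary choice of basis, i.e.
an arbitrary additive Haar measure; the null sets do not depend on the choice. -/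
theorem theorem3p10 (d : ℕ) (hd : 1 ≤ d) (b : ℕ) (hb : 2 ≤ b) (φ : LinearFlow d)
    (μ : Measure (LinObservable d)) [μ.IsAddHaarMeasure] :
    IsExpNonresonant b φ.domSpectrum ↔
      ∀ᵐ H ∂μ, IsBenford b (fun t : ℝ => H (φ.timeMap t)) := by
  have hfin : φ.domSpectrum.Finite := finite_domSpectrum φ.generator
  have hne : φ.domSpectrum.Nonempty := domSpectrum_nonempty hd φ.generator
  obtain ⟨z₀, hz₀⟩ := id hne
  let W : Finset ℝ := (hfin.image Complex.im).toFinset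
  have hW : ∀ w, w ∈ W ↔ ∃ z ∈ φ.domSpectrum, z.im = w := fun w => by simp [W]
  rw [isExpNonresonant_iff hfin hne (fun z hz => domSpectrum_conj hz) (ρ := z₀.re)
    fun z hz => (domSpectrum_eq hz₀ hz).1]
  have e : (fun z : ℂ => z.im / (2 * Real.pi)) '' φ.domSpectrum
      = (fun w : ℝ => w / (2 * Real.pi)) '' (W : Set ℝ) := by
    rw [Set.Finite.coe_toFinset, image_image]
  rw [e]
  exact ⟨φ.ae_isBenford_of_notMem_span hb hz₀ hW μ, φ.notMem_span_of_ae_isBenford hb hz₀ hW μ⟩
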